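/- Let $n\ge 0$ be an integer, $\lambda=1+\frac1{n+1}$ and $\psi_\infty>0$. Spheres in $\mathbb R^3$ are smooth, rotationally symmetric, and parameterized by the inverse of the Gauss map, with $\theta\in[0,\pi]$ the polar angle of the unit normal $N$. Let $r_2$ be the radius of curvature of the profile curve, $r_1$ the other radius of curvature, and $s=\frac12(r_1-r_2)$ (the astigmatism), a function of $\theta$. The linear Hopf flow is the evolution $\big(\frac{\partial \vec X}{\partial t}\big)^{\perp}=-\mathbb K\,N$ with $\mathbb K=\frac12(r_1+r_2)+\frac\lambda2(r_1-r_2)-\psi_\infty$, by such spheres, smooth up to the initial time (the spheres may pass through their focal sets). Put $P^n_l(x)=\frac{(-1)^n}{2^l\,l!}(1-x^2)^{n/2}\frac{d^{l+n}}{dx^{l+n}}(x^2-1)^l$ and $$\mu_l=\frac{(2l+1)(n-l)}{n+1},\qquad \nu_l=\frac{2l(n-l)}{n+1},\qquad \omega_l=\frac{l(l+1)-n(n+1)}{2(n+1)},$$ where the index of $\mu$ may be a half-integer, and for $0\le l<n$, $1\le m\le n-l-1$ and $\delta\in\{0,\frac12\}$ put $$\kappa^{\delta}_{l,m}=(-1)^{n-l-m}\,\frac{\prod_{p=m}^{n-l-1}\nu_{n-p}}{\prod_{q=m+1}^{n-l}\big(\mu_{n-m+\delta}-\mu_{n-q+\delta}\big)}.$$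 Let $S_0$ be a convex such sphere whose astigmatism has an expansion $$s(0)=\sum_{l=0}^{n-1}(a_l+b_l\cos\theta)\sin^{2l+2}\theta+\sum_{l=n}^\infty c_l\sin^{2+n}\theta\,P^n_l(\cos\theta),\qquad (*)$$ with constants $a_l,b_l,c_l$, where the series converges uniformly relative to $\sin^{2n+2}\theta$ (the error of the partial sums is at most $\varepsilon\sin^{2n+2}\theta$ on $[0,\pi]$, for every $\varepsilon>0$, from some partial sum on). Then there are unique constants $\tilde a_l,\tilde b_l$ $(0\le l<n)$ with $$a_l=\tilde a_l+\sum_{m=1}^{n-l-1}\kappa^{0}_{l,m}\,\tilde a_{n-m},\qquad b_l=\tilde b_l+\sum_{m=1}^{n-l-1}\kappa^{1/2}_{l,m}\,\tilde b_{n-m},$$ and with $$A_l(t)=\tilde a_le^{\mu_lt}+\sum_{m=1}^{n-l-1}\kappa^{0}_{l,m}\,\tilde a_{n-m}e^{\mu_{n-m}t},\qquad B_l(t)=\tilde b_le^{\mu_{l+\frac12}t}+\sum_{m=1}^{n-l-1}\kappa^{1/2}_{l,m}\,\tilde b_{n-m}e^{\mu_{n-m+\frac12}t}$$ (so that $A_{n-1}=\tilde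 a_{n-1}e^{\mu_{n-1}t}$ and $B_{n-1}=\tilde b_{n-1}e^{\mu_{n-\frac12}t}$ if $n\geq 1$) the function $$s(\theta,t)=\sum_{l=0}^{n-1}\big[A_l(t)+B_l(t)\cos\theta\big]\sin^{2l+2}\theta+\sin^{2+n}\theta\sum_{l=n}^\infty c_l\,P^n_l(\cos\theta)\,e^{-\omega_lt}$$ is well defined for $0\le\theta\le\pi$ and $t\ge0$, the series converging in the same sense as in $(*)$ for each $t$. It is continuous there, equals $s(0)$ at $t=0$, vanishes at $\theta=0,\pi$, and for $t>0$, $0<\theta<\pi$ it satisfies the astigmatism equation $$\frac{\partial s}{\partial t}=\frac{\lambda-1}{2\sin\theta}\frac{\partial}{\partial \theta}\Big(\sin\theta\frac{\partial s}{\partial \theta}\Big)-\lambda\cot\theta\frac{\partial s }{\partial \theta} +\frac{1+\cos^2\theta}{\sin^2\theta}\, s .$$ For every linear Hopf flow on a time interval $[0,T)$, $T>0$, that starts at $S_0$, the astigmatism at time $t\in[0,T)$ is $s(\cdot,t)$. -/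

import Mathlib

open scoped ContDiff Manifold

noncomputable section

/-- Euclidean 3-space. -/
abbrev E3 : Type := EuclideanSpace ℝ (Fin 3)

/-- The unit sphere in Euclidean 3-space. -/
abbrev S2 : Type := Metric.sphere (0 : E3) 1

/-! ### Polar coordinates and the orthonormal polar frame on the unit sphere -/

/-- The point with polar angle `θ` and azimuth `φ`. -/
def polarPoint (θ φ : ℝ) : S2 :=
  ⟨!₂[Real.sin θ * Real.cos φ, Real.sin θ * Real.sin φ, Real.cos θ], by
    rw [mem_sphere_zero_iff_norm, EuclideanSpace.norm_eq, Real.sqrt_eq_one]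
    simp [Fin.sum_univ_three]
    nlinarith [Real.sin_sq_add_cos_sq θ, Real.sin_sq_add_cos_sq φ]⟩

/-- The unit tangent vector `∂/∂θ` at `polarPoint θ φ` (direction of the profile curve). -/
def meridianDir (θ φ : ℝ) : S2 :=
  ⟨!₂[Real.cos θ * Real.cos φ, Real.cos θ * Real.sin φ, -Real.sin θ], by
    rw [mem_sphere_zero_iff_norm, EuclideanSpace.norm_eq, Real.sqrt_eq_one]
    simp [Fin.sum_univ_three]
    nlinarith [Real.sin_sq_add_cos_sq θ, Real.sin_sq_add_cos_sq φ]⟩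

/-- The unit tangent vector `(1 / sin θ) ∂/∂φ` at `polarPoint θ φ`. -/
def parallelDir (φ : ℝ) : S2 :=
  ⟨!₂[-Real.sin φ, Real.cos φ, 0], by
    rw [mem_sphere_zero_iff_norm, EuclideanSpace.norm_eq, Real.sqrt_eq_one]
    simp [Fin.sum_univ_three]⟩

theorem inner_polarPoint_meridianDir (θ φ : ℝ) :
    inner ℝ (polarPoint θ φ : E3) (meridianDir θ φ : E3) = 0 := by
  simp [polarPoint, meridianDir, PiLp.inner_apply, Fin.sum_univ_three]
  linear_combination
    (Real.sin θ * Real.cos θ) * (Real.sin_sq_add_cos_sq φ)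

theorem inner_polarPoint_parallelDir (θ φ : ℝ) :
    inner ℝ (polarPoint θ φ : E3) (parallelDir φ : E3) = 0 := by
  simp [polarPoint, parallelDir, PiLp.inner_apply, Fin.sum_univ_three]
  ring

/-- The unit speed great circle that leaves `p` in the unit tangent direction `e`. -/
def greatCircle (p e : S2) (h : inner ℝ (p : E3) (e : E3) = 0) (τ : ℝ) : S2 :=
  ⟨Real.cos τ • (p : E3) + Real.sin τ • (e : E3), by
    have hp : ‖(p : E3)‖ = 1 := mem_sphere_zero_iff_norm.1 p.2
    have he : ‖(e : E3)‖ = 1 := mem_sphere_zero_iff_norm.1 e.2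
    rw [mem_sphere_zero_iff_norm, ← sq_eq_sq₀ (norm_nonneg _) zero_le_one,
      norm_add_sq_real, inner_smul_left, inner_smul_right, h, norm_smul, norm_smul, hp, he]
    simp⟩

/-- The directional derivative `dX_p(e)` of a map `X` on the unit sphere along the unit tangent
vector `e` at `p`. -/
def dirDeriv (X : S2 → E3) (p e : S2) (h : inner ℝ (p : E3) (e : E3) = 0) : E3 :=
  deriv (fun τ => X (greatCircle p e h τ)) 0

/-- Rotation of Euclidean 3-space through the angle `α` about the third axis. -/
def rotZ (α : ℝ) (y : E3) : E3 :=
  !₂[Real.cos α * y 0 - Real.sin α * y 1, Real.sin α * y 0 + Real.cos α * y 1, y 2]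

/-! ### Rotationally symmetric spheres in Gauss coordinates -/

/-- `X` is a smooth rotationally symmetric sphere (about the third axis), parameterized by the
inverse of its Gauss map: the unit normal at `X p` is `p`. As such a sphere may pass through its
focal set when it moves, `X` is not required to be an immersion here. -/
structure IsRotSphere (X : S2 → E3) : Prop where
  smooth : ContMDiff (𝓡 2) 𝓘(ℝ, E3) ∞ X
  normal : ∀ (p e : S2) (h : inner ℝ (p : E3) (e : E3) = 0),
    inner ℝ (dirDeriv X p e h) (p : E3) = 0
  symmetric : ∀ (α : ℝ) (p q : S2), (q : E3) = rotZ α (p : E3) → X q = rotZ α (X p)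

/-- The radius of curvature `r₂` of the profile curve, at the point with normal
`polarPoint θ φ`. The derivative of the position with respect to the unit normal is
diagonal in the polar frame, and the radii of curvature are its eigenvalues. -/
def profileRadius (X : S2 → E3) (θ φ : ℝ) : ℝ :=
  inner ℝ (dirDeriv X (polarPoint θ φ) (meridianDir θ φ) (inner_polarPoint_meridianDir θ φ))
    (meridianDir θ φ : E3)

/-- The other radius of curvature `r₁`, at the point with normal `polarPoint θ φ`. -/
def parallelRadius (X : S2 → E3) (θ φ : ℝ) : ℝ :=
  inner ℝ (dirDeriv X (polarPoint θ φ) (parallelDir φ) (inner_polarPoint_parallelDir θ φ))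
    (parallelDir φ : E3)

/-- The sphere is (strictly) convex: both radii of curvature are positive. -/
def IsConvexSphere (X : S2 → E3) : Prop :=
  ∀ θ φ : ℝ, 0 < parallelRadius X θ φ ∧ 0 < profileRadius X θ φ

/-- The astigmatism `s = (r₁ - r₂) / 2` of a rotationally symmetric sphere, as a function of the
polar angle `θ` of the normal. -/
def astigmatism (X : S2 → E3) (θ : ℝ) : ℝ :=
  (parallelRadius X θ 0 - profileRadius X θ 0) / 2

/-! ### The linear Hopf flow -/

/-- The speed `(r₁ + r₂) / 2 + lam (r₁ - r₂) / 2 - psiInf`. -/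
def hopfSpeed (lam psiInf : ℝ) (X : S2 → E3) (θ φ : ℝ) : ℝ :=
  (parallelRadius X θ φ + profileRadius X θ φ) / 2
    + lam / 2 * (parallelRadius X θ φ - profileRadius X θ φ) - psiInf

/-- `X` is a linear Hopf flow of rotationally symmetric spheres on the time interval `[0, T)`: it is
smooth up to the initial time, and the normal part of its velocity is `-K N`. -/
structure IsLinearHopfFlow (lam psiInf T : ℝ) (X : S2 → ℝ → E3) : Prop where
  smooth : ContMDiffOn ((𝓡 2).prod 𝓘(ℝ, ℝ)) 𝓘(ℝ, E3) ∞ (fun x : S2 × ℝ => X x.1 x.2)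
    (Set.univ ×ˢ Set.Ico 0 T)
  sphere : ∀ t ∈ Set.Ico 0 T, IsRotSphere (fun p => X p t)
  flow : ∀ t ∈ Set.Ico 0 T, ∀ θ φ : ℝ,
    inner ℝ (derivWithin (fun τ => X (polarPoint θ φ) τ) (Set.Ico 0 T) t)
        (polarPoint θ φ : E3) • (polarPoint θ φ : E3)
      = -(hopfSpeed lam psiInf (fun p => X p t) θ φ) • (polarPoint θ φ : E3)

/-- The integer coefficient `lam = 1 + 1 / (n + 1)`. -/
def hopfLam (n : ℕ) : ℝ := 1 + 1 / ((n : ℝ) + 1)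

/-- `s t θ` solves the initial value problem, with Dirichlet boundary conditions, for the
astigmatism under linear Hopf flow:
`s_t = (lam - 1) / (2 sin θ) (sin θ s_θ)_θ - lam cot θ s_θ + (1 + cos² θ) / sin² θ s`. -/
structure SolvesAstigmatismEquation (lam : ℝ) (s₀ : ℝ → ℝ) (s : ℝ → ℝ → ℝ) : Prop where
  continuousOn : ContinuousOn (fun x : ℝ × ℝ => s x.1 x.2) (Set.Ici 0 ×ˢ Set.Icc 0 Real.pi)
  initial : ∀ θ ∈ Set.Icc 0 Real.pi, s 0 θ = s₀ θ
  boundary : ∀ t, 0 ≤ t → s t 0 = 0 ∧ s t Real.pi = 0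
  differentiable_time : ∀ t, 0 < t → ∀ θ ∈ Set.Ioo 0 Real.pi,
    DifferentiableAt ℝ (fun τ => s τ θ) t
  differentiable_angle : ∀ t, 0 < t → ∀ θ ∈ Set.Ioo 0 Real.pi, DifferentiableAt ℝ (s t) θ
  differentiable_angle_two : ∀ t, 0 < t → ∀ θ ∈ Set.Ioo 0 Real.pi,
    DifferentiableAt ℝ (deriv (s t)) θ
  equation : ∀ t, 0 < t → ∀ θ ∈ Set.Ioo 0 Real.pi,
    deriv (fun τ => s τ θ) t
      = (lam - 1) / (2 * Real.sin θ) * deriv (fun x => Real.sin x * deriv (s t) x) θ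
        - lam * (Real.cos θ / Real.sin θ) * deriv (s t) θ
        + (1 + Real.cos θ ^ 2) / Real.sin θ ^ 2 * s t θ

/-! ### Associated Legendre polynomials and the mode expansion -/

/-- The associated Legendre polynomial
`P^n_l(x) = (-1)^n / (2^l l!) (1 - x²)^(n/2) (d/dx)^(l+n) (x² - 1)^l`. -/
def assocLegendre (n l : ℕ) (x : ℝ) : ℝ :=
  (-1) ^ n / (2 ^ l * (Nat.factorial l : ℝ)) * Real.sqrt (1 - x ^ 2) ^ n
    * (Polynomial.derivative^[l + n]
        ((Polynomial.X ^ 2 - 1 : Polynomial ℝ) ^ l)).eval x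

/-- The expansion
`s(θ) = ∑_{l < n} (a_l + b_l cos θ) sin^{2l+2} θ + ∑_{l ≥ n} c_l sin^{2+n} θ P^n_l(cos θ)` on
`[0, π]`, where the series is of order `2n+2` at the poles: it converges uniformly relative to
`sin^{2n+2} θ`. -/
def HasModeExpansion (n : ℕ) (s : ℝ → ℝ) (a b c : ℕ → ℝ) : Prop :=
  ∀ ε : ℝ, 0 < ε → ∃ N₀ : ℕ, ∀ N : ℕ, N₀ ≤ N → ∀ θ ∈ Set.Icc 0 Real.pi,
    |s θ - ((∑ l ∈ Finset.range n, (a l + b l * Real.cos θ) * Real.sin θ ^ (2 * l + 2))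
        + ∑ l ∈ Finset.Ico n N,
            c l * (Real.sin θ ^ (2 + n) * assocLegendre n l (Real.cos θ)))|
      ≤ ε * Real.sin θ ^ (2 * n + 2)

/-! ### The explicit amplitudes -/

/-- `μ_x = (2x + 1)(n - x) / (n + 1)`; the index `x` may be a half-integer. -/
def rateMu (n : ℕ) (x : ℝ) : ℝ := (2 * x + 1) * ((n : ℝ) - x) / ((n : ℝ) + 1)

/-- `ν_x = 2x(n - x) / (n + 1)`. -/
def rateNu (n : ℕ) (x : ℝ) : ℝ := 2 * x * ((n : ℝ) - x) / ((n : ℝ) + 1)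

/-- `ω_l = (l(l + 1) - n(n + 1)) / (2(n + 1))`. -/
def rateOmega (n l : ℕ) : ℝ :=
  ((l : ℝ) * ((l : ℝ) + 1) - (n : ℝ) * ((n : ℝ) + 1)) / (2 * ((n : ℝ) + 1))

/-- The coefficient
`(-1)^{n-l-m} ∏_{p=m}^{n-l-1} ν_{n-p} / ∏_{q=m+1}^{n-l} (μ_{n-m+δ} - μ_{n-q+δ})`. -/
def modeCoeff (n : ℕ) (δ : ℝ) (l m : ℕ) : ℝ :=
  (-1) ^ (n - l - m) * (∏ p ∈ Finset.Icc m (n - l - 1), rateNu n ((n : ℝ) - p))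
    / ∏ q ∈ Finset.Icc (m + 1) (n - l),
        (rateMu n ((n : ℝ) - m + δ) - rateMu n ((n : ℝ) - q + δ))

/-- The amplitude with constants `x` (`δ = 0` for `A_l`, and `δ = 1/2` for `B_l`):
`x_l e^{μ_{l+δ} t} + ∑_{m=1}^{n-l-1} modeCoeff n δ l m x_{n-m} e^{μ_{n-m+δ} t}`, for `l < n`. -/
def modeAmplitude (n : ℕ) (δ : ℝ) (x : ℕ → ℝ) (l : ℕ) (t : ℝ) : ℝ :=
  x l * Real.exp (rateMu n ((l : ℝ) + δ) * t)
    + ∑ m ∈ Finset.Icc 1 (n - l - 1),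
        modeCoeff n δ l m * x (n - m) * Real.exp (rateMu n ((n : ℝ) - m + δ) * t)

/-- The constants `x_l`, `l < n`, are related to the initial constants `a_l` by
`a_l = x_l + ∑_{m=1}^{n-l-1} modeCoeff n δ l m x_{n-m}`. -/
def InitialRelation (n : ℕ) (δ : ℝ) (a x : ℕ → ℝ) : Prop :=
  ∀ l, l < n → a l = x l + ∑ m ∈ Finset.Icc 1 (n - l - 1), modeCoeff n δ l m * x (n - m)

end

/-! Write `s = sin² θ U(t, cos θ)` and `e = 1 / (2 (n + 1))`, so that `lam = 1 + 2 e`. The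
astigmatism equation becomes the reduced equation `U_t = e (1 - x²) U_xx + (1 - 4 e) x U_x + (1 - 2
e) U` on `-1 < x < 1`. Its right side sends `(1 - x²)^l` to `μ_l (1 - x²)^l - ν_l (1 - x²)^(l-1)`,
and likewise for `x (1 - x²)^l` with `μ_{l+1/2}`. Since `ν_n = 0`, the powers `l < n` and the
multiples of `(1 - x²)^n` evolve separately.

Existence. On the powers `l < n` the equation is a triangular linear system of ODEs, solved
explicitly by the amplitudes (`hasDerivAt_modeAmplitude`, `isReducedSolution_polynomialPart`). On `U
= (1 - x²)^n V` it is a Gegenbauer equation for `V`, whose eigenfunctions are the polynomial factors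
of `P^n_l`. The series is only assumed to converge uniformly at `t = 0`. Abel's test with the
weights `e^{-ω_l t}` carries the uniform convergence to all `t ≥ 0`; for `t > 0` a Markov inequality
allows termwise differentiation (`exists_mode_series`).

Uniqueness. The support function of a flow satisfies a linear equation in `x = cos θ`, and minus
half its second `x`-derivative is `U`, which solves the reduced equation. The difference from the
explicit solution has zero initial values, and a maximum principle (`IsReducedSolution.nonpos`)
gives its vanishing once it is controlled at the poles. For `n = 0` boundedness suffices, with a
logarithmic barrier. For `n ≥ 1` it must tend to zero there. This follows from smoothness of the
flow: with `x = 1 - 2 τ²`, the Taylor coefficient of order `k` of `τ³ U` is coupled only to that of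
order `k + 2`, with a factor that vanishes at `k = 2 n + 1` (`hasDerivAt_taylorCoeff_at_pole`). The
orders `3, 5, ..., 2 n + 1` therefore form a closed linear system; after subtraction of the
polynomial part they vanish at `t = 0`, hence always (`exists_bound_at_pole`).
`IsLinearHopfFlow.reduced_eq` combines these facts. -/

/-! ### The polynomial factors of the associated Legendre functions. -/

open Polynomial in
/-- The polynomial factor of the associated Legendre function `P^n_l`. -/
noncomputable def legendreFactor (n l : ℕ) : Polynomial ℝ :=
  C ((-1) ^ n / (2 ^ l * (Nat.factorial l : ℝ))) * derivative^[l + n] ((X ^ 2 - 1) ^ l)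

theorem assocLegendre_eq (n l : ℕ) (x : ℝ) :
    assocLegendre n l x = Real.sqrt (1 - x ^ 2) ^ n * (legendreFactor n l).eval x := by
  simp only [assocLegendre, legendreFactor, Polynomial.eval_mul, Polynomial.eval_C]
  ring

theorem natDegree_legendreFactor_le (n l : ℕ) : (legendreFactor n l).natDegree ≤ l := by
  refine (Polynomial.natDegree_C_mul_le _ _).trans
    ((Polynomial.natDegree_iterate_derivative _ _).trans ?_)
  have h : ((Polynomial.X ^ 2 - 1 : Polynomial ℝ) ^ l).natDegree ≤ l * 2 := by
    refine Polynomial.natDegree_pow_le_of_le l ?_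
    compute_degree
  omega

-- Repeated differentiation of `(X² - 1) W' = 2 l X W` for `W = (X² - 1)^l`.
open Polynomial in
theorem iterate_derivative_sq_sub_one_pow (l m : ℕ) :
    (X ^ 2 - 1) * derivative^[m + 2] ((X ^ 2 - 1 : ℝ[X]) ^ l)
      + C (2 * ((m : ℝ) + 1) - 2 * l) * X * derivative^[m + 1] ((X ^ 2 - 1 : ℝ[X]) ^ l)
      + C (((m : ℝ) + 1) * (m - 2 * l)) * derivative^[m] ((X ^ 2 - 1 : ℝ[X]) ^ l) = 0 := by
  set W : ℝ[X] := (X ^ 2 - 1) ^ l with hW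
  have h0 : (X ^ 2 - 1) * derivative W = C (2 * (l : ℝ)) * X * W := by
    rcases l with _ | l
    · simp [hW]
    · rw [hW, derivative_pow, pow_succ (X ^ 2 - 1 : ℝ[X]) l]
      simp only [derivative_sub, derivative_X_pow, derivative_one, map_mul, map_natCast,
        Nat.add_sub_cancel]
      push_cast
      simp only [map_ofNat]
      ring
  induction m with
  | zero =>
    have h1 := congrArg derivative h0
    simp only [derivative_mul, derivative_sub, derivative_X_pow, derivative_one, derivative_C,
      derivative_X] at h1
    simp only [Function.iterate_succ', Function.comp, Function.iterate_zero, id, zero_add]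
    simp only [map_add, map_sub, map_mul, map_one, map_ofNat, map_natCast, map_zero,
      Nat.cast_zero] at h1 ⊢
    push_cast at h1
    linear_combination h1
  | succ m ih =>
    have h1 := congrArg derivative ih
    simp only [derivative_mul, derivative_add, derivative_sub, derivative_X_pow, derivative_one,
      derivative_C, derivative_X, derivative_zero] at h1
    simp only [← Function.iterate_succ_apply' derivative] at h1
    simp only [map_add, map_sub, map_mul, map_one, map_ofNat, map_natCast, Nat.cast_succ,
      Nat.succ_eq_add_one] at h1 ⊢
    push_cast at h1
    linear_combination h1

-- The case of `l + n` derivatives: the constant `(l + n + 1)(n - l)` equals `n (n + 1) - l (l +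
-- 1)`. After multiplication by `e = 1 / (2 (n + 1))` this exhibits `-ω_l` as the eigenvalue.
open Polynomial in
theorem legendreFactor_equation (n l : ℕ) (x : ℝ) :
    (1 - x ^ 2) * (derivative (derivative (legendreFactor n l))).eval x
      - 2 * ((n : ℝ) + 1) * x * (derivative (legendreFactor n l)).eval x
      + ((l : ℝ) * (l + 1) - n * (n + 1)) * (legendreFactor n l).eval x = 0 := by
  have h := congrArg (eval x) (iterate_derivative_sq_sub_one_pow l (l + n))
  simp only [legendreFactor, derivative_C_mul, ← Function.iterate_succ_apply' derivative,
    Nat.succ_eq_add_one]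
  simp only [eval_add, eval_sub, eval_mul, eval_C, eval_X, eval_pow, eval_one, eval_zero] at h ⊢
  push_cast at h
  linear_combination (-((-1) ^ n / (2 ^ l * (Nat.factorial l : ℝ)))) * h

/-! ### A derivative bound for polynomials on `[-1, 1]`. -/

namespace Polynomial

/-- Among polynomials bounded by one on `[-1, 1]`, the Chebyshev polynomial has the largest
derivative at the endpoint `1`, namely `d²`. The affine map of `[-1, 1]` onto `[-1, x]` moves that
endpoint to `x`; its slope `(1 + x) / 2` is at least `1 / 2`, whence the factor 2. -/
theorem abs_eval_derivative_le_of_nonneg {d : ℕ} {P : ℝ[X]} (hd : P.natDegree ≤ d) {M : ℝ}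
    (hM : ∀ x ∈ Set.Icc (-1 : ℝ) 1, |P.eval x| ≤ M) {x : ℝ} (hx : x ∈ Set.Icc (0 : ℝ) 1) :
    (derivative P).eval x ≤ 2 * (d : ℝ) ^ 2 * M := by
  refine le_of_forall_pos_le_add fun η hη => ?_
  have hM0 : 0 ≤ M := (abs_nonneg _).trans (hM 0 (by simp))
  -- `M` may be zero, so the normalization divides by a slightly larger constant; the excess costs
  -- at most `η` in the end.
  set M' := M + η / (2 * (d : ℝ) ^ 2 + 1) with hM'
  have hpos : 0 < 2 * (d : ℝ) ^ 2 + 1 := by positivity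
  have hM'pos : 0 < M' := by positivity
  set R : ℝ[X] := C M'⁻¹ * P.comp (C ((1 + x) / 2) * X + C (-(1 - x) / 2)) with hR
  have hdeg : R.degree ≤ d := by
    refine natDegree_le_iff_degree_le.1 ((natDegree_C_mul_le _ _).trans (natDegree_comp_le.trans ?_))
    calc P.natDegree * _ ≤ d * 1 := Nat.mul_le_mul hd (by compute_degree)
      _ = d := mul_one d
  have hbd : ∀ y ∈ Set.Icc (-1 : ℝ) 1, |R.eval y| ≤ 1 := by
    intro y hy
    simp only [hR, eval_mul, eval_C, eval_comp, eval_add, eval_X, abs_mul, abs_inv,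
      abs_of_pos hM'pos]
    rw [inv_mul_le_one₀ hM'pos]
    refine (hM _ ⟨?_, ?_⟩).trans (by rw [hM']; have : 0 ≤ η / (2 * (d : ℝ) ^ 2 + 1) := by positivity
                                     linarith) <;>
      nlinarith [hy.1, hy.2, hx.1, hx.2]
  have h := Chebyshev.eval_iterate_derivative_le_of_forall_abs_le_one (k := 1) le_rfl hdeg hbd
  have hT : (derivative (Chebyshev.T ℝ d)).eval 1 = (d : ℝ) ^ 2 := by
    simpa using Chebyshev.derivative_T_eval_one (R := ℝ) d
  simp only [Function.iterate_one, hT] at h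
  simp only [hR, derivative_comp, eval_mul, eval_C, eval_comp, eval_add, eval_X,
    derivative_add, derivative_C, derivative_mul, derivative_X] at h
  have e1 : (1 + x) / 2 * 1 + -(1 - x) / 2 = x := by ring
  rw [e1] at h
  simp only [eval_zero, eval_one, zero_mul, mul_one, zero_add, add_zero] at h
  rw [inv_mul_le_iff₀ hM'pos] at h
  have e2 : 2 * (d : ℝ) ^ 2 * M' ≤ 2 * (d : ℝ) ^ 2 * M + η := by
    rw [hM', mul_add]
    have : 2 * (d : ℝ) ^ 2 * (η / (2 * (d : ℝ) ^ 2 + 1)) ≤ η := by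
      rw [mul_div_assoc', div_le_iff₀ hpos]; nlinarith
    linarith
  by_cases h0 : 0 ≤ (derivative P).eval x
  · nlinarith [hx.1]
  · have : 0 ≤ 2 * (d : ℝ) ^ 2 * M := by positivity
    linarith

/-- A weak form of Markov's inequality. -/
theorem abs_eval_derivative_le {d : ℕ} {P : ℝ[X]} (hd : P.natDegree ≤ d) {M : ℝ}
    (hM : ∀ x ∈ Set.Icc (-1 : ℝ) 1, |P.eval x| ≤ M) {x : ℝ} (hx : x ∈ Set.Icc (-1 : ℝ) 1) :
    |(derivative P).eval x| ≤ 2 * (d : ℝ) ^ 2 * M := by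
  have key : ∀ Q : ℝ[X], Q.natDegree ≤ d → (∀ x ∈ Set.Icc (-1 : ℝ) 1, |Q.eval x| ≤ M) →
      ∀ x ∈ Set.Icc (0 : ℝ) 1, |(derivative Q).eval x| ≤ 2 * (d : ℝ) ^ 2 * M := by
    intro Q hQ hQM y hy
    refine abs_le'.2 ⟨abs_eval_derivative_le_of_nonneg hQ hQM hy, ?_⟩
    simpa using abs_eval_derivative_le_of_nonneg (P := -Q) (by simpa using hQ)
      (by simpa using hQM) hy
  rcases le_total 0 x with h | h
  · exact key P hd hM x ⟨h, hx.2⟩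
  · have := key (P.comp (-X)) (by rw [natDegree_comp]; simpa using hd)
      (fun y hy => by
        simpa using hM (-y) ⟨by linarith [hy.2], by linarith [hy.1]⟩) (-x)
      ⟨by linarith, by linarith [hx.1]⟩
    simpa [derivative_comp] using this

end Polynomial

/-! ### The reduced equation in the variable `x = cos θ`. -/

/-- `U t x` is a classical solution, for `t ∈ I` and `-1 < x < 1`, of
`U_t = e (1 - x²) U_xx + (1 - 4 e) x U_x + (1 - 2 e) U`; for `lam = 1 + 2 e` and `x = cos θ` this
is the astigmatism equation for `s = sin² θ U`. -/
def IsReducedSolution (e : ℝ) (I : Set ℝ) (U : ℝ → ℝ → ℝ) : Prop :=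
  ∃ Ux Uxx : ℝ → ℝ → ℝ, ∀ t ∈ I, ∀ x ∈ Set.Ioo (-1 : ℝ) 1,
    HasDerivAt (U t) (Ux t x) x ∧ HasDerivAt (Ux t) (Uxx t x) x ∧
    HasDerivAt (fun τ => U τ x)
      (e * (1 - x ^ 2) * Uxx t x + (1 - 4 * e) * x * Ux t x + (1 - 2 * e) * U t x) t

namespace IsReducedSolution

variable {e : ℝ} {I : Set ℝ} {U V : ℝ → ℝ → ℝ}

theorem mono {J : Set ℝ} (h : IsReducedSolution e I U) (hJ : J ⊆ I) :
    IsReducedSolution e J U := by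
  obtain ⟨Ux, Uxx, h⟩ := h
  exact ⟨Ux, Uxx, fun t ht => h t (hJ ht)⟩

theorem add (hU : IsReducedSolution e I U) (hV : IsReducedSolution e I V) :
    IsReducedSolution e I (fun t x => U t x + V t x) := by
  obtain ⟨Ux, Uxx, hU⟩ := hU
  obtain ⟨Vx, Vxx, hV⟩ := hV
  refine ⟨fun t x => Ux t x + Vx t x, fun t x => Uxx t x + Vxx t x, fun t ht x hx => ?_⟩
  obtain ⟨h1, h2, h3⟩ := hU t ht x hx
  obtain ⟨k1, k2, k3⟩ := hV t ht x hx
  exact ⟨h1.add k1, h2.add k2, (h3.add k3).congr_deriv (by ring)⟩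

theorem sub (hU : IsReducedSolution e I U) (hV : IsReducedSolution e I V) :
    IsReducedSolution e I (fun t x => U t x - V t x) := by
  obtain ⟨Ux, Uxx, hU⟩ := hU
  obtain ⟨Vx, Vxx, hV⟩ := hV
  refine ⟨fun t x => Ux t x - Vx t x, fun t x => Uxx t x - Vxx t x, fun t ht x hx => ?_⟩
  obtain ⟨h1, h2, h3⟩ := hU t ht x hx
  obtain ⟨k1, k2, k3⟩ := hV t ht x hx
  exact ⟨h1.sub k1, h2.sub k2, (h3.sub k3).congr_deriv (by ring)⟩

theorem comp_neg (hU : IsReducedSolution e I U) :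
    IsReducedSolution e I (fun t x => U t (-x)) := by
  obtain ⟨Ux, Uxx, hU⟩ := hU
  refine ⟨fun t x => -Ux t (-x), fun t x => Uxx t (-x), fun t ht x hx => ?_⟩
  obtain ⟨h1, h2, h3⟩ := hU t ht (-x) ⟨by linarith [hx.2], by linarith [hx.1]⟩
  refine ⟨?_, ?_, h3.congr_deriv (by ring)⟩
  · exact (h1.comp x (hasDerivAt_neg x)).congr_deriv (by ring)
  · exact (h2.comp x (hasDerivAt_neg x)).neg.congr_deriv (by ring)

end IsReducedSolution

/-! ### Abel summation -/

/-- Summation by parts: the differences of the weights are nonnegative and telescope. Only the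
partial sums of `g` are bounded, which is all that a uniformly, perhaps not absolutely, convergent
series provides. -/
theorem abs_sum_mul_le_of_antitone {ε : ℝ} {g w : ℕ → ℝ} (hw : Antitone w) (hw0 : ∀ i, 0 ≤ w i)
    (hg : ∀ m, |∑ i ∈ Finset.range m, g i| ≤ ε) (m : ℕ) :
    |∑ i ∈ Finset.range m, g i * w i| ≤ ε * w 0 := by
  have hε : 0 ≤ ε := (abs_nonneg _).trans (hg 0)
  rcases m with _ | m
  · simpa using mul_nonneg hε (hw0 0)
  have key : ∀ m, ∑ i ∈ Finset.range (m + 1), g i * w i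
      = (∑ i ∈ Finset.range (m + 1), g i) * w m
        + ∑ i ∈ Finset.range m, (∑ j ∈ Finset.range (i + 1), g j) * (w i - w (i + 1)) := by
    intro m
    induction m with
    | zero => simp
    | succ m ih =>
      rw [Finset.sum_range_succ, ih, Finset.sum_range_succ _ (m + 1),
        Finset.sum_range_succ (fun i => (∑ j ∈ Finset.range (i + 1), g j) * (w i - w (i + 1))) m]
      ring
  rw [key]
  have h1 : |(∑ i ∈ Finset.range (m + 1), g i) * w m| ≤ ε * w m := by
    rw [abs_mul, abs_of_nonneg (hw0 m)]
    exact mul_le_mul_of_nonneg_right (hg _) (hw0 m)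
  have h2 : |∑ i ∈ Finset.range m, (∑ j ∈ Finset.range (i + 1), g j) * (w i - w (i + 1))|
      ≤ ∑ i ∈ Finset.range m, ε * (w i - w (i + 1)) := by
    refine (Finset.abs_sum_le_sum_abs _ _).trans (Finset.sum_le_sum fun i _ => ?_)
    have : 0 ≤ w i - w (i + 1) := sub_nonneg.2 (hw (Nat.le_succ i))
    rw [abs_mul, abs_of_nonneg this]
    exact mul_le_mul_of_nonneg_right (hg _) this
  rw [← Finset.mul_sum, Finset.sum_range_sub'] at h2
  calc _ ≤ _ := abs_add_le _ _
    _ ≤ ε * w m + ε * (w 0 - w m) := add_le_add h1 h2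
    _ = ε * w 0 := by ring

/-- Abel's test, uniformly in two parameters. -/
theorem exists_uniform_limit_of_antitone {α β : Type*} {A : Set α} {B : Set β}
    {f : ℕ → α → ℝ} {w : ℕ → β → ℝ} (hw : ∀ t ∈ B, Antitone fun k => w k t)
    (hw0 : ∀ k, ∀ t ∈ B, 0 ≤ w k t) (hw1 : ∀ k, ∀ t ∈ B, w k t ≤ 1)
    (hf : ∀ ε > 0, ∃ N₀, ∀ N ≥ N₀, ∀ m, ∀ x ∈ A, |∑ i ∈ Finset.range m, f (N + i) x| ≤ ε) :
    ∃ V : β → α → ℝ, ∀ ε > 0, ∃ N₀, ∀ N ≥ N₀, ∀ t ∈ B, ∀ x ∈ A,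
      |V t x - ∑ k ∈ Finset.range N, f k x * w k t| ≤ ε := by
  -- The index `N₀` for the unweighted blocks serves every `t`. For the mode series this uniformity
  -- includes `t = 0` and gives continuity of the limit there.
  have tail : ∀ ε > 0, ∃ N₀, ∀ N ≥ N₀, ∀ m, ∀ t ∈ B, ∀ x ∈ A,
      |∑ k ∈ Finset.range (N + m), f k x * w k t - ∑ k ∈ Finset.range N, f k x * w k t| ≤ ε := by
    intro ε hε
    obtain ⟨N₀, hN₀⟩ := hf ε hε
    refine ⟨N₀, fun N hN m t ht x hx => ?_⟩
    rw [Finset.sum_range_add, add_sub_cancel_left]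
    refine (abs_sum_mul_le_of_antitone (ε := ε) (g := fun i => f (N + i) x)
      (w := fun i => w (N + i) t) (fun i j hij => hw t ht (by omega)) (fun i => hw0 _ t ht)
      (fun m => hN₀ N hN m x hx) m).trans ?_
    exact mul_le_of_le_one_right hε.le (hw1 _ t ht)
  have lim : ∀ t x, ∃ v : ℝ, t ∈ B → x ∈ A →
      Filter.Tendsto (fun N => ∑ k ∈ Finset.range N, f k x * w k t) Filter.atTop (nhds v) := by
    intro t x
    by_cases h : t ∈ B ∧ x ∈ A
    · have hc : CauchySeq (fun N => ∑ k ∈ Finset.range N, f k x * w k t) := by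
        rw [Metric.cauchySeq_iff']
        intro ε hε
        obtain ⟨N₀, hN₀⟩ := tail (ε / 2) (by positivity)
        refine ⟨N₀, fun N hN => ?_⟩
        obtain ⟨m, rfl⟩ := Nat.exists_eq_add_of_le hN
        rw [Real.dist_eq]
        linarith [hN₀ N₀ le_rfl m t h.1 x h.2]
      obtain ⟨v, hv⟩ := cauchySeq_tendsto_of_complete hc
      exact ⟨v, fun _ _ => hv⟩
    · exact ⟨0, fun h1 h2 => absurd ⟨h1, h2⟩ h⟩
  choose V hV using lim
  refine ⟨V, fun ε hε => ?_⟩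
  obtain ⟨N₀, hN₀⟩ := tail ε hε
  refine ⟨N₀, fun N hN t ht x hx => ?_⟩
  have h1 : Filter.Tendsto (fun m => |∑ k ∈ Finset.range (m + N), f k x * w k t
      - ∑ k ∈ Finset.range N, f k x * w k t|) Filter.atTop
      (nhds |V t x - ∑ k ∈ Finset.range N, f k x * w k t|) :=
    (((Filter.tendsto_add_atTop_iff_nat N).2 (hV t x ht hx)).sub_const _).abs
  refine le_of_tendsto h1 (Filter.Eventually.of_forall fun m => ?_)
  rw [add_comm m N]
  exact hN₀ N hN m t ht x hx

/-- Division by a power of `1 - x²` yields convergence on the open interval only. Finite blocks are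
continuous, so their bounds pass to the closure, and the poles are included. -/
theorem tail_bound_of_uniform_limit {f : ℕ → ℝ → ℝ} {g : ℝ → ℝ} (hfc : ∀ k, Continuous (f k))
    (h : ∀ ε > 0, ∃ N₀, ∀ N ≥ N₀, ∀ x ∈ Set.Ioo (-1 : ℝ) 1,
      |g x - ∑ k ∈ Finset.range N, f k x| ≤ ε) :
    ∀ ε > 0, ∃ N₀, ∀ N ≥ N₀, ∀ m, ∀ x ∈ Set.Icc (-1 : ℝ) 1,
      |∑ i ∈ Finset.range m, f (N + i) x| ≤ ε := by
  intro ε hε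
  obtain ⟨N₀, hN₀⟩ := h (ε / 2) (by positivity)
  refine ⟨N₀, fun N hN m x hx => ?_⟩
  have hcl : IsClosed {x : ℝ | |∑ i ∈ Finset.range m, f (N + i) x| ≤ ε} :=
    isClosed_le (continuous_finsetSum _ fun i _ => hfc _).abs continuous_const
  have hsub : Set.Ioo (-1 : ℝ) 1 ⊆ {x : ℝ | |∑ i ∈ Finset.range m, f (N + i) x| ≤ ε} := by
    intro y hy
    have h1 := hN₀ N hN y hy
    have h2 := hN₀ (N + m) (by omega) y hy
    rw [Finset.sum_range_add] at h2
    rw [abs_le] at h1 h2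
    change |_| ≤ ε
    rw [abs_le]
    constructor <;> linarith [h1.1, h1.2, h2.1, h2.2]
  have := hcl.closure_subset_iff.2 hsub
  rw [closure_Ioo (by norm_num)] at this
  exact this hx

/-- One bound for all terms is what Markov's inequality needs to control their derivatives. -/
theorem exists_uniform_bound_of_tail {f : ℕ → ℝ → ℝ} (hfc : ∀ k, Continuous (f k))
    (hf : ∀ ε > 0, ∃ N₀, ∀ N ≥ N₀, ∀ m, ∀ x ∈ Set.Icc (-1 : ℝ) 1,
      |∑ i ∈ Finset.range m, f (N + i) x| ≤ ε) :
    ∃ M, ∀ k, ∀ x ∈ Set.Icc (-1 : ℝ) 1, |f k x| ≤ M := by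
  obtain ⟨N₀, hN₀⟩ := hf 1 one_pos
  have hB : ∀ k, ∃ B, ∀ x ∈ Set.Icc (-1 : ℝ) 1, |f k x| ≤ B := fun k =>
    isCompact_Icc.exists_bound_of_continuousOn (hfc k).continuousOn
  choose B hB using hB
  have hB0 : ∀ k, 0 ≤ B k := fun k => (abs_nonneg _).trans (hB k 0 (by simp))
  have hS : 0 ≤ ∑ k ∈ Finset.range N₀, B k := Finset.sum_nonneg fun k _ => hB0 k
  refine ⟨1 + ∑ k ∈ Finset.range N₀, B k, fun k x hx => ?_⟩
  by_cases hk : k < N₀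
  · have := Finset.single_le_sum (f := B) (fun k _ => hB0 k) (Finset.mem_range.2 hk)
    linarith [hB k x hx]
  · have := hN₀ k (by omega) 1 x hx
    simp only [Finset.range_one, Finset.sum_singleton, add_zero] at this
    linarith

/-! ### The eigenvalues -/

theorem rateOmega_add (n k : ℕ) :
    rateOmega n (n + k) = ((k : ℝ) ^ 2 + (2 * n + 1) * k) / (2 * ((n : ℝ) + 1)) := by
  rw [rateOmega]; push_cast; ring

theorem rateOmega_add_monotone (n : ℕ) : Monotone fun k => rateOmega n (n + k) := by
  intro j k hjk
  simp only [rateOmega_add]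
  have : (j : ℝ) ≤ k := by exact_mod_cast hjk
  gcongr

theorem le_rateOmega_add (n k : ℕ) : (k : ℝ) / 2 ≤ rateOmega n (n + k) := by
  rw [rateOmega_add, div_le_div_iff₀ (by norm_num) (by positivity)]
  have h1 : (0 : ℝ) ≤ k := k.cast_nonneg
  have h2 : (0 : ℝ) ≤ n := n.cast_nonneg
  rcases Nat.eq_zero_or_pos k with rfl | hk
  · simp
  · have h3 : (1 : ℝ) ≤ k := by exact_mod_cast hk
    nlinarith [mul_nonneg h1 h2]

theorem rateOmega_add_le (n k : ℕ) : rateOmega n (n + k) ≤ 2 * ((n : ℝ) + k) ^ 2 := by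
  rw [rateOmega_add, div_le_iff₀ (by positivity)]
  have h1 : (0 : ℝ) ≤ k := k.cast_nonneg
  have h2 : (0 : ℝ) ≤ n := n.cast_nonneg
  have h4 : (k : ℝ) ≤ k ^ 2 := by
    rcases Nat.eq_zero_or_pos k with rfl | hk
    · simp
    · have h3 : (1 : ℝ) ≤ k := by exact_mod_cast hk
      nlinarith
  have h5 : ((k : ℝ) ^ 2 + (2 * n + 1) * k) ≤ 2 * ((n : ℝ) + k) ^ 2 := by
    nlinarith [mul_nonneg h1 h2, sq_nonneg (n : ℝ)]
  have h6 : 2 * ((n : ℝ) + k) ^ 2 * 1 ≤ 2 * ((n : ℝ) + k) ^ 2 * (2 * ((n : ℝ) + 1)) :=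
    mul_le_mul_of_nonneg_left (by linarith) (by positivity)
  linarith

/-- The quadratic growth of the rates is weakened to `k / 2`, which already gives geometric decay
for times bounded away from zero. -/
theorem exp_neg_rateOmega_le (n k : ℕ) {t₁ t : ℝ} (ht₁ : 0 ≤ t₁) (ht : t₁ ≤ t) :
    Real.exp (-rateOmega n (n + k) * t) ≤ Real.exp (-t₁ / 2) ^ k := by
  rw [← Real.exp_nat_mul, Real.exp_le_exp]
  have h := le_rateOmega_add n k
  have h1 : (0 : ℝ) ≤ k := k.cast_nonneg
  nlinarith [mul_le_mul h ht ht₁ (by linarith)]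

/-- With `d = n + k`, the factor `(1 + 2 d²)²` dominates `1`, `2 d²` and `4 d⁴`. One majorant thus
covers the terms, their first two `x`-derivatives and, as the rate is at most `2 d²`, their
`t`-derivative. -/
theorem summable_majorant (n : ℕ) (M : ℝ) {t₁ : ℝ} (ht₁ : 0 < t₁) :
    Summable fun k : ℕ => (1 + 2 * ((n + k : ℕ) : ℝ) ^ 2) ^ 2 * M * Real.exp (-t₁ / 2) ^ k := by
  set r := Real.exp (-t₁ / 2) with hr
  have hr0 : 0 < r := Real.exp_pos _
  have hr1 : r < 1 := by rw [hr, Real.exp_lt_one_iff]; linarith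
  have hs : ∀ j : ℕ, Summable fun k : ℕ => (k : ℝ) ^ j * r ^ k := fun j =>
    summable_pow_mul_geometric_of_norm_lt_one j (by rwa [Real.norm_of_nonneg hr0.le])
  have h : ∀ k : ℕ, (1 + 2 * ((n + k : ℕ) : ℝ) ^ 2) ^ 2 * M * r ^ k
      = M * ((1 + 2 * (n : ℝ) ^ 2) ^ 2 * ((k : ℝ) ^ 0 * r ^ k)
        + 2 * (1 + 2 * (n : ℝ) ^ 2) * (4 * n) * ((k : ℝ) ^ 1 * r ^ k)
        + (4 * (1 + 2 * (n : ℝ) ^ 2) + (4 * (n : ℝ)) ^ 2) * ((k : ℝ) ^ 2 * r ^ k)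
        + 16 * n * ((k : ℝ) ^ 3 * r ^ k) + 4 * ((k : ℝ) ^ 4 * r ^ k)) := by
    intro k; push_cast; ring
  simp only [h]
  exact ((((((hs 0).mul_left _).add ((hs 1).mul_left _)).add ((hs 2).mul_left _)).add
    ((hs 3).mul_left _)).add ((hs 4).mul_left _)).mul_left _

/-! ### The series of eigenmodes. -/

-- Multiplying by `1 - x²` avoids the exponents `n - 1` and `n - 2`, which are truncated for small
-- `n`.
open Polynomial in
theorem one_sub_sq_pow_derivative (n : ℕ) (x : ℝ) :
    (1 - x ^ 2) * (derivative ((1 - X ^ 2 : ℝ[X]) ^ n)).eval x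
        = -2 * n * x * ((1 - X ^ 2 : ℝ[X]) ^ n).eval x ∧
      (1 - x ^ 2) * (derivative (derivative ((1 - X ^ 2 : ℝ[X]) ^ n))).eval x
        = (2 - 2 * n) * x * (derivative ((1 - X ^ 2 : ℝ[X]) ^ n)).eval x
          - 2 * n * ((1 - X ^ 2 : ℝ[X]) ^ n).eval x := by
  have h0 : (1 - X ^ 2) * derivative ((1 - X ^ 2 : ℝ[X]) ^ n)
      = C (-2 * (n : ℝ)) * X * (1 - X ^ 2 : ℝ[X]) ^ n := by
    rcases n with _ | n
    · simp
    · rw [derivative_pow, pow_succ (1 - X ^ 2 : ℝ[X]) n]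
      simp only [derivative_sub, derivative_X_pow, derivative_one, map_mul, map_natCast,
        Nat.add_sub_cancel, map_neg, map_ofNat]
      push_cast
      ring
  have h1 := congrArg derivative h0
  constructor
  · have := congrArg (eval x) h0
    simpa using this
  · have := congrArg (eval x) h1
    simp only [derivative_mul, derivative_sub, derivative_X_pow, derivative_one, derivative_C,
      derivative_X] at this
    simp only [eval_add, eval_sub, eval_mul, eval_C, eval_X, eval_pow, eval_one, eval_zero] at this
    push_cast at this
    simp only [pow_one, eval_pow, eval_sub, eval_one, eval_X] at this ⊢
    linear_combination this

/-- Multiplication by `(1 - x²)^n` turns solutions of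
`V_t = e ((1 - x²) V_xx - 2 (n + 1) x V_x)`, where `2 e (n + 1) = 1`, into solutions of the
reduced equation. -/
theorem isReducedSolution_one_sub_sq_pow_mul {n : ℕ} {e : ℝ} (he : 2 * e * (n + 1) = 1)
    {I : Set ℝ} {V V1 V2 : ℝ → ℝ → ℝ}
    (h : ∀ t ∈ I, ∀ x ∈ Set.Ioo (-1 : ℝ) 1,
      HasDerivAt (V t) (V1 t x) x ∧ HasDerivAt (V1 t) (V2 t x) x ∧
      HasDerivAt (fun τ => V τ x)
        (e * ((1 - x ^ 2) * V2 t x - 2 * ((n : ℝ) + 1) * x * V1 t x)) t) :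
    IsReducedSolution e I (fun t x => (1 - x ^ 2) ^ n * V t x) := by
  set p : Polynomial ℝ := (1 - Polynomial.X ^ 2 : Polynomial ℝ) ^ n with hp
  have hpe : ∀ x : ℝ, (1 - x ^ 2) ^ n = p.eval x := fun x => by simp [hp]
  simp only [hpe]
  refine ⟨fun t x => p.derivative.eval x * V t x + p.eval x * V1 t x,
    fun t x => p.derivative.derivative.eval x * V t x + 2 * (p.derivative.eval x * V1 t x)
      + p.eval x * V2 t x, fun t ht x hx => ?_⟩
  obtain ⟨h1, h2, h3⟩ := h t ht x hx
  refine ⟨(p.hasDerivAt x).mul h1,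
    (((p.derivative.hasDerivAt x).mul h1).add ((p.hasDerivAt x).mul h2)).congr_deriv (by ring),
    (h3.const_mul (p.eval x)).congr_deriv ?_⟩
  obtain ⟨k1, k2⟩ := one_sub_sq_pow_derivative n x
  rw [← hp] at k1 k2
  -- For `p = (1 - x²)^n`, the terms `p V` and `x p' V` both carry the factor `1 - 2 e (n + 1) = 0`,
  -- so no zero-order term remains.
  linear_combination (-(e * V t x)) * k2 - 2 * e * V1 t x * k1
    + (x * p.derivative.eval x * V t x + p.eval x * V t x + p.eval x * x * V1 t x) * he

/-- The series of eigenmodes is a solution which attains its initial values continuously. -/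
theorem exists_mode_series (n : ℕ) (c : ℕ → ℝ) (g : ℝ → ℝ)
    (h : ∀ ε > 0, ∃ N₀, ∀ N ≥ N₀, ∀ x ∈ Set.Ioo (-1 : ℝ) 1,
      |g x - ∑ k ∈ Finset.range N, c (n + k) * (legendreFactor n (n + k)).eval x| ≤ ε) :
    ∃ V : ℝ → ℝ → ℝ,
      (∀ ε > 0, ∃ N₀, ∀ N ≥ N₀, ∀ t ∈ Set.Ici (0 : ℝ), ∀ x ∈ Set.Icc (-1 : ℝ) 1,
        |V t x - ∑ k ∈ Finset.range N, c (n + k) * (legendreFactor n (n + k)).eval x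
          * Real.exp (-rateOmega n (n + k) * t)| ≤ ε) ∧
      ContinuousOn (fun q : ℝ × ℝ => V q.1 q.2) (Set.Ici 0 ×ˢ Set.Icc (-1) 1) ∧
      IsReducedSolution (1 / (2 * ((n : ℝ) + 1))) (Set.Ioi 0)
        (fun t x => (1 - x ^ 2) ^ n * V t x) := by
  set f : ℕ → ℝ → ℝ := fun k x => c (n + k) * (legendreFactor n (n + k)).eval x with hf
  have hfc : ∀ k, Continuous (f k) := fun k =>
    continuous_const.mul (legendreFactor n (n + k)).continuous
  have htail := tail_bound_of_uniform_limit hfc h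
  obtain ⟨M, hM⟩ := exists_uniform_bound_of_tail hfc htail
  have hM0 : 0 ≤ M := (abs_nonneg _).trans (hM 0 0 (by simp))
  have hω0 : ∀ k, 0 ≤ rateOmega n (n + k) := fun k =>
    le_trans (by positivity) (le_rateOmega_add n k)
  obtain ⟨V, hV⟩ := exists_uniform_limit_of_antitone (A := Set.Icc (-1 : ℝ) 1)
    (B := Set.Ici (0 : ℝ)) (f := f) (w := fun k t => Real.exp (-rateOmega n (n + k) * t))
    (fun t ht j k hjk => Real.exp_le_exp.2 (by
      have := rateOmega_add_monotone n hjk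
      simp only at this
      have ht : (0 : ℝ) ≤ t := ht
      nlinarith))
    (fun k t _ => (Real.exp_pos _).le)
    (fun k t ht => Real.exp_le_one_iff.2 (by
      have := hω0 k
      have ht : (0 : ℝ) ≤ t := ht
      nlinarith)) htail
  refine ⟨V, hV, ?_, ?_⟩
  · have hu : TendstoUniformlyOn
        (fun N (q : ℝ × ℝ) => ∑ k ∈ Finset.range N, f k q.2 * Real.exp (-rateOmega n (n + k) * q.1))
        (fun q => V q.1 q.2) Filter.atTop (Set.Ici 0 ×ˢ Set.Icc (-1) 1) := by
      rw [Metric.tendstoUniformlyOn_iff]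
      intro ε hε
      obtain ⟨N₀, hN₀⟩ := hV (ε / 2) (by positivity)
      filter_upwards [Filter.eventually_ge_atTop N₀] with N hN q hq
      rw [Real.dist_eq]
      linarith [hN₀ N hN q.1 hq.1 q.2 hq.2]
    refine hu.continuousOn (Filter.Frequently.of_forall fun N => Continuous.continuousOn ?_)
    refine continuous_finsetSum _ fun k _ => ?_
    exact ((hfc k).comp continuous_snd).mul (by fun_prop)
  -- the termwise derivatives
  have he : (2 * (1 / (2 * ((n : ℝ) + 1))) * (n + 1)) = 1 := by field_simp
  set e : ℝ := 1 / (2 * ((n : ℝ) + 1)) with he'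
  set P : ℕ → Polynomial ℝ := fun k => Polynomial.C (c (n + k)) * legendreFactor n (n + k) with hP
  have hPf : ∀ k x, (P k).eval x = f k x := fun k x => by simp [hP, hf]
  have hdeg : ∀ k, (P k).natDegree ≤ n + k := fun k =>
    (Polynomial.natDegree_C_mul_le _ _).trans (natDegree_legendreFactor_le n (n + k))
  have hdeg1 : ∀ k, (P k).derivative.natDegree ≤ n + k := fun k =>
    (Polynomial.natDegree_derivative_le _).trans ((Nat.sub_le _ _).trans (hdeg k))
  have b0 : ∀ k, ∀ x ∈ Set.Icc (-1 : ℝ) 1, |(P k).eval x| ≤ M := fun k x hx => by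
    rw [hPf]; exact hM k x hx
  have b1 : ∀ k, ∀ x ∈ Set.Icc (-1 : ℝ) 1,
      |(P k).derivative.eval x| ≤ 2 * ((n + k : ℕ) : ℝ) ^ 2 * M := fun k x hx =>
    Polynomial.abs_eval_derivative_le (hdeg k) (b0 k) hx
  have b2 : ∀ k, ∀ x ∈ Set.Icc (-1 : ℝ) 1, |(P k).derivative.derivative.eval x|
      ≤ 2 * ((n + k : ℕ) : ℝ) ^ 2 * (2 * ((n + k : ℕ) : ℝ) ^ 2 * M) := fun k x hx =>
    Polynomial.abs_eval_derivative_le (hdeg1 k) (b1 k) hx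
  set u : ℝ → ℕ → ℝ := fun t₁ k =>
    (1 + 2 * ((n + k : ℕ) : ℝ) ^ 2) ^ 2 * M * Real.exp (-t₁ / 2) ^ k with hu
  have hsu : ∀ t₁ : ℝ, 0 < t₁ → Summable (u t₁) := fun t₁ ht₁ => summable_majorant n M ht₁
  have major : ∀ (t₁ t : ℝ) (k : ℕ) (y : ℝ), 0 < t₁ → t₁ ≤ t →
      |y| ≤ (1 + 2 * ((n + k : ℕ) : ℝ) ^ 2) ^ 2 * M →
      ‖y * Real.exp (-rateOmega n (n + k) * t)‖ ≤ u t₁ k := by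
    intro t₁ t k y h1 h2 h3
    rw [norm_mul, Real.norm_eq_abs, Real.norm_eq_abs, abs_of_pos (Real.exp_pos _)]
    exact mul_le_mul h3 (exp_neg_rateOmega_le n k h1.le h2) (Real.exp_pos _).le (by positivity)
  have a0 : ∀ k, ∀ x ∈ Set.Icc (-1 : ℝ) 1,
      |(P k).eval x| ≤ (1 + 2 * ((n + k : ℕ) : ℝ) ^ 2) ^ 2 * M := fun k x hx =>
    (b0 k x hx).trans (by
      have : 0 ≤ ((n + k : ℕ) : ℝ) ^ 2 := by positivity
      nlinarith [mul_nonneg this hM0, mul_nonneg (mul_nonneg this this) hM0])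
  have a1 : ∀ k, ∀ x ∈ Set.Icc (-1 : ℝ) 1,
      |(P k).derivative.eval x| ≤ (1 + 2 * ((n + k : ℕ) : ℝ) ^ 2) ^ 2 * M := fun k x hx =>
    (b1 k x hx).trans (by
      have : 0 ≤ ((n + k : ℕ) : ℝ) ^ 2 := by positivity
      nlinarith [mul_nonneg this hM0, mul_nonneg (mul_nonneg this this) hM0])
  have a2 : ∀ k, ∀ x ∈ Set.Icc (-1 : ℝ) 1,
      |(P k).derivative.derivative.eval x| ≤ (1 + 2 * ((n + k : ℕ) : ℝ) ^ 2) ^ 2 * M :=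
    fun k x hx => (b2 k x hx).trans (by
      have : 0 ≤ ((n + k : ℕ) : ℝ) ^ 2 := by positivity
      nlinarith [mul_nonneg this hM0, mul_nonneg (mul_nonneg this this) hM0])
  have a3 : ∀ k, ∀ x ∈ Set.Icc (-1 : ℝ) 1,
      |(P k).eval x * (-rateOmega n (n + k))| ≤ (1 + 2 * ((n + k : ℕ) : ℝ) ^ 2) ^ 2 * M := by
    intro k x hx
    rw [abs_mul, abs_neg, abs_of_nonneg (hω0 k), mul_comm]
    have h1 := rateOmega_add_le n k
    rw [← Nat.cast_add] at h1
    have : 0 ≤ ((n + k : ℕ) : ℝ) ^ 2 := by positivity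
    calc _ ≤ 2 * ((n + k : ℕ) : ℝ) ^ 2 * M :=
          mul_le_mul h1 (b0 k x hx) (abs_nonneg _) (by positivity)
      _ ≤ _ := by nlinarith [mul_nonneg this hM0, mul_nonneg (mul_nonneg this this) hM0]
  set E : ℕ → ℝ → ℝ := fun k t => Real.exp (-rateOmega n (n + k) * t) with hE
  have sum0 : ∀ (y : ℕ → ℝ) (t : ℝ), 0 < t →
      (∀ k, |y k| ≤ (1 + 2 * ((n + k : ℕ) : ℝ) ^ 2) ^ 2 * M) →
      Summable fun k => y k * E k t := fun y t ht hy =>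
    Summable.of_norm_bounded (hsu t ht) fun k => major t t k (y k) ht le_rfl (hy k)
  have hVt : ∀ t, 0 < t → ∀ x ∈ Set.Icc (-1 : ℝ) 1, V t x = ∑' k, (P k).eval x * E k t := by
    intro t ht x hx
    refine tendsto_nhds_unique ?_ (sum0 _ t ht fun k => a0 k x hx).hasSum.tendsto_sum_nat
    rw [Metric.tendsto_atTop]
    intro ε hε
    obtain ⟨N₀, hN₀⟩ := hV (ε / 2) (by positivity)
    refine ⟨N₀, fun N hN => ?_⟩
    rw [dist_comm, Real.dist_eq]
    simp only [hPf]
    linarith [hN₀ N hN t (le_of_lt ht : (0 : ℝ) ≤ t) x hx]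
  refine isReducedSolution_one_sub_sq_pow_mul he
    (V1 := fun t x => ∑' k, (P k).derivative.eval x * E k t)
    (V2 := fun t x => ∑' k, (P k).derivative.derivative.eval x * E k t) ?_
  intro t ht x hx
  have ht : 0 < t := ht
  have hIoo : Set.Ioo (-1 : ℝ) 1 ⊆ Set.Icc (-1) 1 := Set.Ioo_subset_Icc_self
  have hxder : ∀ R : ℕ → Polynomial ℝ,
      (∀ k, ∀ x ∈ Set.Icc (-1 : ℝ) 1,
        |(R k).eval x| ≤ (1 + 2 * ((n + k : ℕ) : ℝ) ^ 2) ^ 2 * M) →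
      (∀ k, ∀ x ∈ Set.Icc (-1 : ℝ) 1,
        |(R k).derivative.eval x| ≤ (1 + 2 * ((n + k : ℕ) : ℝ) ^ 2) ^ 2 * M) →
      HasDerivAt (fun y => ∑' k, (R k).eval y * E k t) (∑' k, (R k).derivative.eval x * E k t) x := by
    intro R hR hR'
    refine hasDerivAt_tsum_of_isPreconnected (u := u t)
      (g := fun k y => (R k).eval y * E k t)
      (g' := fun k y => (R k).derivative.eval y * E k t) (hsu t ht) isOpen_Ioo
      isPreconnected_Ioo (fun k y _ => ((R k).hasDerivAt y).mul_const _)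
      (fun k y hy => major t t k _ ht le_rfl (hR' k y (hIoo hy))) hx
      (sum0 _ t ht fun k => hR k x (hIoo hx)) hx
  refine ⟨(hxder P a0 a1).congr_of_eventuallyEq ?_, hxder (fun k => (P k).derivative) a1 a2, ?_⟩
  · filter_upwards [isOpen_Ioo.mem_nhds hx] with y hy using hVt t ht y (hIoo hy)
  · have hd : HasDerivAt (fun τ => ∑' k, (P k).eval x * E k τ)
        (∑' k, (P k).eval x * (-rateOmega n (n + k)) * E k t) t := by
      -- The majorant at time `t / 2` is valid for all later times, hence on a neighbourhood of `t`.
      refine hasDerivAt_tsum_of_isPreconnected (u := u (t / 2))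
        (g := fun k τ => (P k).eval x * E k τ)
        (g' := fun k τ => (P k).eval x * (-rateOmega n (n + k)) * E k τ)
        (hsu (t / 2) (by positivity)) (isOpen_Ioi (a := t / 2))
        isPreconnected_Ioi (fun k τ _ => ?_)
        (fun k τ hτ => major (t / 2) τ k _ (by positivity) (le_of_lt hτ) (a3 k x (hIoo hx)))
        (by simpa using ht) (sum0 _ t ht fun k => a0 k x (hIoo hx)) (by simpa using ht)
      have h1 : HasDerivAt (E k) (E k τ * (-rateOmega n (n + k))) τ := by
        have := ((hasDerivAt_id τ).const_mul (-rateOmega n (n + k))).exp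
        simpa [hE] using this
      exact (h1.const_mul ((P k).eval x)).congr_deriv (by ring)
    refine (hd.congr_of_eventuallyEq ?_).congr_deriv ?_
    · filter_upwards [lt_mem_nhds ht] with τ hτ using hVt τ hτ x (hIoo hx)
    · have s1 := sum0 _ t ht fun k => a1 k x (hIoo hx)
      have s2 := sum0 _ t ht fun k => a2 k x (hIoo hx)
      rw [← tsum_mul_left, ← tsum_mul_left,
        ← (s2.mul_left _).tsum_sub (s1.mul_left _), ← tsum_mul_left]
      refine tsum_congr fun k => ?_
      have hq := legendreFactor_equation n (n + k) x
      have hω : rateOmega n (n + k)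
          = e * (((n + k : ℕ) : ℝ) * ((n + k : ℕ) + 1) - n * (n + 1)) := by
        rw [rateOmega, he']; ring
      simp only [hP, Polynomial.derivative_C_mul, Polynomial.eval_mul, Polynomial.eval_C]
      rw [hω]
      linear_combination (-(e * c (n + k) * E k t)) * hq

/-! ### The amplitudes -/

/-- The difference factors as `(m - q)(2 n + 1 - 2 (m + q) + 4 δ) / (n + 1)`. As `4 δ` is `0` or
`2`, the second factor is an odd integer. There is therefore no resonance, and the denominators of
`modeCoeff` do not vanish. -/
theorem rateMu_sub_rateMu_ne_zero (n : ℕ) {δ : ℝ} (hδ : δ = 0 ∨ δ = 1 / 2) {m q : ℕ}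
    (hmq : m < q) :
    rateMu n ((n : ℝ) - m + δ) - rateMu n ((n : ℝ) - q + δ) ≠ 0 := by
  have h1 : rateMu n ((n : ℝ) - m + δ) - rateMu n ((n : ℝ) - q + δ)
      = ((m : ℝ) - q) * (2 * n + 1 - 2 * (m + q) + 4 * δ) / (n + 1) := by
    simp only [rateMu]; ring
  rw [h1]
  have hmq' : (m : ℝ) - q ≠ 0 := by
    have : (m : ℝ) < q := by exact_mod_cast hmq
    linarith
  have h2 : (2 * (n : ℝ) + 1 - 2 * (m + q) + 4 * δ) ≠ 0 := by
    rcases hδ with rfl | rfl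
    · intro h
      have : (2 * (n : ℤ) + 1 - 2 * (m + q)) = 0 := by
        have h' : (2 * (n : ℝ) + 1 - 2 * (m + q)) = 0 := by linarith
        exact_mod_cast h'
      omega
    · intro h
      have : (2 * (n : ℤ) + 1 - 2 * (m + q) + 2) = 0 := by
        have h' : (2 * (n : ℝ) + 1 - 2 * (m + q) + 2) = 0 := by linarith
        exact_mod_cast h'
      omega
  have h3 : (n : ℝ) + 1 ≠ 0 := by positivity
  exact div_ne_zero (mul_ne_zero hmq' h2) h3

/-- This is the equation `A_l' = μ_l A_l - ν_{l+1} A_{l+1}` read off at the exponential of rate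
`μ_{n-m+δ}`, and it explains the product form of the coefficients: passing from `l + 1` to `l` adds
one factor above and one below. -/
theorem modeCoeff_succ (n : ℕ) {δ : ℝ} (hδ : δ = 0 ∨ δ = 1 / 2) {l m : ℕ} (hm : 1 ≤ m)
    (hml : m + l + 1 ≤ n) :
    (rateMu n ((n : ℝ) - m + δ) - rateMu n ((l : ℝ) + δ)) * modeCoeff n δ l m
      = -(rateNu n ((l + 1 : ℕ) : ℝ) * modeCoeff n δ (l + 1) m) := by
  obtain ⟨r, hr⟩ : ∃ r, n = l + (r + 1 + 1) := ⟨n - l - 2, by omega⟩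
  have e1 : n - l = r + 1 + 1 := by omega
  have e2 : n - (l + 1) = r + 1 := by omega
  have e3 : r + 1 + 1 - m = (r + 1 - m) + 1 := by omega
  have hc1 : (n : ℝ) - ((r + 1 + 1 : ℕ) : ℝ) = l := by rw [hr]; push_cast; ring
  have hc2 : (n : ℝ) - ((r + 1 : ℕ) : ℝ) = ((l + 1 : ℕ) : ℝ) := by rw [hr]; push_cast; ring
  have hne := rateMu_sub_rateMu_ne_zero n hδ (m := m) (q := r + 1 + 1) (by omega)
  rw [modeCoeff, modeCoeff, e1, e2, e3, Nat.add_sub_cancel, Nat.add_sub_cancel,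
    Finset.prod_Icc_succ_top (by omega : m ≤ r + 1),
    Finset.prod_Icc_succ_top (by omega : m + 1 ≤ r + 1 + 1), hc2]
  rw [hc1] at hne ⊢
  rw [pow_succ, ← div_div, mul_div_assoc', mul_div_cancel_left₀ _ hne]
  ring

/-- For `m = n - l` the products in the coefficient are empty or have no factor, so it equals one
and the leading term joins the sum. -/
theorem modeAmplitude_eq_sum (n : ℕ) (δ : ℝ) (x : ℕ → ℝ) {l : ℕ} (hl : l < n) (t : ℝ) :
    modeAmplitude n δ x l t = ∑ m ∈ Finset.Icc 1 (n - l),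
      modeCoeff n δ l m * x (n - m) * Real.exp (rateMu n ((n : ℝ) - m + δ) * t) := by
  obtain ⟨r, hr⟩ : ∃ r, n = l + (r + 1) := ⟨n - l - 1, by omega⟩
  have e1 : n - l = r + 1 := by omega
  have hc1 : (n : ℝ) - ((r + 1 : ℕ) : ℝ) = l := by rw [hr]; push_cast; ring
  have e2 : n - (r + 1) = l := by omega
  have h1 : modeCoeff n δ l (r + 1) = 1 := by
    simp [modeCoeff, e1]
  rw [modeAmplitude, e1, Finset.sum_Icc_succ_top (by omega), Nat.add_sub_cancel, h1, e2, hc1]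
  ring

theorem hasDerivAt_modeAmplitude (n : ℕ) {δ : ℝ} (hδ : δ = 0 ∨ δ = 1 / 2) (x : ℕ → ℝ) {l : ℕ}
    (hl : l < n) (t : ℝ) :
    HasDerivAt (modeAmplitude n δ x l)
      (rateMu n ((l : ℝ) + δ) * modeAmplitude n δ x l t
        - rateNu n ((l + 1 : ℕ) : ℝ) * modeAmplitude n δ x (l + 1) t) t := by
  have hexp : ∀ r : ℝ, HasDerivAt (fun t => Real.exp (r * t)) (r * Real.exp (r * t)) t := by
    intro r
    have := ((hasDerivAt_id t).const_mul r).exp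
    simp only [id] at this
    exact this.congr_deriv (by ring)
  have h1 : HasDerivAt (modeAmplitude n δ x l)
      (∑ m ∈ Finset.Icc 1 (n - l), modeCoeff n δ l m * x (n - m)
        * (rateMu n ((n : ℝ) - m + δ) * Real.exp (rateMu n ((n : ℝ) - m + δ) * t))) t := by
    rw [show modeAmplitude n δ x l = fun t => ∑ m ∈ Finset.Icc 1 (n - l),
      modeCoeff n δ l m * x (n - m) * Real.exp (rateMu n ((n : ℝ) - m + δ) * t) from
      funext fun t => modeAmplitude_eq_sum n δ x hl t]
    exact HasDerivAt.fun_sum fun m _ => (hexp _).const_mul _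
  refine h1.congr_deriv ?_
  rw [modeAmplitude_eq_sum n δ x hl, Finset.mul_sum, sub_eq_add_neg, ← sub_eq_iff_eq_add',
    ← Finset.sum_sub_distrib]
  have hnl : n - l = (n - (l + 1)) + 1 := by omega
  rw [hnl, Finset.sum_Icc_succ_top (by omega)]
  have hc : (n : ℝ) - ((n - (l + 1) + 1 : ℕ) : ℝ) = l := by
    rw [← hnl, Nat.cast_sub hl.le]; ring
  rw [hc, sub_eq_zero_of_eq (by ring), add_zero]
  rcases Nat.lt_or_ge (l + 1) n with h | h
  · rw [modeAmplitude_eq_sum n δ x h, Finset.mul_sum, ← Finset.sum_neg_distrib]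
    refine Finset.sum_congr rfl fun m hm => ?_
    rw [Finset.mem_Icc] at hm
    have := modeCoeff_succ n hδ (l := l) hm.1 (by omega)
    linear_combination (x (n - m) * Real.exp (rateMu n ((n : ℝ) - m + δ) * t)) * this
  -- The amplitude of index `n` has no meaning here, but its factor `ν_n` is zero.
  · have : l + 1 = n := by omega
    subst this
    simp [rateNu]

theorem modeAmplitude_zero {n : ℕ} {δ : ℝ} {a x : ℕ → ℝ} (h : InitialRelation n δ a x) {l : ℕ}
    (hl : l < n) : modeAmplitude n δ x l 0 = a l := by
  rw [h l hl]; simp [modeAmplitude]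

/-- The solution, by backward substitution, of `a_l = x_l + ∑_{m < n - l} K l m x_{n - m}`, with
index `j = n - l`. -/
noncomputable def backSubstitution (n : ℕ) (K : ℕ → ℕ → ℝ) (a : ℕ → ℝ) (j : ℕ) : ℝ :=
  a (n - j) - ∑ m : Fin j, if 1 ≤ (m : ℕ) then K (n - j) m * backSubstitution n K a m else 0
termination_by j
decreasing_by exact m.2

theorem backSubstitution_eq (n : ℕ) (K : ℕ → ℕ → ℝ) (a : ℕ → ℝ) (j : ℕ) :
    backSubstitution n K a j
      = a (n - j) - ∑ m ∈ Finset.Icc 1 (j - 1), K (n - j) m * backSubstitution n K a m := by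
  rw [backSubstitution, Fin.sum_univ_eq_sum_range
    (fun m => if 1 ≤ m then K (n - j) m * backSubstitution n K a m else 0), ← Finset.sum_filter]
  congr 2
  ext m
  simp only [Finset.mem_filter, Finset.mem_range, Finset.mem_Icc]
  omega

/-- The equation for `l` involves, besides `x_l`, only `x_{n-m}` with `n - m > l`. The system is
triangular with unit diagonal, and the equivalence expresses existence and uniqueness together. -/
theorem exists_initialRelation_iff (n : ℕ) (δ : ℝ) (a : ℕ → ℝ) :
    ∃ a' : ℕ → ℝ, ∀ x : ℕ → ℝ, InitialRelation n δ a x ↔ ∀ l, l < n → x l = a' l := by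
  refine ⟨fun l => backSubstitution n (modeCoeff n δ) a (n - l), fun x => ⟨fun h => ?_, fun h => ?_⟩⟩
  · have key : ∀ j, 1 ≤ j → j ≤ n → x (n - j) = backSubstitution n (modeCoeff n δ) a j := by
      intro j
      induction j using Nat.strong_induction_on with
      | _ j ih =>
        intro h1 hj
        have e : n - (n - j) = j := by omega
        have hx := h (n - j) (by omega)
        rw [e] at hx
        rw [backSubstitution_eq, hx, eq_sub_iff_add_eq]
        congr 1
        refine Finset.sum_congr rfl fun m hm => ?_
        rw [Finset.mem_Icc] at hm
        rw [ih m (by omega) hm.1 (by omega)]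
    intro l hl
    have := key (n - l) (by omega) (by omega)
    rwa [show n - (n - l) = l by omega] at this
  · intro l hl
    have e : n - (n - l) = l := by omega
    have hl' : x l = backSubstitution n (modeCoeff n δ) a (n - l) := h l hl
    rw [backSubstitution_eq, e] at hl'
    rw [hl', eq_comm, sub_add_eq_add_sub, sub_eq_iff_eq_add]
    congr 1
    refine Finset.sum_congr rfl fun m hm => ?_
    rw [Finset.mem_Icc] at hm
    rw [h (n - m) (by omega)]
    simp only [show n - (n - m) = m by omega]

/-! ### The polynomial part -/

-- Replacing `x²` by `1 - (1 - x²)` produces the lower power, the source of the coupling `ν_l`. At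
-- `l = 0` the truncated exponent is harmless because its coefficient vanishes.
open Polynomial in
theorem X_mul_derivative_one_sub_sq_pow (l : ℕ) (x : ℝ) :
    x * (derivative ((1 - X ^ 2 : ℝ[X]) ^ l)).eval x
      = 2 * l * (1 - x ^ 2) ^ l - 2 * l * (1 - x ^ 2) ^ (l - 1) := by
  rcases l with _ | l
  · simp
  · simp [derivative_pow]
    ring

/-- The part of the solution which is determined by its jets at the poles. -/
noncomputable def polynomialPart (n : ℕ) (A B : ℕ → ℝ → ℝ) (t x : ℝ) : ℝ :=
  ∑ l ∈ Finset.range n, (A l t + B l t * x) * (1 - x ^ 2) ^ l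

theorem isReducedSolution_polynomialPart (n : ℕ) {A B : ℕ → ℝ → ℝ}
    (hA : ∀ l < n, ∀ t, HasDerivAt (A l)
      (rateMu n l * A l t - rateNu n ((l + 1 : ℕ) : ℝ) * A (l + 1) t) t)
    (hB : ∀ l < n, ∀ t, HasDerivAt (B l)
      (rateMu n ((l : ℝ) + 1 / 2) * B l t - rateNu n ((l + 1 : ℕ) : ℝ) * B (l + 1) t) t) :
    IsReducedSolution (1 / (2 * ((n : ℝ) + 1))) Set.univ (polynomialPart n A B) := by
  have he : (2 * (1 / (2 * ((n : ℝ) + 1))) * (n + 1)) = 1 := by field_simp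
  set e : ℝ := 1 / (2 * ((n : ℝ) + 1)) with he'
  set p : ℕ → Polynomial ℝ := fun l => (1 - Polynomial.X ^ 2 : Polynomial ℝ) ^ l with hp
  have hpe : ∀ l (x : ℝ), (1 - x ^ 2) ^ l = (p l).eval x := fun l x => by simp [hp]
  have h0 : ∀ l x, HasDerivAt (fun x : ℝ => (1 - x ^ 2) ^ l) ((p l).derivative.eval x) x := by
    intro l x
    simp only [hpe]
    exact (p l).hasDerivAt x
  refine ⟨fun t x => ∑ l ∈ Finset.range n, (B l t * (1 - x ^ 2) ^ l
      + (A l t + B l t * x) * (p l).derivative.eval x),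
    fun t x => ∑ l ∈ Finset.range n, (2 * B l t * (p l).derivative.eval x
      + (A l t + B l t * x) * (p l).derivative.derivative.eval x), fun t _ x _ => ⟨?_, ?_, ?_⟩⟩
  · refine HasDerivAt.fun_sum fun l _ => ?_
    exact ((((hasDerivAt_id x).const_mul (B l t)).const_add (A l t)).mul (h0 l x)).congr_deriv
      (by simp)
  · refine HasDerivAt.fun_sum fun l _ => ?_
    exact (((h0 l x).const_mul (B l t)).add
      ((((hasDerivAt_id x).const_mul (B l t)).const_add (A l t)).mul
        ((p l).derivative.hasDerivAt x))).congr_deriv (by simp; ring)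
  · have hd : HasDerivAt (fun τ => polynomialPart n A B τ x)
        (∑ l ∈ Finset.range n,
          ((rateMu n l * A l t - rateNu n ((l + 1 : ℕ) : ℝ) * A (l + 1) t)
            + (rateMu n ((l : ℝ) + 1 / 2) * B l t - rateNu n ((l + 1 : ℕ) : ℝ) * B (l + 1) t) * x)
          * (1 - x ^ 2) ^ l) t := by
      refine HasDerivAt.fun_sum fun l hl => ?_
      have hl := Finset.mem_range.1 hl
      exact ((hA l hl t).add ((hB l hl t).mul_const x)).mul_const _
    refine hd.congr_deriv ?_
    -- The coupling terms. Since `ν_0 = ν_n = 0`, shifting the index over `0, ..., n - 1` leaves no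
    -- boundary terms.
    set F : ℕ → ℝ := fun l => rateNu n l * (A l t + B l t * x) * (1 - x ^ 2) ^ (l - 1) with hF
    have hshift : ∑ l ∈ Finset.range n, F (l + 1) = ∑ l ∈ Finset.range n, F l := by
      have h1 := Finset.sum_range_succ F n
      have h2 := Finset.sum_range_succ' F n
      have h3 : F n = 0 := by simp [hF, rateNu]
      have h4 : F 0 = 0 := by simp [hF, rateNu]
      linarith
    have hsplit : ∀ l : ℕ, ((rateMu n l * A l t - rateNu n ((l + 1 : ℕ) : ℝ) * A (l + 1) t)
            + (rateMu n ((l : ℝ) + 1 / 2) * B l t - rateNu n ((l + 1 : ℕ) : ℝ) * B (l + 1) t) * x)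
          * (1 - x ^ 2) ^ l
        = (rateMu n l * A l t + rateMu n ((l : ℝ) + 1 / 2) * B l t * x) * (1 - x ^ 2) ^ l
          - F (l + 1) := by
      intro l; simp only [hF, Nat.add_sub_cancel]; ring
    simp only [hsplit]
    rw [Finset.sum_sub_distrib, hshift, ← Finset.sum_sub_distrib, polynomialPart,
      Finset.mul_sum, Finset.mul_sum, Finset.mul_sum, ← Finset.sum_add_distrib,
      ← Finset.sum_add_distrib]
    refine Finset.sum_congr rfl fun l _ => ?_
    obtain ⟨k1, k2⟩ := one_sub_sq_pow_derivative l x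
    have k3 := X_mul_derivative_one_sub_sq_pow l x
    simp only [hF, hpe] at k1 k2 k3 ⊢
    have m1 : rateMu n l = (1 - 2 * e * (l + 1)) * (2 * l + 1) := by
      rw [rateMu, he']; field_simp; ring
    have m2 : rateMu n ((l : ℝ) + 1 / 2) = (1 - 2 * e * (l + 1)) * (2 * l + 1) - 4 * e * l + 1 - 4 * e
        := by
      rw [rateMu, he']; field_simp; ring
    have m3 : rateNu n l = (1 - 2 * e * (l + 1)) * (2 * l) := by
      rw [rateNu, he']; field_simp; ring
    rw [m1, m2, m3]
    linear_combination (-(e * (A l t + B l t * x))) * k2 - (2 * e * B l t) * k1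
      - (A l t + B l t * x) * (1 - 2 * e * (l + 1)) * k3

/-! ### From the reduced equation to the astigmatism equation -/

/-- The chain rule for `x = cos θ`; the factor `sin² θ` supplies the Dirichlet conditions, whatever
the values of `U` at the poles. -/
theorem IsReducedSolution.solvesAstigmatismEquation {n : ℕ} {U : ℝ → ℝ → ℝ} {s₀ : ℝ → ℝ}
    (hU : IsReducedSolution (1 / (2 * ((n : ℝ) + 1))) (Set.Ioi 0) U)
    (hcont : ContinuousOn (fun q : ℝ × ℝ => U q.1 q.2) (Set.Ici 0 ×ˢ Set.Icc (-1) 1))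
    (hinit : ∀ θ ∈ Set.Icc 0 Real.pi, Real.sin θ ^ 2 * U 0 (Real.cos θ) = s₀ θ) :
    SolvesAstigmatismEquation (hopfLam n) s₀ (fun t θ => Real.sin θ ^ 2 * U t (Real.cos θ)) := by
  obtain ⟨Ux, Uxx, hU⟩ := hU
  have hcos : ∀ θ ∈ Set.Ioo 0 Real.pi, Real.cos θ ∈ Set.Ioo (-1 : ℝ) 1 := by
    intro θ hθ
    have h1 := Real.sin_pos_of_mem_Ioo hθ
    have h2 := Real.sin_sq_add_cos_sq θ
    constructor <;> nlinarith
  have d1 : ∀ t, 0 < t → ∀ θ ∈ Set.Ioo 0 Real.pi,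
      HasDerivAt (fun θ => Real.sin θ ^ 2 * U t (Real.cos θ))
        (2 * Real.sin θ * Real.cos θ * U t (Real.cos θ)
          - Real.sin θ ^ 3 * Ux t (Real.cos θ)) θ := by
    intro t ht θ hθ
    obtain ⟨h1, _, _⟩ := hU t ht _ (hcos θ hθ)
    exact (((Real.hasDerivAt_sin θ).pow 2).mul (h1.comp θ (Real.hasDerivAt_cos θ))).congr_deriv
      (by simp; ring)
  have d1' : ∀ t, 0 < t → ∀ θ ∈ Set.Ioo 0 Real.pi,
      deriv (fun θ => Real.sin θ ^ 2 * U t (Real.cos θ)) =ᶠ[nhds θ]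
        fun θ => 2 * Real.sin θ * Real.cos θ * U t (Real.cos θ)
          - Real.sin θ ^ 3 * Ux t (Real.cos θ) := by
    intro t ht θ hθ
    filter_upwards [isOpen_Ioo.mem_nhds hθ] with y hy using (d1 t ht y hy).deriv
  have d2 : ∀ t, 0 < t → ∀ θ ∈ Set.Ioo 0 Real.pi,
      HasDerivAt (deriv (fun θ => Real.sin θ ^ 2 * U t (Real.cos θ)))
        (2 * (Real.cos θ ^ 2 - Real.sin θ ^ 2) * U t (Real.cos θ)
          - 5 * Real.sin θ ^ 2 * Real.cos θ * Ux t (Real.cos θ)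
          + Real.sin θ ^ 4 * Uxx t (Real.cos θ)) θ := by
    intro t ht θ hθ
    obtain ⟨h1, h2, _⟩ := hU t ht _ (hcos θ hθ)
    refine HasDerivAt.congr_of_eventuallyEq ?_ (d1' t ht θ hθ)
    exact (((((Real.hasDerivAt_sin θ).const_mul 2).mul (Real.hasDerivAt_cos θ)).mul
      (h1.comp θ (Real.hasDerivAt_cos θ))).sub
      (((Real.hasDerivAt_sin θ).pow 3).mul (h2.comp θ (Real.hasDerivAt_cos θ)))).congr_deriv
      (by simp; ring)
  refine ⟨?_, hinit, fun t _ => by simp, ?_, fun t ht θ hθ => (d1 t ht θ hθ).differentiableAt,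
    fun t ht θ hθ => (d2 t ht θ hθ).differentiableAt, ?_⟩
  · refine ContinuousOn.mul (by fun_prop) (hcont.comp (f := fun q : ℝ × ℝ => (q.1, Real.cos q.2))
      (by fun_prop) fun q hq => ⟨hq.1, Real.neg_one_le_cos _, Real.cos_le_one _⟩)
  · intro t ht θ hθ
    exact ((hU t ht _ (hcos θ hθ)).2.2.const_mul _).differentiableAt
  · intro t ht θ hθ
    obtain ⟨_, _, h3⟩ := hU t ht _ (hcos θ hθ)
    have hS : Real.sin θ ≠ 0 := (Real.sin_pos_of_mem_Ioo hθ).ne'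
    have hd := d2 t ht θ hθ
    have hd' := (Real.hasDerivAt_sin θ).fun_mul hd
    rw [(h3.const_mul (Real.sin θ ^ 2)).deriv, hd'.deriv, (d1 t ht θ hθ).deriv]
    have hC : Real.cos θ ^ 2 = 1 - Real.sin θ ^ 2 := Real.cos_sq' θ
    have hlam : hopfLam n = 1 + 2 * (1 / (2 * ((n : ℝ) + 1))) := by rw [hopfLam]; field_simp
    rw [hlam]
    generalize 1 / (2 * ((n : ℝ) + 1)) = e at *
    generalize Real.sin θ = S at *
    generalize Real.cos θ = C at *
    generalize U t C = u at *
    generalize Ux t C = u1 at *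
    generalize Uxx t C = u2 at *
    field_simp
    linear_combination (2 * u - 2 * e * S ^ 2 * u2) * hC

/-! ### The maximum principle -/

/-- A positive second derivative would make the point a local minimum too; the function would be
locally constant, with second derivative zero. -/
theorem IsLocalMax.second_deriv_nonpos {f f' : ℝ → ℝ} {f'' x : ℝ} (h : IsLocalMax f x)
    (h1 : ∀ᶠ y in nhds x, HasDerivAt f (f' y) y) (h2 : HasDerivAt f' f'' x) : f'' ≤ 0 := by
  by_contra! hpos
  have e1 : deriv f =ᶠ[nhds x] f' := h1.mono fun y hy => hy.deriv
  have e2 : deriv (deriv f) x = f'' := by rw [e1.deriv_eq, h2.deriv]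
  have hmin : IsLocalMin f x :=
    isLocalMin_of_deriv_deriv_pos (by rwa [e2]) h.deriv_eq_zero h1.self_of_nhds.continuousAt
  have hconst : f =ᶠ[nhds x] fun _ => f x := by
    filter_upwards [h, hmin] with y hy hy' using le_antisymm hy hy'
  have : deriv (deriv f) x = 0 := by
    rw [hconst.deriv.deriv_eq]; simp
  linarith

/-- Comparison with earlier times only, since the maximum may occur at the final time. -/
theorem HasDerivAt.nonneg_of_le_left {f : ℝ → ℝ} {d t : ℝ} (h : HasDerivAt f d t)
    (hle : ∀ᶠ τ in nhdsWithin t (Set.Iio t), f τ ≤ f t) : 0 ≤ d := by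
  have h1 := (hasDerivWithinAt_iff_tendsto_slope' (by simp)).1
    (h.hasDerivWithinAt (s := Set.Iio t))
  refine ge_of_tendsto h1 ?_
  filter_upwards [hle, self_mem_nhdsWithin] with τ hτ hτ'
  rw [slope_def_field]
  exact div_nonneg_of_nonpos (by linarith) (by linarith [Set.mem_Iio.1 hτ'])

/-- The maximum principle for the reduced equation, with a barrier function `B`. -/
theorem IsReducedSolution.nonpos {e T : ℝ} (he : 0 ≤ e) {z : ℝ → ℝ → ℝ}
    (hz : IsReducedSolution e (Set.Ioc 0 T) z)
    (hcont : ContinuousOn (fun q : ℝ × ℝ => z q.1 q.2) (Set.Icc 0 T ×ˢ Set.Ioo (-1) 1))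
    (h0 : ∀ x ∈ Set.Ioo (-1 : ℝ) 1, z 0 x = 0) {B B1 B2 : ℝ → ℝ}
    (hB : ∀ x ∈ Set.Ioo (-1 : ℝ) 1, 1 ≤ B x)
    (hB1 : ∀ x ∈ Set.Ioo (-1 : ℝ) 1, HasDerivAt B (B1 x) x)
    (hB2 : ∀ x ∈ Set.Ioo (-1 : ℝ) 1, HasDerivAt B1 (B2 x) x)
    (hLB : ∀ x ∈ Set.Ioo (-1 : ℝ) 1,
      e * (1 - x ^ 2) * B2 x + (1 - 4 * e) * x * B1 x + (1 - 2 * e) * B x ≤ 2 * B x)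
    (hbd : ∀ δ > 0, ∃ η > 0, ∀ t ∈ Set.Icc 0 T, ∀ x : ℝ, 1 - η < |x| → |x| < 1 →
      z t x ≤ δ * B x) :
    ∀ t ∈ Set.Icc 0 T, ∀ x ∈ Set.Ioo (-1 : ℝ) 1, z t x ≤ 0 := by
  obtain ⟨zx, zxx, hz⟩ := hz
  intro t ht x hx
  by_contra! hpos
  have hBx := hB x hx
  -- Half the value for which `w` would vanish at `(t, x)`, so that `w` is positive there.
  set δ : ℝ := Real.exp (-3 * t) * z t x / (2 * B x) with hδ
  have hδ0 : 0 < δ := by positivity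
  set w : ℝ → ℝ → ℝ := fun t x => Real.exp (-3 * t) * z t x - δ * B x with hw
  have hwpos : 0 < w t x := by
    have : δ * B x = Real.exp (-3 * t) * z t x / 2 := by rw [hδ]; field_simp
    simp only [hw, this]
    have : 0 < Real.exp (-3 * t) * z t x := by positivity
    linarith
  obtain ⟨η, hη, hbd⟩ := hbd δ hδ0
  have hout : ∀ t ∈ Set.Icc 0 T, ∀ x : ℝ, 1 - η < |x| → |x| < 1 → w t x ≤ 0 := by
    intro t ht x h1 h2
    have hB' := hB x (abs_lt.1 h2)
    have h3 := hbd t ht x h1 h2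
    have h4 : Real.exp (-3 * t) ≤ 1 := Real.exp_le_one_iff.2 (by linarith [ht.1])
    have h5 := Real.exp_pos (-3 * t)
    have h6 : 0 ≤ δ * B x := by positivity
    simp only [hw]
    nlinarith [mul_le_mul_of_nonneg_left h3 h5.le]
  have hsub : Set.Icc 0 T ×ˢ Set.Icc (-(1 - η)) (1 - η) ⊆ Set.Icc 0 T ×ˢ Set.Ioo (-1 : ℝ) 1 :=
    Set.prod_mono_right fun y hy => ⟨by linarith [hy.1], by linarith [hy.2]⟩
  have hin : ∀ t ∈ Set.Icc 0 T, ∀ x ∈ Set.Ioo (-1 : ℝ) 1, 0 < w t x →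
      x ∈ Set.Icc (-(1 - η)) (1 - η) := by
    intro t ht x hx h
    by_contra hcon
    refine absurd (hout t ht x ?_ (abs_lt.2 hx)) (not_le.2 h)
    by_contra! h'
    exact hcon (abs_le.1 h')
  have hBc : ContinuousOn B (Set.Ioo (-1) 1) := fun x hx => (hB1 x hx).continuousAt.continuousWithinAt
  have hwc : ContinuousOn (fun q : ℝ × ℝ => w q.1 q.2) (Set.Icc 0 T ×ˢ Set.Ioo (-1) 1) :=
    (ContinuousOn.mul (by fun_prop) hcont).sub
      (continuousOn_const.mul (hBc.comp continuousOn_snd fun q hq => hq.2))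
  -- Near the poles `w ≤ 0` by the choice of `η`, so a positive maximum is attained on a compact
  -- rectangle inside the strip.
  obtain ⟨⟨t₀, x₀⟩, hmem, hmax⟩ := (isCompact_Icc.prod isCompact_Icc).exists_isMaxOn
    ⟨(t, x), ht, hin t ht x hx hwpos⟩ (hwc.mono hsub)
  obtain ⟨ht₀, hx₀⟩ := hsub hmem
  simp only at ht₀ hx₀
  have hmax' : ∀ t ∈ Set.Icc 0 T, ∀ x ∈ Set.Ioo (-1 : ℝ) 1, w t x ≤ w t₀ x₀ := by
    have h1 : w t x ≤ w t₀ x₀ := hmax (a := (t, x)) ⟨ht, hin t ht x hx hwpos⟩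
    intro t' ht' x' hx'
    by_cases h : 0 < w t' x'
    · exact hmax (a := (t', x')) ⟨ht', hin t' ht' x' hx' h⟩
    · linarith
  have hw₀ : 0 < w t₀ x₀ := hwpos.trans_le (hmax' t ht x hx)
  have ht₀pos : 0 < t₀ := by
    rcases ht₀.1.lt_or_eq with h | h
    · exact h
    · exfalso
      have hB' := hB x₀ hx₀
      rw [← h] at hw₀
      simp only [hw, h0 x₀ hx₀] at hw₀
      nlinarith
  have ht₀' : t₀ ∈ Set.Ioc 0 T := ⟨ht₀pos, ht₀.2⟩
  have hnhds := isOpen_Ioo.mem_nhds hx₀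
  have dx : ∀ y ∈ Set.Ioo (-1 : ℝ) 1,
      HasDerivAt (w t₀) (Real.exp (-3 * t₀) * zx t₀ y - δ * B1 y) y := fun y hy =>
    ((hz t₀ ht₀' y hy).1.const_mul _).sub ((hB1 y hy).const_mul δ)
  have dxx : HasDerivAt (fun y => Real.exp (-3 * t₀) * zx t₀ y - δ * B1 y)
      (Real.exp (-3 * t₀) * zxx t₀ x₀ - δ * B2 x₀) x₀ :=
    ((hz t₀ ht₀' x₀ hx₀).2.1.const_mul _).sub ((hB2 x₀ hx₀).const_mul δ)
  have hloc : IsLocalMax (w t₀) x₀ := by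
    filter_upwards [hnhds] with y hy using hmax' t₀ ht₀ y hy
  have e1 := hloc.hasDerivAt_eq_zero (dx x₀ hx₀)
  have e2 := hloc.second_deriv_nonpos (by filter_upwards [hnhds] with y hy using dx y hy) dxx
  have hexp : HasDerivAt (fun τ => Real.exp (-3 * τ)) (-3 * Real.exp (-3 * t₀)) t₀ := by
    have := ((hasDerivAt_id t₀).const_mul (-3)).exp
    simp only [id] at this
    exact this.congr_deriv (by ring)
  have dt := (hexp.mul (hz t₀ ht₀' x₀ hx₀).2.2).sub_const (δ * B x₀)
  have e3 := HasDerivAt.nonneg_of_le_left (f := fun τ => w τ x₀) dt (by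
    filter_upwards [Ioo_mem_nhdsLT ht₀pos] with τ hτ
    exact hmax' τ ⟨hτ.1.le, hτ.2.le.trans ht₀.2⟩ x₀ hx₀)
  have hL := hLB x₀ hx₀
  have hB' := hB x₀ hx₀
  have hy : 0 ≤ e * (1 - x₀ ^ 2) := mul_nonneg he (by nlinarith [hx₀.1, hx₀.2])
  simp only [hw] at hw₀
  generalize Real.exp (-3 * t₀) = E at *
  generalize z t₀ x₀ = u at *
  generalize zx t₀ x₀ = u1 at *
  generalize zxx t₀ x₀ = u2 at *
  -- At the maximum the equation gives `w_t ≤ 2 δ B + (1 - 2 e) w - 3 (w + δ B) = -(2 + 2 e) w - δ B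
  -- < 0`, against `w_t ≥ 0`. The decay rate 3 is chosen to exceed the 2 allowed to the barrier.
  have f1 := mul_nonneg hy (neg_nonneg.2 e2)
  have f2 := mul_le_mul_of_nonneg_left hL hδ0.le
  have f3 : 0 < δ * B x₀ := by positivity
  have f4 : (1 - 4 * e) * x₀ * (E * u1 - δ * B1 x₀) = 0 := by rw [e1, mul_zero]
  have f5 := mul_nonneg he hw₀.le
  nlinarith

/-! ### Smooth functions of time and one space variable -/

section TimeSpace

variable {F : ℝ → ℝ → ℝ} {T : ℝ} {I : Set ℝ}

theorem uniqueDiffOn_Ico_prod (hI : IsOpen I) : UniqueDiffOn ℝ (Set.Ico 0 T ×ˢ I) :=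
  (uniqueDiffOn_Ico 0 T).prod hI.uniqueDiffOn

theorem ContDiffOn.slice (hF : ContDiffOn ℝ ∞ (fun q : ℝ × ℝ => F q.1 q.2) (Set.Ico 0 T ×ˢ I))
    {t : ℝ} (ht : t ∈ Set.Ico 0 T) : ContDiffOn ℝ ∞ (F t) I :=
  hF.comp (f := fun x => (t, x)) (by fun_prop) fun x hx => ⟨ht, hx⟩

/-- At `t = 0` only derivatives within the strip are available. Applied to `(0, 1)` they agree with
the ordinary `x`-derivative because `I` is open, and so smoothness up to the initial time is kept.
-/
theorem ContDiffOn.space_deriv (hI : IsOpen I)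
    (hF : ContDiffOn ℝ ∞ (fun q : ℝ × ℝ => F q.1 q.2) (Set.Ico 0 T ×ˢ I)) :
    ContDiffOn ℝ ∞ (fun q : ℝ × ℝ => deriv (F q.1) q.2) (Set.Ico 0 T ×ˢ I) := by
  have h1 := (hF.fderivWithin (uniqueDiffOn_Ico_prod hI) (m := ∞) (by simp)).clm_apply
    (contDiffOn_const (c := ((0 : ℝ), (1 : ℝ))))
  refine h1.congr fun q hq => ?_
  have hd := ((hF.differentiableOn (by simp)) q hq).hasFDerivWithinAt
  have hc : HasDerivWithinAt (fun x : ℝ => (q.1, x)) ((0 : ℝ), (1 : ℝ)) I q.2 :=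
    ((hasDerivAt_const q.2 q.1).prodMk (hasDerivAt_id q.2)).hasDerivWithinAt
  have := hd.comp_hasDerivWithinAt (f := fun x : ℝ => (q.1, x)) q.2 hc fun x hx => ⟨hq.1, hx⟩
  exact (this.hasDerivAt (hI.mem_nhds hq.2)).deriv

theorem ContDiffOn.space_iteratedDeriv (hI : IsOpen I) (k : ℕ)
    (hF : ContDiffOn ℝ ∞ (fun q : ℝ × ℝ => F q.1 q.2) (Set.Ico 0 T ×ˢ I)) :
    ContDiffOn ℝ ∞ (fun q : ℝ × ℝ => iteratedDeriv k (F q.1) q.2) (Set.Ico 0 T ×ˢ I) := by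
  induction k generalizing F with
  | zero => simpa using hF
  | succ k ih =>
    simp only [iteratedDeriv_succ']
    exact ih (F := fun t => deriv (F t)) (hF.space_deriv hI)

theorem hasDerivAt_time_of_contDiffAt {t x : ℝ}
    (hF : ContDiffAt ℝ ∞ (fun q : ℝ × ℝ => F q.1 q.2) (t, x)) :
    HasDerivAt (fun τ => F τ x) (fderiv ℝ (fun q : ℝ × ℝ => F q.1 q.2) (t, x) (1, 0)) t := by
  have hd := (hF.differentiableAt (by simp)).hasFDerivAt
  have hc : HasDerivAt (fun τ : ℝ => (τ, x)) ((1 : ℝ), (0 : ℝ)) t :=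
    (hasDerivAt_id t).prodMk (hasDerivAt_const t x)
  exact hd.comp_hasDerivAt (f := fun τ : ℝ => (τ, x)) t hc

theorem hasDerivAt_space_of_contDiffAt {t x : ℝ}
    (hF : ContDiffAt ℝ ∞ (fun q : ℝ × ℝ => F q.1 q.2) (t, x)) :
    HasDerivAt (F t) (fderiv ℝ (fun q : ℝ × ℝ => F q.1 q.2) (t, x) (0, 1)) x := by
  have hd := (hF.differentiableAt (by simp)).hasFDerivAt
  have hc : HasDerivAt (fun y : ℝ => (t, y)) ((0 : ℝ), (1 : ℝ)) x :=
    (hasDerivAt_const x t).prodMk (hasDerivAt_id x)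
  exact hd.comp_hasDerivAt (f := fun y : ℝ => (t, y)) x hc

/-- Mixed partial derivatives of a smooth function commute. -/
theorem hasDerivAt_time_deriv {Ω : Set (ℝ × ℝ)} (hΩ : IsOpen Ω)
    (hF : ContDiffOn ℝ ∞ (fun q : ℝ × ℝ => F q.1 q.2) Ω) {t x : ℝ} (htx : (t, x) ∈ Ω) :
    HasDerivAt (fun τ => deriv (F τ) x) (deriv (fun y => deriv (fun τ => F τ y) t) x) t := by
  set G : ℝ × ℝ → ℝ := fun q => F q.1 q.2 with hG
  have hat : ∀ q ∈ Ω, ContDiffAt ℝ ∞ G q := fun q hq => hF.contDiffAt (hΩ.mem_nhds hq)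
  have hsymm : IsSymmSndFDerivAt ℝ G (t, x) := (hat _ htx).isSymmSndFDerivAt (by
    simpa using WithTop.coe_le_coe.2 (le_top : (2 : ℕ∞) ≤ ⊤))
  have hG' : DifferentiableAt ℝ (fderiv ℝ G) (t, x) :=
    ((hat _ htx).fderiv_right (m := ∞) (by simp)).differentiableAt (by simp)
  have hxd : ∀ v : ℝ × ℝ, HasFDerivAt (fun q => fderiv ℝ G q v)
      ((fderiv ℝ (fderiv ℝ G) (t, x)).flip v) (t, x) := fun v => by
    have := hG'.hasFDerivAt.clm_apply (hasFDerivAt_const v (t, x))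
    refine this.congr_fderiv ?_
    ext <;> simp
  have c1 : HasDerivAt (fun τ : ℝ => (τ, x)) ((1 : ℝ), (0 : ℝ)) t :=
    (hasDerivAt_id t).prodMk (hasDerivAt_const t x)
  have c2 : HasDerivAt (fun y : ℝ => (t, y)) ((0 : ℝ), (1 : ℝ)) x :=
    (hasDerivAt_const x t).prodMk (hasDerivAt_id x)
  have h1 := (hxd (0, 1)).comp_hasDerivAt (f := fun τ : ℝ => (τ, x)) t c1
  have h2 := (hxd (1, 0)).comp_hasDerivAt (f := fun y : ℝ => (t, y)) x c2
  have n1 : ∀ᶠ τ in nhds t, (τ, x) ∈ Ω :=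
    c1.continuousAt.eventually_mem (hΩ.mem_nhds htx)
  have n2 : ∀ᶠ y in nhds x, (t, y) ∈ Ω :=
    c2.continuousAt.eventually_mem (hΩ.mem_nhds htx)
  have h2' : deriv (fun y => deriv (fun τ => F τ y) t) x
      = (fderiv ℝ (fderiv ℝ G) (t, x)).flip (1, 0) (0, 1) := by
    refine (h2.congr_of_eventuallyEq ?_).deriv
    filter_upwards [n2] with y hy using (hasDerivAt_time_of_contDiffAt (hat _ hy)).deriv
  rw [h2']
  refine (h1.congr_of_eventuallyEq ?_).congr_deriv ?_
  · filter_upwards [n1] with τ hτ using (hasDerivAt_space_of_contDiffAt (hat _ hτ)).deriv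
  · exact hsymm (1, 0) (0, 1)

theorem ContDiffOn.time_deriv (hI : IsOpen I)
    (hF : ContDiffOn ℝ ∞ (fun q : ℝ × ℝ => F q.1 q.2) (Set.Ioo 0 T ×ˢ I)) :
    ContDiffOn ℝ ∞ (fun q : ℝ × ℝ => deriv (fun τ => F τ q.2) q.1) (Set.Ioo 0 T ×ˢ I) := by
  have hΩ : IsOpen (Set.Ioo 0 T ×ˢ I) := isOpen_Ioo.prod hI
  have h1 := (hF.fderiv_of_isOpen hΩ (m := ∞) (by simp)).clm_apply
    (contDiffOn_const (c := ((1 : ℝ), (0 : ℝ))))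
  exact h1.congr fun q hq =>
    (hasDerivAt_time_of_contDiffAt (hF.contDiffAt (hΩ.mem_nhds hq))).deriv

theorem hasDerivAt_time_iteratedDeriv (hI : IsOpen I) (k : ℕ)
    (hF : ContDiffOn ℝ ∞ (fun q : ℝ × ℝ => F q.1 q.2) (Set.Ico 0 T ×ˢ I))
    {t : ℝ} (ht : t ∈ Set.Ioo 0 T) {x : ℝ} (hx : x ∈ I) :
    HasDerivAt (fun τ => iteratedDeriv k (F τ) x)
      (iteratedDeriv k (fun y => deriv (fun τ => F τ y) t) x) t := by
  induction k generalizing F with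
  | zero =>
    have hF' := hF.mono (Set.prod_mono_left Set.Ioo_subset_Ico_self)
    have := hasDerivAt_time_of_contDiffAt (hF'.contDiffAt
      ((isOpen_Ioo.prod hI).mem_nhds (Set.mk_mem_prod ht hx)))
    simpa using this.differentiableAt.hasDerivAt
  | succ k ih =>
    have hF' := hF.mono (Set.prod_mono_left Set.Ioo_subset_Ico_self)
    simp only [iteratedDeriv_succ']
    have := ih (F := fun t => deriv (F t)) (hF.space_deriv hI)
    refine this.congr_deriv (Filter.EventuallyEq.iteratedDeriv_eq k ?_)
    filter_upwards [hI.mem_nhds hx] with y hy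
    exact (hasDerivAt_time_deriv (isOpen_Ioo.prod hI) hF' (Set.mk_mem_prod ht hy)).deriv

end TimeSpace

theorem ContDiffAt.deriv_smooth {f : ℝ → ℝ} {x : ℝ} (hf : ContDiffAt ℝ ∞ f x) :
    ContDiffAt ℝ ∞ (deriv f) x := by
  have h := (hf.fderiv_right (m := ∞) (by simp)).clm_apply (contDiffAt_const (c := (1 : ℝ)))
  simpa only [fderiv_apply_one_eq_deriv] using h

/-! ### Taylor coefficients at the origin -/

/-- The `k`-th Taylor coefficient at `0`. -/
noncomputable def taylorCoeff (k : ℕ) (f : ℝ → ℝ) : ℝ := iteratedDeriv k f 0 / k.factorial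

theorem taylorCoeff_add (k : ℕ) {f g : ℝ → ℝ} (hf : ContDiffAt ℝ ∞ f 0)
    (hg : ContDiffAt ℝ ∞ g 0) :
    taylorCoeff k (fun x => f x + g x) = taylorCoeff k f + taylorCoeff k g := by
  have : iteratedDeriv k (fun x => f x + g x) 0 = _ :=
    iteratedDeriv_add (hf.of_le (by exact_mod_cast le_top)) (hg.of_le (by exact_mod_cast le_top))
  rw [taylorCoeff, this, add_div]; rfl

theorem taylorCoeff_const_mul (k : ℕ) (c : ℝ) (f : ℝ → ℝ) :
    taylorCoeff k (fun x => c * f x) = c * taylorCoeff k f := by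
  rw [taylorCoeff, iteratedDeriv_const_mul_field, mul_div_assoc]; rfl

theorem taylorCoeff_deriv (k : ℕ) (f : ℝ → ℝ) :
    taylorCoeff k (deriv f) = (k + 1) * taylorCoeff (k + 1) f := by
  have h : (k.factorial : ℝ) ≠ 0 := by positivity
  have h2 : (k : ℝ) + 1 ≠ 0 := by positivity
  rw [taylorCoeff, taylorCoeff, iteratedDeriv_succ', Nat.factorial_succ]
  push_cast
  field_simp

theorem taylorCoeff_zero_id_mul (f : ℝ → ℝ) : taylorCoeff 0 (fun x => x * f x) = 0 := by
  simp [taylorCoeff]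

theorem taylorCoeff_succ_id_mul (k : ℕ) {f : ℝ → ℝ} (hf : ContDiffAt ℝ ∞ f 0) :
    taylorCoeff (k + 1) (fun x => x * f x) = taylorCoeff k f := by
  have h : (k.factorial : ℝ) ≠ 0 := by positivity
  have h2 : (k : ℝ) + 1 ≠ 0 := by positivity
  have h1 : iteratedDeriv (k + 1) (fun x => x * f x) 0 = (k + 1) * iteratedDeriv k f 0 := by
    rw [iteratedDeriv_fun_mul (f := fun x : ℝ => x) contDiffAt_id (hf.of_le (by exact_mod_cast le_top)),
      Finset.sum_eq_single 1]
    · simp [iteratedDeriv_fun_id_zero]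
    · intro i _ hi
      simp [iteratedDeriv_fun_id_zero, hi]
    · intro hi
      simp at hi
  rw [taylorCoeff, taylorCoeff, h1, Nat.factorial_succ]
  push_cast
  field_simp

theorem taylorCoeff_id_mul_deriv (k : ℕ) {f : ℝ → ℝ} (hf : ContDiffAt ℝ ∞ f 0) :
    taylorCoeff k (fun x => x * deriv f x) = k * taylorCoeff k f := by
  rcases k with _ | k
  · simp [taylorCoeff_zero_id_mul]
  · rw [taylorCoeff_succ_id_mul k (f := deriv f), taylorCoeff_deriv]
    · push_cast; rfl
    · exact hf.deriv_smooth

/-- By induction the lower coefficients vanish, and `f x / x ^ j` tends both to the coefficient of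
order `j` and to zero as `x → 0+`. A one-sided bound suffices, which matters because the equation is
known only for `τ > 0`. -/
theorem taylorCoeff_eq_zero_of_bound {f : ℝ → ℝ} (hf : ContDiffOn ℝ ∞ f (Set.Ioo (-1) 1)) {C : ℝ}
    {m : ℕ} (hbd : ∀ x ∈ Set.Ioo (0 : ℝ) 1, |f x| ≤ C * x ^ m) {j : ℕ} (hj : j < m) :
    taylorCoeff j f = 0 := by
  induction j using Nat.strong_induction_on with
  | _ j ih =>
    have h1 := Real.taylor_tendsto (n := j) (convex_Ioo (-1 : ℝ) 1) (x₀ := 0) (by norm_num)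
      (hf.of_le (by exact_mod_cast le_top))
    have h2 : ∀ x, taylorWithinEval f j (Set.Ioo (-1) 1) 0 x = taylorCoeff j f * x ^ j := by
      intro x
      have hw : ∀ k, iteratedDerivWithin k f (Set.Ioo (-1 : ℝ) 1) 0 = iteratedDeriv k f 0 :=
        fun k => iteratedDerivWithin_of_isOpen isOpen_Ioo (by norm_num)
      rw [taylor_within_apply, Finset.sum_range_succ, Finset.sum_eq_zero, zero_add, hw]
      · simp only [taylorCoeff, sub_zero, smul_eq_mul]; ring
      · intro k hk
        have hk := Finset.mem_range.1 hk
        have h0 := ih k hk (hk.trans hj)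
        have : (k.factorial : ℝ) ≠ 0 := by positivity
        rw [taylorCoeff, div_eq_zero_iff, or_iff_left this] at h0
        rw [hw, h0, smul_zero]
    have h3 : Filter.Tendsto (fun x => (f x - taylorWithinEval f j (Set.Ioo (-1) 1) 0 x)
        / (x - 0) ^ j) (nhdsWithin 0 (Set.Ioi 0)) (nhds 0) := by
      refine h1.mono_left ?_
      rw [nhdsWithin_le_iff]
      exact mem_nhdsWithin_of_mem_nhds (Ioo_mem_nhds (by norm_num) (by norm_num))
    have h4 : Filter.Tendsto (fun x => f x / x ^ j) (nhdsWithin 0 (Set.Ioi 0)) (nhds 0) := by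
      have hlim : Filter.Tendsto (fun x : ℝ => C * x ^ (m - j)) (nhdsWithin 0 (Set.Ioi 0))
          (nhds 0) := by
        have : Filter.Tendsto (fun x : ℝ => C * x ^ (m - j)) (nhds 0) (nhds (C * 0 ^ (m - j))) :=
          (Continuous.tendsto (by fun_prop) 0)
        rw [zero_pow (by omega), mul_zero] at this
        exact this.mono_left nhdsWithin_le_nhds
      refine squeeze_zero_norm' ?_ hlim
      filter_upwards [Ioo_mem_nhdsGT (zero_lt_one (α := ℝ))] with x hx
      have hxj : 0 < x ^ j := pow_pos hx.1 j
      rw [Real.norm_eq_abs, abs_div, abs_of_pos hxj, div_le_iff₀ hxj, mul_assoc, ← pow_add,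
        Nat.sub_add_cancel hj.le]
      exact hbd x hx
    have h5 : Filter.Tendsto (fun _ : ℝ => taylorCoeff j f) (nhdsWithin 0 (Set.Ioi 0)) (nhds 0) := by
      have := h4.sub h3
      rw [sub_zero] at this
      refine this.congr' ?_
      filter_upwards [self_mem_nhdsWithin] with x hx
      have hxj : x ^ j ≠ 0 := (pow_pos hx j).ne'
      rw [h2, sub_zero]
      field_simp
      ring
    exact tendsto_nhds_unique tendsto_const_nhds h5

/-- Taylor's formula of order four, uniformly in time. -/
theorem exists_taylor_bound {F : ℝ → ℝ → ℝ} {T T₁ : ℝ}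
    (hF : ContDiffOn ℝ ∞ (fun q : ℝ × ℝ => F q.1 q.2) (Set.Ico 0 T ×ˢ Set.Ioo (-1) 1))
    (hT₁ : T₁ < T)
    (h0 : ∀ t ∈ Set.Ico 0 T, ∀ k < 3, taylorCoeff k (F t) = 0) :
    ∃ C, ∀ t ∈ Set.Icc 0 T₁, ∀ x ∈ Set.Ioc (0 : ℝ) (1 / 2),
      |F t x - taylorCoeff 3 (F t) * x ^ 3| ≤ C * x ^ 4 := by
  have hsub : Set.Icc 0 T₁ ×ˢ Set.Icc (0 : ℝ) (1 / 2) ⊆ Set.Ico 0 T ×ˢ Set.Ioo (-1) 1 := by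
    rintro ⟨t, x⟩ ⟨ht, hx⟩
    exact ⟨⟨ht.1, ht.2.trans_lt hT₁⟩, by linarith [hx.1], by linarith [hx.2]⟩
  obtain ⟨C, hC⟩ := (isCompact_Icc.prod isCompact_Icc).exists_bound_of_continuousOn
    ((hF.space_iteratedDeriv isOpen_Ioo 4).continuousOn.mono hsub)
  refine ⟨C / 24, fun t ht x hx => ?_⟩
  have ht' : t ∈ Set.Ico 0 T := ⟨ht.1, ht.2.trans_lt hT₁⟩
  have hs := hF.slice ht'
  have hux : Set.uIcc 0 x = Set.Icc 0 x := Set.uIcc_of_le hx.1.le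
  have hsx : Set.Icc 0 x ⊆ Set.Ioo (-1 : ℝ) 1 := fun y hy =>
    ⟨by linarith [hy.1], by linarith [hy.2, hx.2]⟩
  obtain ⟨y, hy, hxy⟩ := taylor_mean_remainder_lagrange_iteratedDeriv (n := 3) (f := F t)
    hx.1.ne (((contDiffOn_infty.1 hs 4).of_le (by norm_cast)).mono (by rw [hux]; exact hsx))
  rw [Set.uIoo_of_le hx.1.le] at hy
  have hw : ∀ k, iteratedDerivWithin k (F t) (Set.uIcc 0 x) 0 = iteratedDeriv k (F t) 0 := by
    intro k
    rw [hux]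
    refine iteratedDerivWithin_eq_iteratedDeriv (uniqueDiffOn_Icc hx.1)
      ((hs.contDiffAt (isOpen_Ioo.mem_nhds (by norm_num))).of_le (by exact_mod_cast le_top))
      ⟨le_rfl, hx.1.le⟩
  have hz : ∀ k < 3, iteratedDeriv k (F t) 0 = 0 := by
    intro k hk
    have h := h0 t ht' k hk
    have hne : (k.factorial : ℝ) ≠ 0 := by positivity
    rwa [taylorCoeff, div_eq_zero_iff, or_iff_left hne] at h
  have ht3 : taylorWithinEval (F t) 3 (Set.uIcc 0 x) 0 x = taylorCoeff 3 (F t) * x ^ 3 := by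
    rw [taylor_within_apply, Finset.sum_range_succ, Finset.sum_eq_zero, zero_add, hw]
    · simp only [taylorCoeff, sub_zero, smul_eq_mul]; ring
    · intro k hk
      rw [hw, hz k (Finset.mem_range.1 hk), smul_zero]
  rw [ht3] at hxy
  rw [hxy, sub_zero]
  have hb := hC (t, y) ⟨ht, hy.1.le, hy.2.le.trans hx.2⟩
  rw [Real.norm_eq_abs] at hb
  have hx4 : 0 < x ^ 4 := pow_pos hx.1 4
  have h24 : ((3 + 1).factorial : ℝ) = 24 := by norm_num [Nat.factorial]
  rw [abs_div, abs_mul, h24, abs_of_pos (by norm_num : (0 : ℝ) < 24), abs_of_pos hx4,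
    div_mul_eq_mul_div]
  simp only [Nat.reduceAdd] at hb ⊢
  gcongr

/-! ### Jets of solutions at a pole -/

theorem taylorCoeff_id_sq_mul (k : ℕ) {f : ℝ → ℝ} (hf : ContDiffAt ℝ ∞ f 0) :
    taylorCoeff (k + 2) (fun x => x ^ 2 * f x) = taylorCoeff k f := by
  have h : (fun x => x ^ 2 * f x) = fun x => x * ((fun y => y * f y) x) := by
    funext x; ring
  have hg : ContDiffAt ℝ ∞ (fun y => y * f y) 0 := contDiffAt_id.mul hf
  rw [h, taylorCoeff_succ_id_mul (k + 1) hg, taylorCoeff_succ_id_mul k hf]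

/-- In the variable `τ` with `x = 1 - 2 τ²`, the reduced equation for `U` becomes an equation for
`w = τ³ U` with polynomial coefficients. -/
theorem reduced_equation_at_pole {e T : ℝ} {U w : ℝ → ℝ → ℝ}
    (hU : IsReducedSolution e (Set.Ioo 0 T) U)
    (hwU : ∀ t ∈ Set.Ico 0 T, ∀ τ ∈ Set.Ioo (0 : ℝ) 1, w t τ = τ ^ 3 * U t (1 - 2 * τ ^ 2))
    {t : ℝ} (ht : t ∈ Set.Ioo 0 T) {τ : ℝ} (hτ : τ ∈ Set.Ioo (0 : ℝ) 1) :
    4 * τ ^ 2 * deriv (fun r => w r τ) t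
      = e * (1 - τ ^ 2) * (τ ^ 2 * deriv (deriv (w t)) τ - 7 * (τ * deriv (w t) τ) + 15 * w t τ)
        - (1 - 4 * e) * (1 - 2 * τ ^ 2) * (τ * deriv (w t) τ - 3 * w t τ)
        + 4 * (1 - 2 * e) * τ ^ 2 * w t τ := by
  obtain ⟨Ux, Uxx, hU⟩ := hU
  have ht' : t ∈ Set.Ico 0 T := ⟨ht.1.le, ht.2⟩
  have hmem : ∀ y ∈ Set.Ioo (0 : ℝ) 1, 1 - 2 * y ^ 2 ∈ Set.Ioo (-1 : ℝ) 1 := by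
    intro y hy
    constructor <;> nlinarith [hy.1, hy.2]
  have hin : ∀ y : ℝ, HasDerivAt (fun y : ℝ => 1 - 2 * y ^ 2) (-(4 * y)) y := fun y =>
    ((((hasDerivAt_id y).pow 2).const_mul 2).const_sub 1).congr_deriv (by simp; ring)
  have d1 : ∀ y ∈ Set.Ioo (0 : ℝ) 1, HasDerivAt (w t)
      (3 * y ^ 2 * U t (1 - 2 * y ^ 2) - 4 * y ^ 4 * Ux t (1 - 2 * y ^ 2)) y := by
    intro y hy
    have h := ((hasDerivAt_id y).pow 3).mul ((hU t ht _ (hmem y hy)).1.comp y (hin y))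
    refine (h.congr_of_eventuallyEq ?_).congr_deriv (by simp; ring)
    filter_upwards [isOpen_Ioo.mem_nhds hy] with z hz using hwU t ht' z hz
  have d2 : HasDerivAt (deriv (w t)) (6 * τ * U t (1 - 2 * τ ^ 2)
      - 28 * τ ^ 3 * Ux t (1 - 2 * τ ^ 2) + 16 * τ ^ 5 * Uxx t (1 - 2 * τ ^ 2)) τ := by
    have h := ((((hasDerivAt_id τ).pow 2).const_mul 3).mul
      ((hU t ht _ (hmem τ hτ)).1.comp τ (hin τ))).sub
      ((((hasDerivAt_id τ).pow 4).const_mul 4).mul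
      ((hU t ht _ (hmem τ hτ)).2.1.comp τ (hin τ)))
    refine (h.congr_of_eventuallyEq ?_).congr_deriv (by simp; ring)
    filter_upwards [isOpen_Ioo.mem_nhds hτ] with z hz using (d1 z hz).deriv
  have d3 : HasDerivAt (fun r => w r τ) _ t :=
    ((hU t ht _ (hmem τ hτ)).2.2.const_mul (τ ^ 3)).congr_of_eventuallyEq (by
      filter_upwards [isOpen_Ioo.mem_nhds ht] with r hr using hwU r ⟨hr.1.le, hr.2⟩ τ hτ)
  rw [d3.deriv, d2.deriv, (d1 τ hτ).deriv, hwU t ht' τ hτ]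
  ring

/-- The evolution of the Taylor coefficients at the pole. -/
theorem hasDerivAt_taylorCoeff_at_pole {e T : ℝ} {U w : ℝ → ℝ → ℝ}
    (hU : IsReducedSolution e (Set.Ioo 0 T) U)
    (hw : ContDiffOn ℝ ∞ (fun q : ℝ × ℝ => w q.1 q.2) (Set.Ico 0 T ×ˢ Set.Ioo (-1) 1))
    (hwU : ∀ t ∈ Set.Ico 0 T, ∀ τ ∈ Set.Ioo (0 : ℝ) 1, w t τ = τ ^ 3 * U t (1 - 2 * τ ^ 2))
    (k : ℕ) {t : ℝ} (ht : t ∈ Set.Ioo 0 T) :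
    HasDerivAt (fun r => taylorCoeff k (w r))
      (((k : ℝ) - 1) * (e * (k + 1) - 1) / 4 * taylorCoeff (k + 2) (w t)
        + (4 * (1 - 2 * e) + 2 * (1 - 4 * e) * (k - 3) - e * (k - 3) * (k - 5)) / 4
          * taylorCoeff k (w t)) t := by
  have h0 : (0 : ℝ) ∈ Set.Ioo (-1 : ℝ) 1 := by norm_num
  have hnhds : Set.Ioo (-1 : ℝ) 1 ∈ nhds (0 : ℝ) := isOpen_Ioo.mem_nhds h0
  have ht' : t ∈ Set.Ico 0 T := ⟨ht.1.le, ht.2⟩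
  have hd := (hasDerivAt_time_iteratedDeriv isOpen_Ioo k hw ht h0).div_const (k.factorial : ℝ)
  refine hd.congr_deriv ?_
  set wt : ℝ → ℝ := fun y => deriv (fun r => w r y) t with hwt
  change taylorCoeff k wt = _
  have sO : ∀ {f : ℝ → ℝ}, ContDiffOn ℝ ∞ f (Set.Ioo (-1) 1) →
      ContDiffOn ℝ ∞ (deriv f) (Set.Ioo (-1) 1) := fun hf =>
    hf.deriv_of_isOpen isOpen_Ioo (by simp)
  have s0 : ContDiffOn ℝ ∞ (w t) (Set.Ioo (-1) 1) := hw.slice ht'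
  have s1 := sO s0
  have s2 := sO s1
  have swt : ContDiffOn ℝ ∞ wt (Set.Ioo (-1) 1) :=
    ((hw.mono (Set.prod_mono_left Set.Ioo_subset_Ico_self)).time_deriv isOpen_Ioo).comp
      (f := fun y => (t, y)) (by fun_prop) fun y hy => ⟨ht, hy⟩
  have hid : ContDiffOn ℝ ∞ (fun y : ℝ => y) (Set.Ioo (-1) 1) := contDiffOn_id
  set E : (ℝ → ℝ) → ℝ → ℝ := fun f y => y * deriv f y with hE
  have sE : ContDiffOn ℝ ∞ (E (w t)) (Set.Ioo (-1) 1) := hid.mul s1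
  have sEE : ContDiffOn ℝ ∞ (E (E (w t))) (Set.Ioo (-1) 1) := hid.mul (sO sE)
  -- `P` and `R` are the two Euler operators of the equation
  set P : ℝ → ℝ := fun y => E (E (w t)) y + (-8 * E (w t) y + 15 * w t y) with hP
  set R : ℝ → ℝ := fun y => E (w t) y + (-3) * w t y with hR
  have sR : ContDiffOn ℝ ∞ R (Set.Ioo (-1) 1) := sE.add (contDiffOn_const.mul s0)
  have sP : ContDiffOn ℝ ∞ P (Set.Ioo (-1) 1) :=
    sEE.add ((contDiffOn_const.mul sE).add (contDiffOn_const.mul s0))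
  -- The equation at the pole is sorted as `y² G + H = 0`, with `G` and `H` built from the Euler
  -- operator `E`. This operator multiplies the coefficient of order `j` by `j`, so `P` contributes
  -- `(j - 3)(j - 5)` and `R` contributes `j - 3`.
  set G : ℝ → ℝ := fun y => 4 * wt y + (e * P y + (-(2 * (1 - 4 * e)) * R y
    + -(4 * (1 - 2 * e)) * w t y)) with hG
  set H : ℝ → ℝ := fun y => -e * P y + (1 - 4 * e) * R y with hH
  have sH : ContDiffOn ℝ ∞ H (Set.Ioo (-1) 1) :=
    (contDiffOn_const.mul sP).add (contDiffOn_const.mul sR)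
  have sG : ContDiffOn ℝ ∞ G (Set.Ioo (-1) 1) :=
    (contDiffOn_const.mul swt).add ((contDiffOn_const.mul sP).add
      ((contDiffOn_const.mul sR).add (contDiffOn_const.mul s0)))
  have hz : ∀ y ∈ Set.Ioo (0 : ℝ) 1, y ^ 2 * G y + H y = 0 := by
    intro y hy
    have heq := reduced_equation_at_pole hU hwU ht hy
    have hEE : E (E (w t)) y = y * deriv (w t) y + y ^ 2 * deriv (deriv (w t)) y := by
      have hy' : y ∈ Set.Ioo (-1 : ℝ) 1 := ⟨by linarith [hy.1], hy.2⟩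
      have hdd : DifferentiableAt ℝ (deriv (w t)) y :=
        (s1.contDiffAt (isOpen_Ioo.mem_nhds hy')).differentiableAt (by simp)
      have : HasDerivAt (E (w t)) (deriv (w t) y + y * deriv (deriv (w t)) y) y :=
        ((hasDerivAt_id y).mul hdd.hasDerivAt).congr_deriv (by simp)
      change y * deriv (E (w t)) y = _
      rw [this.deriv]; ring
    simp only [hG, hH, hP, hR, hEE]
    simp only [hE, hwt]
    linear_combination heq
  have at0 : ∀ {f : ℝ → ℝ}, ContDiffOn ℝ ∞ f (Set.Ioo (-1) 1) → ContDiffAt ℝ ∞ f 0 :=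
    fun hf => hf.contDiffAt hnhds
  -- At order `k + 2`, `y² G` contributes order `k` and `H` order `k + 2`: exactly two coefficients
  -- are coupled.
  have hcoeff : taylorCoeff (k + 2) (fun y => y ^ 2 * G y + H y) = 0 :=
    taylorCoeff_eq_zero_of_bound (C := 0) (m := k + 3) (((hid.pow 2).mul sG).add sH)
      (fun y hy => by rw [hz y hy]; simp) (by omega)
  have cE : ∀ j, taylorCoeff j (E (w t)) = j * taylorCoeff j (w t) := fun j =>
    taylorCoeff_id_mul_deriv j (at0 s0)
  have cEE : ∀ j, taylorCoeff j (E (E (w t))) = j * (j * taylorCoeff j (w t)) := fun j => by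
    rw [← cE]; exact taylorCoeff_id_mul_deriv j (at0 sE)
  have cP : ∀ j, taylorCoeff j P = ((j : ℝ) - 3) * (j - 5) * taylorCoeff j (w t) := by
    intro j
    rw [hP, taylorCoeff_add j (at0 sEE) (at0 ((contDiffOn_const.mul sE).add
        (contDiffOn_const.mul s0))), taylorCoeff_add j (at0 (contDiffOn_const.mul sE))
        (at0 (contDiffOn_const.mul s0)), taylorCoeff_const_mul, taylorCoeff_const_mul, cE, cEE]
    ring
  have cR : ∀ j, taylorCoeff j R = ((j : ℝ) - 3) * taylorCoeff j (w t) := by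
    intro j
    rw [hR, taylorCoeff_add j (at0 sE) (at0 (contDiffOn_const.mul s0)), taylorCoeff_const_mul, cE]
    ring
  rw [taylorCoeff_add _ (at0 ((hid.pow 2).mul sG)) (at0 sH), taylorCoeff_id_sq_mul k (at0 sG), hG,
    hH, taylorCoeff_add k (at0 (contDiffOn_const.mul swt)) (at0 ((contDiffOn_const.mul sP).add
      ((contDiffOn_const.mul sR).add (contDiffOn_const.mul s0)))),
    taylorCoeff_add k (at0 (contDiffOn_const.mul sP)) (at0
      ((contDiffOn_const.mul sR).add (contDiffOn_const.mul s0))),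
    taylorCoeff_add k (at0 (contDiffOn_const.mul sR)) (at0 (contDiffOn_const.mul s0)),
    taylorCoeff_add _ (at0 (contDiffOn_const.mul sP)) (at0 (contDiffOn_const.mul sR))] at hcoeff
  simp only [taylorCoeff_const_mul, cP, cR] at hcoeff
  push_cast at hcoeff
  linear_combination hcoeff / 4

/-- The product `e^{-c t} f` has zero derivative. Only continuity is required at `t = 0`. -/
theorem eq_zero_of_hasDerivAt_mul {f : ℝ → ℝ} {T c : ℝ} (hf : ContinuousOn f (Set.Ico 0 T))
    (hd : ∀ t ∈ Set.Ioo 0 T, HasDerivAt f (c * f t) t) (h0 : f 0 = 0) :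
    ∀ t ∈ Set.Ico 0 T, f t = 0 := by
  intro t ht
  rcases ht.1.eq_or_lt with h | h
  · rw [← h, h0]
  have hsub : Set.Icc 0 t ⊆ Set.Ico 0 T := fun y hy => ⟨hy.1, hy.2.trans_lt ht.2⟩
  have hder : ∀ y ∈ Set.Ioo 0 t, HasDerivAt (fun y => Real.exp (-c * y) * f y) 0 y := by
    intro y hy
    have h1 := ((hasDerivAt_id y).const_mul (-c)).exp
    exact (h1.mul (hd y ⟨hy.1, hy.2.trans ht.2⟩)).congr_deriv (by simp; ring)
  obtain ⟨y, _, hy⟩ := exists_hasDerivAt_eq_slope (fun y => Real.exp (-c * y) * f y) (fun _ => 0) h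
    (ContinuousOn.mul (by fun_prop) (hf.mono hsub)) hder
  rw [eq_comm, div_eq_zero_iff, or_iff_left (by linarith), h0, mul_zero, sub_zero] at hy
  exact (mul_eq_zero.1 hy).resolve_left (Real.exp_pos _).ne'

/-- A solution which is smooth at the pole and vanishes there to order `n` at the initial time
vanishes at the pole at all times. -/
theorem exists_bound_at_pole {n : ℕ} {T T₁ C : ℝ} {U w : ℝ → ℝ → ℝ} (hT₁ : T₁ < T)
    (hU : IsReducedSolution (1 / (2 * ((n : ℝ) + 1))) (Set.Ioo 0 T) U)
    (hw : ContDiffOn ℝ ∞ (fun q : ℝ × ℝ => w q.1 q.2) (Set.Ico 0 T ×ˢ Set.Ioo (-1) 1))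
    (hwU : ∀ t ∈ Set.Ico 0 T, ∀ τ ∈ Set.Ioo (0 : ℝ) 1, w t τ = τ ^ 3 * U t (1 - 2 * τ ^ 2))
    (hjet : ∀ t ∈ Set.Ico 0 T, ∀ k < 3, taylorCoeff k (w t) = 0)
    (hinit : ∀ x ∈ Set.Ioo (-1 : ℝ) 1, |U 0 x| ≤ C * (1 - x ^ 2) ^ n) :
    ∃ D, 0 ≤ D ∧ ∀ t ∈ Set.Icc 0 T₁, ∀ τ ∈ Set.Ioc (0 : ℝ) (1 / 2),
      |U t (1 - 2 * τ ^ 2)| ≤ D ∧ (0 < n → |U t (1 - 2 * τ ^ 2)| ≤ D * τ) := by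
  rcases lt_or_ge T₁ 0 with hneg | hT₁0
  · exact ⟨0, le_rfl, fun t ht => absurd (ht.1.trans ht.2) (by linarith)⟩
  have hT : 0 < T := by linarith
  have hcont : ∀ k, ContinuousOn (fun t => taylorCoeff k (w t)) (Set.Ico 0 T) := fun k =>
    (((hw.space_iteratedDeriv isOpen_Ioo k).continuousOn.comp (f := fun t : ℝ => (t, (0 : ℝ)))
      (by fun_prop) fun t ht => ⟨ht, by norm_num⟩)).div_const _
  have hC : 0 ≤ C := by
    have := hinit 0 (by norm_num)
    simp only [ne_eq, OfNat.ofNat_ne_zero, not_false_eq_true, zero_pow, sub_zero, one_pow,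
      mul_one] at this
    exact (abs_nonneg _).trans this
  -- Near the pole `1 - x² ≤ 4 τ²`, so `w = τ³ U` is initially of order `τ^(2 n + 3)`.
  have hz0 : ∀ k < 2 * n + 3, taylorCoeff k (w 0) = 0 := by
    intro k hk
    refine taylorCoeff_eq_zero_of_bound (C := C * 4 ^ n) (m := 2 * n + 3)
      (hw.slice ⟨le_rfl, hT⟩) (fun τ hτ => ?_) hk
    rw [hwU 0 ⟨le_rfl, hT⟩ τ hτ, abs_mul, abs_of_pos (pow_pos hτ.1 3)]
    have h1 := hinit (1 - 2 * τ ^ 2) ⟨by nlinarith [hτ.1, hτ.2], by nlinarith [hτ.1, hτ.2]⟩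
    have h2 : (1 - (1 - 2 * τ ^ 2) ^ 2) ^ n ≤ (4 * τ ^ 2) ^ n := by
      refine pow_le_pow_left₀ ?_ ?_ n
      · have h3 : 0 ≤ τ ^ 2 * (1 - τ ^ 2) := by
          refine mul_nonneg (sq_nonneg τ) ?_
          nlinarith [hτ.1, hτ.2]
        linarith
      · nlinarith [sq_nonneg (τ ^ 2)]
    calc τ ^ 3 * |U 0 (1 - 2 * τ ^ 2)| ≤ τ ^ 3 * (C * (4 * τ ^ 2) ^ n) :=
          mul_le_mul_of_nonneg_left (h1.trans (mul_le_mul_of_nonneg_left h2 hC))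
            (pow_pos hτ.1 3).le
      _ = C * 4 ^ n * τ ^ (2 * n + 3) := by rw [mul_pow, pow_add, pow_mul]; ring
  have step : ∀ k < 2 * n + 3, (∀ t ∈ Set.Ioo 0 T,
      ((k : ℝ) - 1) * (1 / (2 * ((n : ℝ) + 1)) * (k + 1) - 1) / 4 * taylorCoeff (k + 2) (w t) = 0) →
      ∀ t ∈ Set.Ico 0 T, taylorCoeff k (w t) = 0 := by
    intro k hk h0
    set e : ℝ := 1 / (2 * ((n : ℝ) + 1))
    refine eq_zero_of_hasDerivAt_mul
      (c := (4 * (1 - 2 * e) + 2 * (1 - 4 * e) * (k - 3) - e * (k - 3) * (k - 5)) / 4)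
      (hcont k) (fun t ht => ?_) (hz0 k hk)
    have := hasDerivAt_taylorCoeff_at_pole hU hw hwU k ht
    rwa [h0 t ht, zero_add] at this
  -- Descending induction over the orders `2 n + 1, 2 n - 1, ..., 3`. It starts because `e (k + 1) =
  -- 1` at `k = 2 n + 1` cuts the coupling to the next order. Order 3 is the value of `U` at the
  -- pole.
  have hz : ∀ i < n, ∀ t ∈ Set.Ico 0 T, taylorCoeff (2 * (n - 1 - i) + 3) (w t) = 0 := by
    intro i
    induction i with
    | zero =>
      intro hi
      refine step _ (by omega) fun t _ => ?_
      have hcast : (((2 * (n - 1 - 0) + 3 : ℕ) : ℝ)) = 2 * n + 1 := by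
        have : 2 * (n - 1 - 0) + 3 = 2 * n + 1 := by omega
        rw [this]; push_cast; ring
      have h1 : 1 / (2 * ((n : ℝ) + 1)) * (2 * n + 1 + 1) - 1 = 0 := by field_simp; ring
      rw [hcast, h1]; ring
    | succ i ih =>
      intro hi
      have hidx : 2 * (n - 1 - (i + 1)) + 3 + 2 = 2 * (n - 1 - i) + 3 := by omega
      refine step _ (by omega) fun t ht => ?_
      rw [hidx, ih (by omega) t ⟨ht.1.le, ht.2⟩, mul_zero]
  obtain ⟨K, hK⟩ := exists_taylor_bound hw hT₁ hjet
  obtain ⟨L, hL⟩ := isCompact_Icc.exists_bound_of_continuousOn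
    ((hcont 3).mono (fun t ht => ⟨ht.1, ht.2.trans_lt hT₁⟩ : Set.Icc 0 T₁ ⊆ Set.Ico 0 T))
  have hK0 : 0 ≤ |K| := abs_nonneg K
  have key : ∀ t ∈ Set.Icc 0 T₁, ∀ τ ∈ Set.Ioc (0 : ℝ) (1 / 2),
      |U t (1 - 2 * τ ^ 2) - taylorCoeff 3 (w t)| ≤ |K| * τ := by
    intro t ht τ hτ
    have h1 := hK t ht τ hτ
    rw [hwU t ⟨ht.1, ht.2.trans_lt hT₁⟩ τ ⟨hτ.1, by linarith [hτ.2]⟩] at h1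
    have h3 : 0 < τ ^ 3 := pow_pos hτ.1 3
    rw [show τ ^ 3 * U t (1 - 2 * τ ^ 2) - taylorCoeff 3 (w t) * τ ^ 3
      = τ ^ 3 * (U t (1 - 2 * τ ^ 2) - taylorCoeff 3 (w t)) by ring, abs_mul, abs_of_pos h3] at h1
    refine le_of_mul_le_mul_left (h1.trans ?_) h3
    calc K * τ ^ 4 ≤ |K| * τ ^ 4 := mul_le_mul_of_nonneg_right (le_abs_self K) (by positivity)
      _ = τ ^ 3 * (|K| * τ) := by ring
  refine ⟨|K| + |L|, by positivity, fun t ht τ hτ => ⟨?_, fun hn => ?_⟩⟩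
  · have h1 := key t ht τ hτ
    have h2 := hL t ht
    rw [Real.norm_eq_abs] at h2
    have h3 : |U t (1 - 2 * τ ^ 2)| ≤ |U t (1 - 2 * τ ^ 2) - taylorCoeff 3 (w t)|
        + |taylorCoeff 3 (w t)| := by
      simpa using abs_add_le (U t (1 - 2 * τ ^ 2) - taylorCoeff 3 (w t)) (taylorCoeff 3 (w t))
    have h4 : |K| * τ ≤ |K| * 1 := mul_le_mul_of_nonneg_left (by linarith [hτ.2]) hK0
    linarith [le_abs_self L]
  · have h1 := key t ht τ hτ
    have h2 := hz (n - 1) (by omega) t ⟨ht.1, ht.2.trans_lt hT₁⟩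
    rw [Nat.sub_self, mul_zero, zero_add] at h2
    rw [h2, sub_zero] at h1
    exact h1.trans (mul_le_mul_of_nonneg_right (by linarith [abs_nonneg L]) hτ.1.le)

/-! ### Maps on the sphere -/

theorem fact_finrank_E3 : Fact (Module.finrank ℝ E3 = 2 + 1) := ⟨finrank_euclideanSpace_fin⟩

theorem contMDiff_sphere_of_coe {E' : Type*} [NormedAddCommGroup E'] [NormedSpace ℝ E']
    {γ : E' → S2} (h : ContDiff ℝ ∞ (fun x => (γ x : E3))) : ContMDiff 𝓘(ℝ, E') (𝓡 2) ∞ γ :=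
  haveI := fact_finrank_E3
  ContMDiff.codRestrict_sphere (n := 2) h.contMDiff fun x => (γ x).2

theorem contMDiff_coe_S2 : ContMDiff (𝓡 2) 𝓘(ℝ, E3) ∞ (fun p : S2 => (p : E3)) :=
  haveI := fact_finrank_E3
  contMDiff_coe_sphere (n := 2)

theorem mfderiv_coe_S2_injective (p : S2) :
    Function.Injective (mfderiv (𝓡 2) 𝓘(ℝ, E3) (fun p : S2 => (p : E3)) p) :=
  haveI := fact_finrank_E3
  injective_mvfderiv_subtypeVal_sphere (n := 2) p

/-- The derivative of a map on the sphere along a curve depends only on the velocity. -/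
theorem deriv_comp_eq_of_velocity_eq {X : S2 → E3} (hX : ContMDiff (𝓡 2) 𝓘(ℝ, E3) ∞ X)
    {γ₁ γ₂ : ℝ → S2} (h₁ : ContDiff ℝ ∞ (fun τ => (γ₁ τ : E3)))
    (h₂ : ContDiff ℝ ∞ (fun τ => (γ₂ τ : E3))) {a b : ℝ} (hab : γ₁ a = γ₂ b)
    (hv : deriv (fun τ => (γ₁ τ : E3)) a = deriv (fun τ => (γ₂ τ : E3)) b) :
    deriv (fun τ => X (γ₁ τ)) a = deriv (fun τ => X (γ₂ τ)) b := by
  have key : ∀ (γ : ℝ → S2), ContDiff ℝ ∞ (fun τ => (γ τ : E3)) → ∀ (Y : S2 → E3),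
      ContMDiff (𝓡 2) 𝓘(ℝ, E3) ∞ Y → ∀ c : ℝ, deriv (fun τ => Y (γ τ)) c
        = mfderiv (𝓡 2) 𝓘(ℝ, E3) Y (γ c) (mfderiv 𝓘(ℝ, ℝ) (𝓡 2) γ c (1 : ℝ)) := by
    intro γ hγ Y hY c
    have h := mfderiv_comp c ((hY.mdifferentiable (by simp)) (γ c))
      (((contMDiff_sphere_of_coe hγ).mdifferentiable (by simp)) c)
    rw [← fderiv_apply_one_eq_deriv, ← mfderiv_eq_fderiv]
    exact congrArg (fun L => L (1 : ℝ)) h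
  rw [key γ₁ h₁ X hX, key γ₂ h₂ X hX]
  rw [key γ₁ h₁ _ contMDiff_coe_S2, key γ₂ h₂ _ contMDiff_coe_S2] at hv
  have transfer : ∀ (p q : S2) (v w : EuclideanSpace ℝ (Fin 2)), p = q →
      mfderiv (𝓡 2) 𝓘(ℝ, E3) (fun p : S2 => (p : E3)) p v
        = mfderiv (𝓡 2) 𝓘(ℝ, E3) (fun p : S2 => (p : E3)) q w →
      mfderiv (𝓡 2) 𝓘(ℝ, E3) X p v = mfderiv (𝓡 2) 𝓘(ℝ, E3) X q w := by
    rintro p _ v w rfl h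
    have := mfderiv_coe_S2_injective p h
    rw [this]
  exact transfer _ _ _ _ hab hv

theorem inner_E3 (u v : E3) : inner ℝ u v = u 0 * v 0 + u 1 * v 1 + u 2 * v 2 := by
  simp [PiLp.inner_apply, Fin.sum_univ_three]; ring

theorem contDiff_polarPoint {E' : Type*} [NormedAddCommGroup E'] [NormedSpace ℝ E']
    {f g : E' → ℝ} (hf : ContDiff ℝ ∞ f) (hg : ContDiff ℝ ∞ g) :
    ContDiff ℝ ∞ (fun x => (polarPoint (f x) (g x) : E3)) := by
  rw [contDiff_euclidean]
  intro i
  fin_cases i <;> simp [polarPoint] <;> fun_prop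

theorem contDiff_greatCircle (p e : S2) (h : inner ℝ (p : E3) (e : E3) = 0) :
    ContDiff ℝ ∞ (fun τ => (greatCircle p e h τ : E3)) := by
  simp only [greatCircle]
  fun_prop

theorem deriv_greatCircle (p e : S2) (h : inner ℝ (p : E3) (e : E3) = 0) :
    deriv (fun τ => (greatCircle p e h τ : E3)) 0 = e := by
  have h1 : HasDerivAt (fun τ : ℝ => Real.cos τ • (p : E3) + Real.sin τ • (e : E3))
      ((-Real.sin 0) • (p : E3) + Real.cos 0 • (e : E3)) 0 :=
    ((Real.hasDerivAt_cos 0).smul_const _).add ((Real.hasDerivAt_sin 0).smul_const _)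
  simpa [greatCircle] using h1.deriv

theorem greatCircle_polarPoint_meridianDir (θ φ τ : ℝ) :
    greatCircle (polarPoint θ φ) (meridianDir θ φ) (inner_polarPoint_meridianDir θ φ) τ
      = polarPoint (θ + τ) φ := by
  apply Subtype.ext
  ext i
  fin_cases i <;> simp [greatCircle, polarPoint, meridianDir, Real.sin_add, Real.cos_add] <;> ring

theorem polarPoint_eq_rotZ (θ φ α : ℝ) :
    (polarPoint θ (φ + α) : E3) = rotZ α (polarPoint θ φ : E3) := by
  ext i
  fin_cases i <;> simp [polarPoint, rotZ, Real.sin_add, Real.cos_add] <;> ring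

theorem hasDerivAt_polarPoint_parallel (θ c : ℝ) :
    HasDerivAt (fun τ => (polarPoint θ (c * τ) : E3)) ((Real.sin θ * c) • (parallelDir 0 : E3)) 0 := by
  have h : (fun τ => (polarPoint θ (c * τ) : E3)) = fun τ =>
      Real.cos (c * τ) • (!₂[Real.sin θ, 0, 0] : E3) + Real.sin (c * τ) • (!₂[0, Real.sin θ, 0] : E3)
        + !₂[0, 0, Real.cos θ] := by
    funext τ
    ext i
    fin_cases i <;> simp [polarPoint] <;> ring
  rw [h]
  have hin : HasDerivAt (fun τ : ℝ => c * τ) c 0 := by simpa using (hasDerivAt_id (0 : ℝ)).const_mul c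
  have h1 := (((hin.cos.smul_const (!₂[Real.sin θ, 0, 0] : E3)).add
    (hin.sin.smul_const (!₂[0, Real.sin θ, 0] : E3))).add_const (!₂[0, 0, Real.cos θ] : E3))
  refine h1.congr_deriv ?_
  ext i
  fin_cases i <;> simp [parallelDir]; ring

/-! ### The support function of a rotationally symmetric sphere -/

/-- The support function along the meridian of azimuth `0`. -/
noncomputable def supportFunction (X : S2 → E3) (θ : ℝ) : ℝ :=
  inner ℝ (X (polarPoint θ 0)) (polarPoint θ 0 : E3)

theorem polarPoint_zero_eq (θ : ℝ) :
    (polarPoint θ 0 : E3) = Real.sin θ • (!₂[1, 0, 0] : E3) + Real.cos θ • (!₂[0, 0, 1] : E3) := by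
  ext i
  fin_cases i <;> simp [polarPoint]

theorem meridianDir_zero_eq (θ : ℝ) :
    (meridianDir θ 0 : E3) = Real.cos θ • (!₂[1, 0, 0] : E3) + (-Real.sin θ) • (!₂[0, 0, 1] : E3) := by
  ext i
  fin_cases i <;> simp [meridianDir]

theorem hasDerivAt_polarPoint (θ : ℝ) :
    HasDerivAt (fun θ => (polarPoint θ 0 : E3)) (meridianDir θ 0 : E3) θ := by
  simp only [polarPoint_zero_eq, meridianDir_zero_eq]
  exact ((Real.hasDerivAt_sin θ).smul_const _).add ((Real.hasDerivAt_cos θ).smul_const _)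

theorem hasDerivAt_meridianDir (θ : ℝ) :
    HasDerivAt (fun θ => (meridianDir θ 0 : E3)) (-(polarPoint θ 0 : E3)) θ := by
  simp only [polarPoint_zero_eq, meridianDir_zero_eq]
  refine (((Real.hasDerivAt_cos θ).smul_const _).add
    ((Real.hasDerivAt_sin θ).neg.smul_const _)).congr_deriv ?_
  rw [neg_add, neg_smul, neg_smul]

namespace IsRotSphere

variable {X : S2 → E3}

theorem contDiff_comp (hX : IsRotSphere X) {γ : ℝ → S2}
    (h : ContDiff ℝ ∞ (fun τ => (γ τ : E3))) : ContDiff ℝ ∞ (fun τ => X (γ τ)) :=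
  contMDiff_iff_contDiff.1 (hX.smooth.comp (contMDiff_sphere_of_coe h))

theorem hasDerivAt_profile (hX : IsRotSphere X) (θ : ℝ) :
    HasDerivAt (fun y => X (polarPoint y 0)) (dirDeriv X (polarPoint θ 0) (meridianDir θ 0)
      (inner_polarPoint_meridianDir θ 0)) θ := by
  have hc := hX.contDiff_comp (contDiff_polarPoint contDiff_id (contDiff_const (c := (0 : ℝ))))
  have hd : DifferentiableAt ℝ (fun y => X (polarPoint y 0)) θ :=
    (hc.differentiable (by simp)) θ
  refine hd.hasDerivAt.congr_deriv ?_
  simp only [dirDeriv, greatCircle_polarPoint_meridianDir]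
  rw [deriv_comp_const_add (fun y => X (polarPoint y 0)) θ 0, add_zero]

theorem hasDerivAt_supportFunction (hX : IsRotSphere X) (θ : ℝ) :
    HasDerivAt (supportFunction X) (inner ℝ (X (polarPoint θ 0)) (meridianDir θ 0 : E3)) θ := by
  have h := (hX.hasDerivAt_profile θ).inner ℝ (hasDerivAt_polarPoint θ)
  rw [hX.normal, add_zero] at h
  exact h

theorem hasDerivAt_deriv_supportFunction (hX : IsRotSphere X) (θ : ℝ) :
    HasDerivAt (deriv (supportFunction X)) (profileRadius X θ 0 - supportFunction X θ) θ := by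
  have h1 : deriv (supportFunction X) = fun θ => inner ℝ (X (polarPoint θ 0)) (meridianDir θ 0 : E3) :=
    funext fun θ => (hX.hasDerivAt_supportFunction θ).deriv
  rw [h1]
  refine ((hX.hasDerivAt_profile θ).inner ℝ (hasDerivAt_meridianDir θ)).congr_deriv ?_
  rw [inner_neg_right, profileRadius, supportFunction]
  ring

theorem map_rotZ (hX : IsRotSphere X) (θ φ α : ℝ) :
    X (polarPoint θ (φ + α)) = rotZ α (X (polarPoint θ φ)) :=
  hX.symmetric α _ _ (polarPoint_eq_rotZ θ φ α)

/-- The great circle tangent to the parallel is replaced by the parallel itself, run at unit speed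
(`c = 1 / sin θ`) and with the same velocity. Along it the surface moves by rotation. -/
theorem parallelRadius_eq (hX : IsRotSphere X) {θ : ℝ} (hθ : Real.sin θ ≠ 0) :
    parallelRadius X θ 0
      = supportFunction X θ + Real.cos θ / Real.sin θ * deriv (supportFunction X) θ := by
  set c : ℝ := (Real.sin θ)⁻¹ with hc
  have hγ : ContDiff ℝ ∞ (fun τ => (polarPoint θ (c * τ) : E3)) :=
    contDiff_polarPoint contDiff_const (contDiff_const.mul contDiff_id)
  have h1 : dirDeriv X (polarPoint θ 0) (parallelDir 0) (inner_polarPoint_parallelDir θ 0)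
      = deriv (fun τ => X (polarPoint θ (c * τ))) 0 := by
    refine deriv_comp_eq_of_velocity_eq hX.smooth (contDiff_greatCircle _ _ _) hγ ?_ ?_
    · apply Subtype.ext
      simp [greatCircle]
    · rw [deriv_greatCircle, (hasDerivAt_polarPoint_parallel θ c).deriv, hc, mul_inv_cancel₀ hθ,
        one_smul]
  have hd : HasDerivAt (fun τ => X (polarPoint θ (c * τ)))
      (deriv (fun τ => X (polarPoint θ (c * τ))) 0) 0 :=
    ((hX.contDiff_comp hγ).differentiable (by simp) 0).hasDerivAt
  have h2 := hd.inner ℝ (hasDerivAt_const (0 : ℝ) (parallelDir 0 : E3))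
  rw [inner_zero_right, zero_add] at h2
  have hrot : ∀ τ, X (polarPoint θ (c * τ)) = rotZ (c * τ) (X (polarPoint θ 0)) := by
    intro τ
    have := hX.map_rotZ θ 0 (c * τ)
    rwa [zero_add] at this
  have h3 : (fun τ => inner ℝ (X (polarPoint θ (c * τ))) (parallelDir 0 : E3))
      = fun τ => Real.sin (c * τ) * X (polarPoint θ 0) 0 + Real.cos (c * τ) * X (polarPoint θ 0) 1 := by
    funext τ
    rw [hrot, inner_E3]
    simp [rotZ, parallelDir]
  have hin : HasDerivAt (fun τ : ℝ => c * τ) c 0 := by simpa using (hasDerivAt_id (0 : ℝ)).const_mul c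
  have h4 : HasDerivAt (fun τ => Real.sin (c * τ) * X (polarPoint θ 0) 0
      + Real.cos (c * τ) * X (polarPoint θ 0) 1) (c * X (polarPoint θ 0) 0) 0 :=
    ((hin.sin.mul_const _).add (hin.cos.mul_const _)).congr_deriv (by simp)
  rw [h3] at h2
  rw [parallelRadius, h1, h2.unique h4, (hX.hasDerivAt_supportFunction θ).deriv, supportFunction,
    inner_E3, inner_E3, hc]
  generalize X (polarPoint θ 0) = Y
  simp only [polarPoint, meridianDir]
  simp
  have hsq := Real.sin_sq_add_cos_sq θ
  field_simp
  linear_combination (-(Y 0)) * hsq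

theorem astigmatism_eq (hX : IsRotSphere X) {θ : ℝ} (hθ : Real.sin θ ≠ 0) :
    astigmatism X θ = (Real.cos θ / Real.sin θ * deriv (supportFunction X) θ
      - deriv (deriv (supportFunction X)) θ) / 2 := by
  rw [astigmatism, hX.parallelRadius_eq hθ, (hX.hasDerivAt_deriv_supportFunction θ).deriv]
  ring

theorem hopfSpeed_eq (hX : IsRotSphere X) (lam psiInf : ℝ) {θ : ℝ} (hθ : Real.sin θ ≠ 0) :
    hopfSpeed lam psiInf X θ 0 = (1 + lam) / 2 * (supportFunction X θ
        + Real.cos θ / Real.sin θ * deriv (supportFunction X) θ)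
      + (1 - lam) / 2 * (deriv (deriv (supportFunction X)) θ + supportFunction X θ) - psiInf := by
  rw [hopfSpeed, hX.parallelRadius_eq hθ, (hX.hasDerivAt_deriv_supportFunction θ).deriv]
  ring

theorem supportFunction_neg (hX : IsRotSphere X) (θ : ℝ) :
    supportFunction X (-θ) = supportFunction X θ := by
  have h : (polarPoint (-θ) 0 : E3) = rotZ Real.pi (polarPoint θ 0 : E3) := by
    ext i
    fin_cases i <;> simp [polarPoint, rotZ]
  rw [supportFunction, supportFunction, hX.symmetric Real.pi _ _ h, h, inner_E3, inner_E3]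
  simp [rotZ]

/-- The poles are umbilic: a quarter turn about the axis, in the sense given by the sign of `cos θ`,
exchanges the two principal directions. -/
theorem parallelRadius_eq_profileRadius_of_sin_eq_zero (hX : IsRotSphere X) {θ : ℝ}
    (hθ : Real.sin θ = 0) : parallelRadius X θ 0 = profileRadius X θ 0 := by
  have hc2 : Real.cos θ ^ 2 = 1 := by
    have := Real.sin_sq_add_cos_sq θ
    rw [hθ] at this
    linarith
  have hsin : Real.sin (Real.cos θ * (Real.pi / 2)) = Real.cos θ := by
    rcases mul_self_eq_one_iff.1 ((sq (Real.cos θ)).symm.trans hc2) with h | h <;> simp [h]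
  have hcos : Real.cos (Real.cos θ * (Real.pi / 2)) = 0 := by
    rcases mul_self_eq_one_iff.1 ((sq (Real.cos θ)).symm.trans hc2) with h | h <;> simp [h]
  set f : ℝ → E3 := fun τ => X (greatCircle (polarPoint θ 0) (meridianDir θ 0)
    (inner_polarPoint_meridianDir θ 0) τ) with hf
  set g : ℝ → E3 := fun τ => X (greatCircle (polarPoint θ 0) (parallelDir 0)
    (inner_polarPoint_parallelDir θ 0) τ) with hg
  -- a quarter turn maps the meridian to the parallel
  have hrot : ∀ τ, g τ = rotZ (Real.cos θ * (Real.pi / 2)) (f τ) := by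
    intro τ
    refine hX.symmetric _ _ _ ?_
    ext i
    fin_cases i <;>
      simp [greatCircle, polarPoint, meridianDir, parallelDir, rotZ, hθ, hsin, hcos]
    linear_combination (-Real.sin τ) * hc2
  have hfd : HasDerivAt f (deriv f 0) 0 :=
    ((hX.contDiff_comp (contDiff_greatCircle _ _ _)).differentiable (by simp) 0).hasDerivAt
  have hgd : HasDerivAt g (deriv g 0) 0 :=
    ((hX.contDiff_comp (contDiff_greatCircle _ _ _)).differentiable (by simp) 0).hasDerivAt
  have h1 := hfd.inner ℝ (hasDerivAt_const (0 : ℝ) (meridianDir θ 0 : E3))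
  have h2 := hgd.inner ℝ (hasDerivAt_const (0 : ℝ) (parallelDir 0 : E3))
  rw [inner_zero_right, zero_add] at h1 h2
  have hfg : (fun τ => inner ℝ (g τ) (parallelDir 0 : E3))
      = fun τ => inner ℝ (f τ) (meridianDir θ 0 : E3) := by
    funext τ
    rw [hrot, inner_E3, inner_E3]
    generalize f τ = Y
    simp [parallelDir, meridianDir, rotZ, hθ, hsin, hcos]
    ring
  rw [hfg] at h2
  exact h2.unique h1

theorem astigmatism_eq_zero_of_sin_eq_zero (hX : IsRotSphere X) {θ : ℝ} (hθ : Real.sin θ = 0) :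
    astigmatism X θ = 0 := by
  rw [astigmatism, hX.parallelRadius_eq_profileRadius_of_sin_eq_zero hθ, sub_self, zero_div]

end IsRotSphere

/-! ### The support function under the flow -/

namespace IsLinearHopfFlow

variable {lam psiInf T : ℝ} {X : S2 → ℝ → E3}

theorem contDiffOn_position (hX : IsLinearHopfFlow lam psiInf T X) :
    ContDiffOn ℝ ∞ (fun q : ℝ × ℝ => X (polarPoint q.2 0) q.1) (Set.Ico 0 T ×ˢ Set.univ) := by
  have h1 : ContMDiff 𝓘(ℝ, ℝ × ℝ) (𝓡 2) ∞ (fun q : ℝ × ℝ => polarPoint q.2 0) :=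
    contMDiff_sphere_of_coe (contDiff_polarPoint contDiff_snd contDiff_const)
  have h2 : ContMDiff 𝓘(ℝ, ℝ × ℝ) 𝓘(ℝ, ℝ) ∞ (fun q : ℝ × ℝ => q.1) := contDiff_fst.contMDiff
  have h3 := hX.smooth.comp (h1.prodMk h2).contMDiffOn (s := Set.Ico 0 T ×ˢ Set.univ)
    fun q hq => ⟨Set.mem_univ _, hq.1⟩
  exact contMDiffOn_iff_contDiffOn.1 h3

theorem contDiffOn_supportFunction (hX : IsLinearHopfFlow lam psiInf T X) :
    ContDiffOn ℝ ∞ (fun q : ℝ × ℝ => supportFunction (fun p => X p q.1) q.2)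
      (Set.Ico 0 T ×ˢ Set.univ) :=
  hX.contDiffOn_position.inner ℝ
    (contDiff_polarPoint (contDiff_snd (E := ℝ) (F := ℝ)) contDiff_const).contDiffOn

theorem hasDerivAt_supportFunction_time (hX : IsLinearHopfFlow lam psiInf T X) {t : ℝ}
    (ht : t ∈ Set.Ioo 0 T) (θ : ℝ) :
    HasDerivAt (fun τ => supportFunction (fun p => X p τ) θ)
      (-hopfSpeed lam psiInf (fun p => X p t) θ 0) t := by
  have ht' : t ∈ Set.Ico 0 T := ⟨ht.1.le, ht.2⟩
  have hc : ContDiffOn ℝ ∞ (fun τ => X (polarPoint θ 0) τ) (Set.Ico 0 T) :=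
    hX.contDiffOn_position.comp (f := fun τ => (τ, θ)) (by fun_prop) fun τ hτ => ⟨hτ, Set.mem_univ _⟩
  have hnhds : Set.Ico 0 T ∈ nhds t := Ico_mem_nhds ht.1 ht.2
  have hd := (((hc.differentiableOn (by simp)) t ht').differentiableAt hnhds).hasDerivAt
  have hflow := congrArg (fun v => inner ℝ v (polarPoint θ 0 : E3)) (hX.flow t ht' θ 0)
  simp only [real_inner_smul_left] at hflow
  have hn : inner ℝ (polarPoint θ 0 : E3) (polarPoint θ 0 : E3) = (1 : ℝ) := by
    rw [real_inner_self_eq_norm_sq, mem_sphere_zero_iff_norm.1 (polarPoint θ 0).2, one_pow]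
  rw [hn, mul_one, mul_one, derivWithin_of_mem_nhds hnhds] at hflow
  have := hd.inner ℝ (hasDerivAt_const t (polarPoint θ 0 : E3))
  rw [inner_zero_right, zero_add, hflow] at this
  exact this

/-- The support function as a function of time and of `x = cos θ`. -/
noncomputable def support (X : S2 → ℝ → E3) (t x : ℝ) : ℝ :=
  supportFunction (fun p => X p t) (Real.arccos x)

theorem contDiffOn_support (hX : IsLinearHopfFlow lam psiInf T X) :
    ContDiffOn ℝ ∞ (fun q : ℝ × ℝ => support X q.1 q.2) (Set.Ico 0 T ×ˢ Set.Ioo (-1) 1) := by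
  refine hX.contDiffOn_supportFunction.comp
    (f := fun q : ℝ × ℝ => (q.1, Real.arccos q.2)) ?_ fun q hq => ⟨hq.1, Set.mem_univ _⟩
  refine contDiffOn_fst.prodMk fun q hq => ?_
  exact ((Real.contDiffAt_arccos hq.2.1.ne' hq.2.2.ne).comp q contDiffAt_snd).contDiffWithinAt

theorem support_cos {θ : ℝ} (t : ℝ) (hθ : θ ∈ Set.Icc 0 Real.pi) :
    support X t (Real.cos θ) = supportFunction (fun p => X p t) θ := by
  rw [support, Real.arccos_cos hθ.1 hθ.2]

theorem cos_mem_Ioo {θ : ℝ} (hθ : θ ∈ Set.Ioo 0 Real.pi) : Real.cos θ ∈ Set.Ioo (-1 : ℝ) 1 := by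
  have h1 := Real.sin_pos_of_mem_Ioo hθ
  have h2 := Real.sin_sq_add_cos_sq θ
  constructor <;> nlinarith

theorem deriv_supportFunction (hX : IsLinearHopfFlow lam psiInf T X) {t : ℝ}
    (ht : t ∈ Set.Ico 0 T) {θ : ℝ} (hθ : θ ∈ Set.Ioo 0 Real.pi) :
    deriv (supportFunction fun p => X p t) θ
        = -Real.sin θ * deriv (support X t) (Real.cos θ) ∧
      deriv (deriv (supportFunction fun p => X p t)) θ
        = Real.sin θ ^ 2 * deriv (deriv (support X t)) (Real.cos θ)
          - Real.cos θ * deriv (support X t) (Real.cos θ) := by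
  have s0 : ContDiffOn ℝ ∞ (support X t) (Set.Ioo (-1) 1) := hX.contDiffOn_support.slice ht
  have s1 : ContDiffOn ℝ ∞ (deriv (support X t)) (Set.Ioo (-1) 1) :=
    s0.deriv_of_isOpen isOpen_Ioo (by simp)
  have d0 : ∀ y ∈ Set.Ioo (-1 : ℝ) 1, HasDerivAt (support X t) (deriv (support X t) y) y :=
    fun y hy => ((s0.contDiffAt (isOpen_Ioo.mem_nhds hy)).differentiableAt (by simp)).hasDerivAt
  have d1 : ∀ y ∈ Set.Ioo (-1 : ℝ) 1,
      HasDerivAt (deriv (support X t)) (deriv (deriv (support X t)) y) y :=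
    fun y hy => ((s1.contDiffAt (isOpen_Ioo.mem_nhds hy)).differentiableAt (by simp)).hasDerivAt
  have e1 : ∀ y ∈ Set.Ioo 0 Real.pi, HasDerivAt (supportFunction fun p => X p t)
      (-Real.sin y * deriv (support X t) (Real.cos y)) y := by
    intro y hy
    have h := (d0 _ (cos_mem_Ioo hy)).comp y (Real.hasDerivAt_cos y)
    refine (h.congr_of_eventuallyEq ?_).congr_deriv (by ring)
    filter_upwards [isOpen_Ioo.mem_nhds hy] with z hz
    exact (support_cos t (Set.Ioo_subset_Icc_self hz)).symm
  have e2 : HasDerivAt (deriv (supportFunction fun p => X p t))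
      (Real.sin θ ^ 2 * deriv (deriv (support X t)) (Real.cos θ)
          - Real.cos θ * deriv (support X t) (Real.cos θ)) θ := by
    have h := (Real.hasDerivAt_sin θ).neg.mul
      ((d1 _ (cos_mem_Ioo hθ)).comp θ (Real.hasDerivAt_cos θ))
    refine (h.congr_of_eventuallyEq ?_).congr_deriv (by simp; ring)
    filter_upwards [isOpen_Ioo.mem_nhds hθ] with z hz using (e1 z hz).deriv
  exact ⟨(e1 θ hθ).deriv, e2.deriv⟩

/-- The astigmatism divided by `sin² θ`, as a function of time and of `x = cos θ`. -/
noncomputable def reduced (X : S2 → ℝ → E3) (t x : ℝ) : ℝ := -deriv (deriv (support X t)) x / 2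

theorem astigmatism_eq_reduced (hX : IsLinearHopfFlow lam psiInf T X) {t : ℝ}
    (ht : t ∈ Set.Ico 0 T) {θ : ℝ} (hθ : θ ∈ Set.Ioo 0 Real.pi) :
    astigmatism (fun p => X p t) θ = Real.sin θ ^ 2 * reduced X t (Real.cos θ) := by
  have hS : Real.sin θ ≠ 0 := (Real.sin_pos_of_mem_Ioo hθ).ne'
  obtain ⟨h1, h2⟩ := hX.deriv_supportFunction ht hθ
  rw [(hX.sphere t ht).astigmatism_eq hS, h1, h2, reduced]
  field_simp
  ring

/-- With `r₁ = r + cot θ r'` and `r₂ = r'' + r` the speed is linear in the support function `r`, and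
in `x = cos θ` all trigonometric coefficients become polynomials. -/
theorem hasDerivAt_support_time {e : ℝ} (hX : IsLinearHopfFlow (1 + 2 * e) psiInf T X) {t : ℝ}
    (ht : t ∈ Set.Ioo 0 T) {x : ℝ} (hx : x ∈ Set.Ioo (-1 : ℝ) 1) :
    HasDerivAt (fun τ => support X τ x) (e * (1 - x ^ 2) * deriv (deriv (support X t)) x
      + x * deriv (support X t) x - support X t x + psiInf) t := by
  have ht' : t ∈ Set.Ico 0 T := ⟨ht.1.le, ht.2⟩
  have hθ : Real.arccos x ∈ Set.Ioo 0 Real.pi :=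
    ⟨Real.arccos_pos.2 hx.2, lt_of_le_of_ne (Real.arccos_le_pi x) fun h => by
      have := Real.arccos_eq_pi.1 h
      linarith [hx.1]⟩
  have hcos : Real.cos (Real.arccos x) = x := Real.cos_arccos hx.1.le hx.2.le
  have hS : Real.sin (Real.arccos x) ≠ 0 := (Real.sin_pos_of_mem_Ioo hθ).ne'
  have hsq : Real.sin (Real.arccos x) ^ 2 = 1 - x ^ 2 := by
    have := Real.sin_sq_add_cos_sq (Real.arccos x)
    rw [hcos] at this
    linarith
  obtain ⟨h1, h2⟩ := hX.deriv_supportFunction ht' hθ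
  rw [hcos] at h1 h2
  refine (hX.hasDerivAt_supportFunction_time ht (Real.arccos x)).congr_deriv ?_
  rw [(hX.sphere t ht').hopfSpeed_eq _ _ hS, h1, h2, hsq, hcos,
    show support X t x = supportFunction (fun p => X p t) (Real.arccos x) from rfl]
  field_simp
  ring

/-- Two `x`-derivatives of the support equation: the constant `psiInf` drops out, and the
first-order coefficient changes from `1` to `1 - 2 e` and then to `1 - 4 e`. -/
theorem isReducedSolution_reduced {e : ℝ} (hX : IsLinearHopfFlow (1 + 2 * e) psiInf T X) :
    IsReducedSolution e (Set.Ioo 0 T) (reduced X) := by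
  refine ⟨fun t x => -deriv (deriv (deriv (support X t))) x / 2,
    fun t x => -deriv (deriv (deriv (deriv (support X t)))) x / 2, fun t ht x hx => ?_⟩
  have ht' : t ∈ Set.Ico 0 T := ⟨ht.1.le, ht.2⟩
  have sO : ∀ {f : ℝ → ℝ}, ContDiffOn ℝ ∞ f (Set.Ioo (-1) 1) →
      ContDiffOn ℝ ∞ (deriv f) (Set.Ioo (-1) 1) := fun hf =>
    hf.deriv_of_isOpen isOpen_Ioo (by simp)
  have hd : ∀ {f : ℝ → ℝ}, ContDiffOn ℝ ∞ f (Set.Ioo (-1) 1) → ∀ y ∈ Set.Ioo (-1 : ℝ) 1,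
      HasDerivAt f (deriv f y) y := fun hf y hy =>
    ((hf.contDiffAt (isOpen_Ioo.mem_nhds hy)).differentiableAt (by simp)).hasDerivAt
  have s0 : ContDiffOn ℝ ∞ (support X t) (Set.Ioo (-1) 1) := hX.contDiffOn_support.slice ht'
  have s1 := sO s0
  have s2 := sO s1
  have s3 := sO s2
  refine ⟨(hd s2 x hx).neg.div_const 2, (hd s3 x hx).neg.div_const 2, ?_⟩
  have hc : ∀ y : ℝ, HasDerivAt (fun y : ℝ => e * (1 - y ^ 2)) (-(2 * e * y)) y := fun y =>
    ((((hasDerivAt_id y).pow 2).const_sub 1).const_mul e).congr_deriv (by simp; ring)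
  have ht1 : ∀ y ∈ Set.Ioo (-1 : ℝ) 1, deriv (fun τ => support X τ y) t
      = e * (1 - y ^ 2) * deriv (deriv (support X t)) y + y * deriv (support X t) y
        - support X t y + psiInf := fun y hy => (hX.hasDerivAt_support_time ht hy).deriv
  have ht2 : ∀ y ∈ Set.Ioo (-1 : ℝ) 1, HasDerivAt (fun y => deriv (fun τ => support X τ y) t)
      (e * (1 - y ^ 2) * deriv (deriv (deriv (support X t))) y
        + (1 - 2 * e) * (y * deriv (deriv (support X t)) y)) y := by
    intro y hy
    have h := ((((hc y).mul (hd s2 y hy)).add ((hasDerivAt_id y).mul (hd s1 y hy))).sub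
      (hd s0 y hy)).add_const psiInf
    refine (h.congr_of_eventuallyEq ?_).congr_deriv (by simp; ring)
    filter_upwards [isOpen_Ioo.mem_nhds hy] with z hz using ht1 z hz
  have ht3 : HasDerivAt (deriv fun y => deriv (fun τ => support X τ y) t)
      (e * (1 - x ^ 2) * deriv (deriv (deriv (deriv (support X t)))) x
        + (1 - 4 * e) * x * deriv (deriv (deriv (support X t))) x
        + (1 - 2 * e) * deriv (deriv (support X t)) x) x := by
    have h := ((hc x).mul (hd s3 x hx)).add
      (((hasDerivAt_id x).mul (hd s2 x hx)).const_mul (1 - 2 * e))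
    refine (h.congr_of_eventuallyEq ?_).congr_deriv (by simp; ring)
    filter_upwards [isOpen_Ioo.mem_nhds hx] with z hz using (ht2 z hz).deriv
  have hmix := hasDerivAt_time_iteratedDeriv isOpen_Ioo 2 hX.contDiffOn_support ht hx
  simp only [iteratedDeriv_succ, iteratedDeriv_zero] at hmix
  rw [ht3.deriv] at hmix
  refine (hmix.neg.div_const 2).congr_deriv ?_
  simp only [reduced]
  ring

theorem continuousOn_reduced (hX : IsLinearHopfFlow lam psiInf T X) :
    ContinuousOn (fun q : ℝ × ℝ => reduced X q.1 q.2) (Set.Ico 0 T ×ˢ Set.Ioo (-1) 1) := by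
  have h := (hX.contDiffOn_support.space_iteratedDeriv isOpen_Ioo 2).continuousOn
  simp only [iteratedDeriv_succ, iteratedDeriv_zero] at h
  exact h.neg.div_const 2

end IsLinearHopfFlow

/-! ### Smoothness of even functions at a pole -/

/-- If `g (1 - 2 τ²)` is a smooth function `k` of `τ`, then `τ³ g''(1 - 2 τ²)` is smooth as well,
with vanishing jet of order two. -/
theorem exists_pole_function {T : ℝ} {k g : ℝ → ℝ → ℝ}
    (hk : ContDiffOn ℝ ∞ (fun q : ℝ × ℝ => k q.1 q.2) (Set.Ico 0 T ×ˢ Set.Ioo (-1) 1))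
    (hg : ContDiffOn ℝ ∞ (fun q : ℝ × ℝ => g q.1 q.2) (Set.Ico 0 T ×ˢ Set.Ioo (-1) 1))
    (heven : ∀ t ∈ Set.Ico 0 T, ∀ τ, k t (-τ) = k t τ)
    (hkg : ∀ t, ∀ τ ∈ Set.Ioo (0 : ℝ) 1, k t τ = g t (1 - 2 * τ ^ 2)) :
    ∃ w : ℝ → ℝ → ℝ,
      ContDiffOn ℝ ∞ (fun q : ℝ × ℝ => w q.1 q.2) (Set.Ico 0 T ×ˢ Set.Ioo (-1) 1) ∧
      (∀ t ∈ Set.Ico 0 T, ∀ τ ∈ Set.Ioo (0 : ℝ) 1,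
        w t τ = τ ^ 3 * (-deriv (deriv (g t)) (1 - 2 * τ ^ 2) / 2)) ∧
      ∀ t ∈ Set.Ico 0 T, ∀ j < 3, taylorCoeff j (w t) = 0 := by
  have hk1 := hk.space_deriv isOpen_Ioo
  have hk2 := ContDiffOn.space_deriv (F := fun t => deriv (k t)) isOpen_Ioo hk1
  -- From `k' = -4 τ g'` follows `τ k'' - k' = 16 τ³ g''`. The cube clears all denominators, so no
  -- quotient of smooth functions has to be shown smooth.
  refine ⟨fun t τ => -(1 / 32) * (τ * deriv (deriv (k t)) τ + (-1) * deriv (k t) τ), ?_, ?_, ?_⟩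
  · exact contDiffOn_const.mul ((contDiffOn_snd.mul hk2).add (contDiffOn_const.mul hk1))
  · intro t ht τ hτ
    have sO : ∀ {f : ℝ → ℝ}, ContDiffOn ℝ ∞ f (Set.Ioo (-1) 1) →
        ContDiffOn ℝ ∞ (deriv f) (Set.Ioo (-1) 1) := fun hf =>
      hf.deriv_of_isOpen isOpen_Ioo (by simp)
    have hd : ∀ {f : ℝ → ℝ}, ContDiffOn ℝ ∞ f (Set.Ioo (-1) 1) → ∀ y ∈ Set.Ioo (-1 : ℝ) 1,
        HasDerivAt f (deriv f y) y := fun hf y hy =>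
      ((hf.contDiffAt (isOpen_Ioo.mem_nhds hy)).differentiableAt (by simp)).hasDerivAt
    have s0 : ContDiffOn ℝ ∞ (g t) (Set.Ioo (-1) 1) := hg.slice ht
    have hmem : ∀ y ∈ Set.Ioo (0 : ℝ) 1, 1 - 2 * y ^ 2 ∈ Set.Ioo (-1 : ℝ) 1 := by
      intro y hy
      constructor <;> nlinarith [hy.1, hy.2]
    have hin : ∀ y : ℝ, HasDerivAt (fun y : ℝ => 1 - 2 * y ^ 2) (-(4 * y)) y := fun y =>
      ((((hasDerivAt_id y).pow 2).const_mul 2).const_sub 1).congr_deriv (by simp; ring)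
    have e1 : ∀ y ∈ Set.Ioo (0 : ℝ) 1,
        HasDerivAt (k t) (-(4 * y) * deriv (g t) (1 - 2 * y ^ 2)) y := by
      intro y hy
      have h := (hd s0 _ (hmem y hy)).comp y (hin y)
      refine (h.congr_of_eventuallyEq ?_).congr_deriv (by ring)
      filter_upwards [isOpen_Ioo.mem_nhds hy] with z hz using hkg t z hz
    have e2 : HasDerivAt (deriv (k t)) (-4 * deriv (g t) (1 - 2 * τ ^ 2)
        + 16 * τ ^ 2 * deriv (deriv (g t)) (1 - 2 * τ ^ 2)) τ := by
      have h := ((hasDerivAt_id τ).const_mul 4).neg.mul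
        ((hd (sO s0) _ (hmem τ hτ)).comp τ (hin τ))
      refine (h.congr_of_eventuallyEq ?_).congr_deriv (by simp; ring)
      filter_upwards [isOpen_Ioo.mem_nhds hτ] with z hz using (e1 z hz).deriv
    simp only [e2.deriv, (e1 τ hτ).deriv]
    ring
  · intro t ht j hj
    have at0 : ContDiffAt ℝ ∞ (k t) 0 :=
      (hk.slice ht).contDiffAt (isOpen_Ioo.mem_nhds (by norm_num))
    have at1 := at0.deriv_smooth
    have at2 := at1.deriv_smooth
    have hodd : ∀ i, taylorCoeff (2 * i + 1) (k t) = 0 := by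
      intro i
      have h := iteratedDeriv_comp_neg (2 * i + 1) (k t) 0
      simp only [heven t ht, neg_zero] at h
      rw [pow_succ, pow_mul, neg_one_sq, one_pow, one_mul, smul_eq_mul] at h
      have : iteratedDeriv (2 * i + 1) (k t) 0 = 0 := by
        have h' : iteratedDeriv (2 * i + 1) (k t) 0
          = -1 * iteratedDeriv (2 * i + 1) (k t) 0 := h
        linarith
      rw [taylorCoeff, this, zero_div]
    have h1 := hodd 0
    have h3 := hodd 1
    have hm : ContDiffAt ℝ ∞ (fun τ => τ * deriv (deriv (k t)) τ) 0 := contDiffAt_id.mul at2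
    have hc : ContDiffAt ℝ ∞ (fun τ => (-1 : ℝ) * deriv (k t) τ) 0 := contDiffAt_const.mul at1
    -- Up to a constant the coefficient of order `j` is `(j - 1)(j + 1)` times that of order `j + 1`
    -- of `k`. It vanishes for `j = 1` by the factor and for `j = 0, 2` by evenness.
    rw [taylorCoeff_const_mul, taylorCoeff_add j hm hc,
      taylorCoeff_const_mul, taylorCoeff_id_mul_deriv j at1, taylorCoeff_deriv]
    interval_cases j
    · simp only [Nat.mul_zero, Nat.zero_add] at h1 ⊢
      rw [h1]; simp
    · simp
    · simp only [Nat.reduceMul, Nat.reduceAdd] at h3 ⊢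
      rw [h3]; simp

/-! ### Vanishing of solutions that are controlled at the poles -/

/-- For `n = 0` the function `1 - log (1 - x²)` is a barrier that blows up at the poles, so
boundedness of `z` is enough. For `n ≥ 1` a constant barrier is used, and `z` itself has to tend to
zero. -/
theorem IsReducedSolution.nonpos_of_pole_bound {n : ℕ} {T D : ℝ} {z : ℝ → ℝ → ℝ}
    (hz : IsReducedSolution (1 / (2 * ((n : ℝ) + 1))) (Set.Ioc 0 T) z)
    (hcont : ContinuousOn (fun q : ℝ × ℝ => z q.1 q.2) (Set.Icc 0 T ×ˢ Set.Ioo (-1) 1))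
    (h0 : ∀ x ∈ Set.Ioo (-1 : ℝ) 1, z 0 x = 0) (hD : 0 ≤ D)
    (hbd : ∀ t ∈ Set.Icc 0 T, ∀ x : ℝ, 1 / 2 ≤ |x| → |x| < 1 →
      |z t x| ≤ D ∧ (0 < n → |z t x| ≤ D * Real.sqrt (1 - |x|))) :
    ∀ t ∈ Set.Icc 0 T, ∀ x ∈ Set.Ioo (-1 : ℝ) 1, z t x ≤ 0 := by
  have he : 0 ≤ 1 / (2 * ((n : ℝ) + 1)) := by positivity
  rcases Nat.eq_zero_or_pos n with rfl | hn
  · have hpos : ∀ x ∈ Set.Ioo (-1 : ℝ) 1, 0 < 1 - x ^ 2 := fun x hx => by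
      nlinarith [hx.1, hx.2]
    have hin : ∀ x : ℝ, HasDerivAt (fun x : ℝ => 1 - x ^ 2) (-(2 * x)) x := fun x =>
      (((hasDerivAt_id x).pow 2).const_sub 1).congr_deriv (by simp)
    have hlog : ∀ x ∈ Set.Ioo (-1 : ℝ) 1, 1 ≤ 1 - Real.log (1 - x ^ 2) := fun x hx => by
      have := Real.log_nonpos (hpos x hx).le (by nlinarith [sq_nonneg x])
      linarith
    refine hz.nonpos he hcont h0 (B := fun x => 1 - Real.log (1 - x ^ 2))
      (B1 := fun x => 2 * x / (1 - x ^ 2))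
      (B2 := fun x => 2 * (1 + x ^ 2) / (1 - x ^ 2) ^ 2) hlog ?_ ?_ ?_ ?_
    · intro x hx
      have := (hpos x hx).ne'
      exact (((hin x).log this).const_sub 1).congr_deriv (by field_simp)
    · intro x hx
      have := (hpos x hx).ne'
      exact ((((hasDerivAt_id x).const_mul 2).div (hin x) this)).congr_deriv (by
        simp only [id_eq]; field_simp; ring)
    · intro x hx
      have h1 := (hpos x hx).ne'
      have h2 := hlog x hx
      have : (1 / (2 * (((0 : ℕ) : ℝ) + 1))) * (1 - x ^ 2) * (2 * (1 + x ^ 2) / (1 - x ^ 2) ^ 2)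
          + (1 - 4 * (1 / (2 * (((0 : ℕ) : ℝ) + 1)))) * x * (2 * x / (1 - x ^ 2))
          + (1 - 2 * (1 / (2 * (((0 : ℕ) : ℝ) + 1)))) * (1 - Real.log (1 - x ^ 2)) = 1 := by
        push_cast; field_simp; ring
      rw [this]; linarith
    · intro δ hδ
      refine ⟨min (1 / 2) (Real.exp (-(D / δ)) / 2), by positivity, fun t ht x hx hx1 => ?_⟩
      have hx2 : 1 / 2 ≤ |x| := by linarith [min_le_left (1 / 2 : ℝ) (Real.exp (-(D / δ)) / 2)]
      have hx3 := min_le_right (1 / 2 : ℝ) (Real.exp (-(D / δ)) / 2)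
      have hp := hpos x (abs_lt.1 hx1)
      have hle : 1 - x ^ 2 ≤ Real.exp (-(D / δ)) := by
        rw [← sq_abs] at hp ⊢; nlinarith [abs_nonneg x]
      have hl := Real.log_le_log hp hle
      rw [Real.log_exp] at hl
      have h4 : δ * (D / δ) = D := by field_simp
      have h5 := (le_abs_self _).trans (hbd t ht x hx2 hx1).1
      nlinarith [mul_le_mul_of_nonneg_left hl hδ.le]
  · refine hz.nonpos he hcont h0 (B := fun _ => 1) (B1 := fun _ => 0) (B2 := fun _ => 0)
      (fun _ _ => le_rfl) (fun x _ => hasDerivAt_const x _) (fun x _ => hasDerivAt_const x _)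
      (fun x _ => by linarith) ?_
    intro δ hδ
    refine ⟨min (1 / 2) ((δ / (D + 1)) ^ 2), by positivity, fun t ht x hx hx1 => ?_⟩
    have hx2 : 1 / 2 ≤ |x| := by linarith [min_le_left (1 / 2 : ℝ) ((δ / (D + 1)) ^ 2)]
    have hx3 := min_le_right (1 / 2 : ℝ) ((δ / (D + 1)) ^ 2)
    have hs : Real.sqrt (1 - |x|) ≤ δ / (D + 1) :=
      (Real.sqrt_le_sqrt (by linarith)).trans (Real.sqrt_sq (by positivity)).le
    have h5 := (le_abs_self _).trans ((hbd t ht x hx2 hx1).2 hn)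
    have h6 : (D + 1) * (δ / (D + 1)) = δ := by field_simp
    have h7 : 0 ≤ δ / (D + 1) := by positivity
    nlinarith [mul_le_mul_of_nonneg_left hs hD]

theorem IsReducedSolution.eq_zero_of_pole_bound {n : ℕ} {T D : ℝ} {z : ℝ → ℝ → ℝ}
    (hz : IsReducedSolution (1 / (2 * ((n : ℝ) + 1))) (Set.Ioc 0 T) z)
    (hcont : ContinuousOn (fun q : ℝ × ℝ => z q.1 q.2) (Set.Icc 0 T ×ˢ Set.Ioo (-1) 1))
    (h0 : ∀ x ∈ Set.Ioo (-1 : ℝ) 1, z 0 x = 0) (hD : 0 ≤ D)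
    (hbd : ∀ t ∈ Set.Icc 0 T, ∀ x : ℝ, 1 / 2 ≤ |x| → |x| < 1 →
      |z t x| ≤ D ∧ (0 < n → |z t x| ≤ D * Real.sqrt (1 - |x|))) :
    ∀ t ∈ Set.Icc 0 T, ∀ x ∈ Set.Ioo (-1 : ℝ) 1, z t x = 0 := by
  intro t ht x hx
  have hneg : IsReducedSolution (1 / (2 * ((n : ℝ) + 1))) (Set.Ioc 0 T) (fun t x => -z t x) := by
    simpa using (hz.sub hz).sub hz
  have h1 := hneg.nonpos_of_pole_bound hcont.neg (fun x hx => by rw [h0 x hx, neg_zero]) hD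
    (by simpa only [abs_neg] using hbd) t ht x hx
  exact le_antisymm (hz.nonpos_of_pole_bound hcont h0 hD hbd t ht x hx) (by linarith)

/-! ### The flow at the poles -/

/-- Subtracting the smooth `τ³ P` from the pole function keeps its jet of order two zero, so the
analysis at the pole applies to the difference from the polynomial part. -/
theorem exists_bound_at_pole_of_even {n : ℕ} {T T₁ C : ℝ} {k g P : ℝ → ℝ → ℝ} (hT₁ : T₁ < T)
    (hk : ContDiffOn ℝ ∞ (fun q : ℝ × ℝ => k q.1 q.2) (Set.Ico 0 T ×ˢ Set.Ioo (-1) 1))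
    (hg : ContDiffOn ℝ ∞ (fun q : ℝ × ℝ => g q.1 q.2) (Set.Ico 0 T ×ˢ Set.Ioo (-1) 1))
    (heven : ∀ t ∈ Set.Ico 0 T, ∀ τ, k t (-τ) = k t τ)
    (hkg : ∀ t, ∀ τ ∈ Set.Ioo (0 : ℝ) 1, k t τ = g t (1 - 2 * τ ^ 2))
    (hP : ContDiff ℝ ∞ (fun q : ℝ × ℝ => P q.1 q.2))
    (hU : IsReducedSolution (1 / (2 * ((n : ℝ) + 1))) (Set.Ioo 0 T)
      (fun t x => -deriv (deriv (g t)) x / 2 - P t x))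
    (hinit : ∀ x ∈ Set.Ioo (-1 : ℝ) 1,
      |-deriv (deriv (g 0)) x / 2 - P 0 x| ≤ C * (1 - x ^ 2) ^ n) :
    ∃ D, 0 ≤ D ∧ ∀ t ∈ Set.Icc 0 T₁, ∀ τ ∈ Set.Ioc (0 : ℝ) (1 / 2),
      |-deriv (deriv (g t)) (1 - 2 * τ ^ 2) / 2 - P t (1 - 2 * τ ^ 2)| ≤ D ∧
      (0 < n → |-deriv (deriv (g t)) (1 - 2 * τ ^ 2) / 2 - P t (1 - 2 * τ ^ 2)| ≤ D * τ) := by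
  obtain ⟨w, hw, hwg, hwj⟩ := exists_pole_function hk hg heven hkg
  have hQ : ContDiff ℝ ∞ (fun q : ℝ × ℝ => q.2 ^ 3 * P q.1 (1 - 2 * q.2 ^ 2)) :=
    (contDiff_snd.pow 3).mul (hP.comp (f := fun q : ℝ × ℝ => (q.1, 1 - 2 * q.2 ^ 2)) (by fun_prop))
  refine exists_bound_at_pole hT₁ hU (w := fun t τ => w t τ + (-1) * (τ ^ 3 * P t (1 - 2 * τ ^ 2)))
    (hw.add (contDiffOn_const.mul hQ.contDiffOn)) ?_ ?_ hinit
  · intro t ht τ hτ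
    simp only [hwg t ht τ hτ]
    ring
  · intro t ht j hj
    have hQt : ContDiff ℝ ∞ (fun τ : ℝ => τ ^ 3 * P t (1 - 2 * τ ^ 2)) :=
      hQ.comp (f := fun τ : ℝ => (t, τ)) (by fun_prop)
    have hPt : Continuous (fun τ : ℝ => P t (1 - 2 * τ ^ 2)) :=
      hP.continuous.comp (f := fun τ : ℝ => (t, 1 - 2 * τ ^ 2)) (by fun_prop)
    obtain ⟨M, hM⟩ := isCompact_Icc.exists_bound_of_continuousOn (s := Set.Icc (0 : ℝ) 1)
      hPt.continuousOn
    rw [taylorCoeff_add j ((hw.slice ht).contDiffAt (isOpen_Ioo.mem_nhds (by norm_num)))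
      (contDiff_const.mul hQt).contDiffAt, taylorCoeff_const_mul, hwj t ht j hj,
      taylorCoeff_eq_zero_of_bound (C := M) (m := 3) hQt.contDiffOn ?_ hj, mul_zero, add_zero]
    intro τ hτ
    have h3 : 0 ≤ τ ^ 3 := pow_nonneg hτ.1.le 3
    rw [abs_mul, abs_of_nonneg h3, mul_comm]
    exact mul_le_mul_of_nonneg_right (hM τ ⟨hτ.1.le, hτ.2.le⟩) h3

theorem arccos_one_sub_two_mul_sq {τ : ℝ} (hτ : τ ∈ Set.Ioo (0 : ℝ) 1) :
    Real.arccos (1 - 2 * τ ^ 2) = 2 * Real.arcsin τ := by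
  have h1 : Real.cos (2 * Real.arcsin τ) = 1 - 2 * τ ^ 2 := by
    rw [Real.cos_two_mul, Real.cos_sq', Real.sin_arcsin (by linarith [hτ.1]) hτ.2.le]; ring
  rw [← h1, Real.arccos_cos (by linarith [Real.arcsin_nonneg.2 hτ.1.le])
    (by linarith [Real.arcsin_le_pi_div_two τ])]

theorem supportFunction_add_two_pi (X : S2 → E3) (θ : ℝ) :
    supportFunction X (θ + 2 * Real.pi) = supportFunction X θ := by
  have : polarPoint (θ + 2 * Real.pi) 0 = polarPoint θ 0 := by
    apply Subtype.ext
    simp [polarPoint]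
  rw [supportFunction, supportFunction, this]

namespace IsLinearHopfFlow

variable {lam psiInf T : ℝ} {X : S2 → ℝ → E3}

theorem contDiffOn_supportFunction_arcsin (hX : IsLinearHopfFlow lam psiInf T X) (u v : ℝ) :
    ContDiffOn ℝ ∞
      (fun q : ℝ × ℝ => supportFunction (fun p => X p q.1) (u + v * Real.arcsin q.2))
      (Set.Ico 0 T ×ˢ Set.Ioo (-1) 1) := by
  refine hX.contDiffOn_supportFunction.comp
    (f := fun q : ℝ × ℝ => (q.1, u + v * Real.arcsin q.2)) ?_ fun q hq => ⟨hq.1, Set.mem_univ _⟩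
  refine contDiffOn_fst.prodMk (contDiffOn_const.add (contDiffOn_const.mul fun q hq => ?_))
  exact ((Real.contDiffAt_arcsin hq.2.1.ne' hq.2.2.ne).comp q contDiffAt_snd).contDiffWithinAt

theorem exists_bound_at_poles {n : ℕ} {C T₁ : ℝ}
    (hX : IsLinearHopfFlow (1 + 2 * (1 / (2 * ((n : ℝ) + 1)))) psiInf T X) (hT₁ : T₁ < T)
    {P : ℝ → ℝ → ℝ} (hP : ContDiff ℝ ∞ (fun q : ℝ × ℝ => P q.1 q.2))
    (hPs : IsReducedSolution (1 / (2 * ((n : ℝ) + 1))) Set.univ P)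
    (hinit : ∀ x ∈ Set.Ioo (-1 : ℝ) 1, |reduced X 0 x - P 0 x| ≤ C * (1 - x ^ 2) ^ n) :
    ∃ D, 0 ≤ D ∧ ∀ t ∈ Set.Icc 0 T₁, ∀ x : ℝ, 1 / 2 ≤ |x| → |x| < 1 →
      |reduced X t x - P t x| ≤ D ∧
      (0 < n → |reduced X t x - P t x| ≤ D * Real.sqrt (1 - |x|)) := by
  have hsol := hX.isReducedSolution_reduced.sub (hPs.mono (Set.subset_univ (Set.Ioo 0 T)))
  have hg2 : ∀ t x, deriv (deriv fun y => support X t (-y)) x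
      = deriv (deriv (support X t)) (-x) := by
    intro t x
    have : (deriv fun y => support X t (-y)) = fun y => -deriv (support X t) (-y) :=
      funext fun y => deriv_comp_neg (support X t) y
    rw [this, deriv.fun_neg, deriv_comp_neg (deriv (support X t)), neg_neg]
  have north := exists_bound_at_pole_of_even (n := n) (C := C) hT₁
    (k := fun t τ => supportFunction (fun p => X p t) (0 + 2 * Real.arcsin τ))
    (g := support X) (hX.contDiffOn_supportFunction_arcsin 0 2) hX.contDiffOn_support
    (fun t ht τ => by
      simp only [zero_add, Real.arcsin_neg, mul_neg]
      exact (hX.sphere t ht).supportFunction_neg _)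
    (fun t τ hτ => by rw [support, arccos_one_sub_two_mul_sq hτ, zero_add]) hP hsol hinit
  -- The south pole is the north pole after `x ↦ -x`, with `θ = π - 2 arcsin τ`. Evenness in `τ` now
  -- also uses the period `2 π`.
  have south := exists_bound_at_pole_of_even (n := n) (C := C) hT₁
    (k := fun t τ => supportFunction (fun p => X p t) (Real.pi + (-2) * Real.arcsin τ))
    (g := fun t x => support X t (-x)) (P := fun t x => P t (-x))
    (hX.contDiffOn_supportFunction_arcsin Real.pi (-2))
    (hX.contDiffOn_support.comp (f := fun q : ℝ × ℝ => (q.1, -q.2)) (by fun_prop)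
      fun q hq => ⟨hq.1, by constructor <;> linarith [hq.2.1, hq.2.2]⟩)
    (fun t ht τ => by
      rw [← (hX.sphere t ht).supportFunction_neg, ← supportFunction_add_two_pi, Real.arcsin_neg]
      congr 1; ring)
    (fun t τ hτ => by
      simp only [support]
      rw [Real.arccos_neg, arccos_one_sub_two_mul_sq hτ]
      congr 1; ring)
    (hP.comp (f := fun q : ℝ × ℝ => (q.1, -q.2)) (by fun_prop))
    (by simpa only [hg2, reduced] using hsol.comp_neg)
    (fun x hx => by
      have := hinit (-x) ⟨by linarith [hx.2], by linarith [hx.1]⟩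
      rw [neg_sq] at this
      simpa only [hg2, reduced] using this)
  obtain ⟨D₁, hD₁, h₁⟩ := north
  obtain ⟨D₂, hD₂, h₂⟩ := south
  refine ⟨max D₁ D₂, le_max_of_le_left hD₁, fun t ht x hx hx1 => ?_⟩
  -- This square root is the `τ` with `1 - 2 τ² = |x|`; the condition `1 / 2 ≤ |x|` gives `τ ≤ 1 /
  -- 2`.
  have hτ2 : Real.sqrt ((1 - |x|) / 2) ^ 2 = (1 - |x|) / 2 := Real.sq_sqrt (by linarith)
  have hτ0 : 0 < Real.sqrt ((1 - |x|) / 2) := Real.sqrt_pos.2 (by linarith)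
  have hτ1 : Real.sqrt ((1 - |x|) / 2) ≤ 1 / 2 := by
    nlinarith
  have hτs : Real.sqrt ((1 - |x|) / 2) ≤ Real.sqrt (1 - |x|) := Real.sqrt_le_sqrt (by linarith)
  have hxτ : 1 - 2 * Real.sqrt ((1 - |x|) / 2) ^ 2 = |x| := by rw [hτ2]; ring
  have key : ∀ D, 0 ≤ D → D ≤ max D₁ D₂ → (|reduced X t x - P t x| ≤ D ∧
      (0 < n → |reduced X t x - P t x| ≤ D * Real.sqrt ((1 - |x|) / 2))) →
      |reduced X t x - P t x| ≤ max D₁ D₂ ∧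
      (0 < n → |reduced X t x - P t x| ≤ max D₁ D₂ * Real.sqrt (1 - |x|)) := fun D h0 hD h =>
    ⟨h.1.trans hD, fun hn => (h.2 hn).trans
      (mul_le_mul hD hτs hτ0.le (h0.trans hD))⟩
  rcases le_total 0 x with h | h
  · have := h₁ t ht _ ⟨hτ0, hτ1⟩
    rw [hxτ, abs_of_nonneg h] at this
    rw [← abs_of_nonneg h] at this
    refine key D₁ hD₁ (le_max_left _ _) ?_
    rw [abs_of_nonneg h] at this ⊢
    exact this
  · have := h₂ t ht _ ⟨hτ0, hτ1⟩
    rw [hxτ, hg2] at this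
    refine key D₂ hD₂ (le_max_right _ _) ?_
    rw [abs_of_nonpos h, neg_neg] at this
    rw [abs_of_nonpos h]
    exact this

/-- The pole analysis needs smoothness at the pole, which `V` need not have at `t = 0`. It is
applied to the flow minus `P` alone; near the poles `(1 - x²)^n V` is controlled by boundedness of
`V`. -/
theorem reduced_eq {n : ℕ}
    (hX : IsLinearHopfFlow (1 + 2 * (1 / (2 * ((n : ℝ) + 1)))) psiInf T X)
    {P V : ℝ → ℝ → ℝ} (hP : ContDiff ℝ ∞ (fun q : ℝ × ℝ => P q.1 q.2))
    (hPs : IsReducedSolution (1 / (2 * ((n : ℝ) + 1))) Set.univ P)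
    (hV : ContinuousOn (fun q : ℝ × ℝ => V q.1 q.2) (Set.Ici 0 ×ˢ Set.Icc (-1) 1))
    (hVs : IsReducedSolution (1 / (2 * ((n : ℝ) + 1))) (Set.Ioi 0)
      (fun t x => (1 - x ^ 2) ^ n * V t x))
    (hinit : ∀ x ∈ Set.Ioo (-1 : ℝ) 1, reduced X 0 x = P 0 x + (1 - x ^ 2) ^ n * V 0 x)
    {t x : ℝ} (ht : t ∈ Set.Ico 0 T) (hx : x ∈ Set.Ioo (-1 : ℝ) 1) :
    reduced X t x = P t x + (1 - x ^ 2) ^ n * V t x := by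
  obtain ⟨M, hM⟩ := (isCompact_Icc.prod isCompact_Icc).exists_bound_of_continuousOn
    (hV.mono (Set.prod_mono (fun r (hr : r ∈ Set.Icc 0 t) => hr.1) Set.Subset.rfl))
  have hM' : ∀ r ∈ Set.Icc 0 t, ∀ y ∈ Set.Icc (-1 : ℝ) 1, |V r y| ≤ M := fun r hr y hy =>
    hM (r, y) ⟨hr, hy⟩
  have hM0 : 0 ≤ M := (abs_nonneg _).trans (hM' 0 ⟨le_rfl, ht.1⟩ 0 (by norm_num))
  have hw0 : ∀ y : ℝ, |y| < 1 → 0 ≤ 1 - y ^ 2 := fun y hy => by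
    rw [← sq_abs]; nlinarith [abs_nonneg y]
  obtain ⟨D, hD, hbd⟩ := hX.exists_bound_at_poles (C := M) ht.2 hP hPs fun y hy => by
    rw [hinit y hy, add_sub_cancel_left, abs_mul,
      abs_of_nonneg (pow_nonneg (hw0 y (abs_lt.2 hy)) n), mul_comm]
    exact mul_le_mul_of_nonneg_right (hM' 0 ⟨le_rfl, ht.1⟩ y ⟨hy.1.le, hy.2.le⟩)
      (pow_nonneg (hw0 y (abs_lt.2 hy)) n)
  have hz := ((hX.isReducedSolution_reduced.mono (J := Set.Ioc 0 t)
    fun r hr => ⟨hr.1, hr.2.trans_lt ht.2⟩).sub (hPs.mono (Set.subset_univ _))).sub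
      (hVs.mono fun r hr => hr.1)
  have h := hz.eq_zero_of_pole_bound (D := D + 2 * M) ?_ ?_ (by positivity) ?_ t ⟨ht.1, le_rfl⟩ x hx
  · linarith
  · refine ((hX.continuousOn_reduced.mono (Set.prod_mono (fun r hr => ⟨hr.1, hr.2.trans_lt ht.2⟩)
      Set.Subset.rfl)).sub hP.continuous.continuousOn).sub (ContinuousOn.mul (by fun_prop)
        (hV.mono (Set.prod_mono (fun r (hr : r ∈ Set.Icc 0 t) => hr.1)
          Set.Ioo_subset_Icc_self)))
  · intro y hy
    rw [hinit y hy]; ring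
  · intro r hr y hy hy1
    have hV1 := hM' r hr y (abs_le.1 hy1.le)
    have h1 := hw0 y hy1
    have h2 : 1 - y ^ 2 ≤ 1 := by nlinarith [sq_nonneg y]
    obtain ⟨hb1, hb2⟩ := hbd r hr y hy hy1
    have habs := abs_sub (reduced X r y - P r y) ((1 - y ^ 2) ^ n * V r y)
    rw [abs_mul, abs_of_nonneg (pow_nonneg h1 n)] at habs
    refine ⟨?_, fun hn => ?_⟩
    · have := mul_le_mul (pow_le_one₀ (n := n) h1 h2) hV1 (abs_nonneg _) zero_le_one
      linarith
    -- For `n ≥ 1` the series part tends to zero at the poles at least as fast as the bound obtained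
    -- for the flow.
    · have h3 : (1 - y ^ 2) ^ n ≤ 2 * Real.sqrt (1 - |y|) := by
        have h4 := pow_le_of_le_one h1 h2 hn.ne'
        have h5 := Real.sq_sqrt (x := 1 - |y|) (by linarith)
        have h6 : Real.sqrt (1 - |y|) ≤ 1 := Real.sqrt_le_one.2 (by linarith)
        have h7 := Real.sqrt_nonneg (1 - |y|)
        have h8 : 1 - y ^ 2 ≤ 2 * (1 - |y|) := by
          rw [← sq_abs y]; nlinarith [sq_nonneg (1 - |y|)]
        nlinarith
      have := mul_le_mul h3 hV1 (abs_nonneg _) (by positivity)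
      have := hb2 hn
      linarith

end IsLinearHopfFlow

/-! ### The mode expansion in the variable `cos θ` -/

theorem sin_sq_pow_succ (n : ℕ) (θ : ℝ) :
    Real.sin θ ^ (2 * n + 2) = Real.sin θ ^ 2 * (1 - Real.cos θ ^ 2) ^ n := by
  rw [← Real.sin_sq, ← pow_mul, ← pow_add, add_comm]

/-- On `[0, π]` the square root in `P^n_l (cos θ)` is `sin θ`. Each mode is then `sin^(2 n + 2) θ`
times a polynomial in `cos θ`, and the relative convergence becomes plain uniform convergence of
polynomials. -/
theorem sum_modes_eq (n N : ℕ) (c : ℕ → ℝ) {θ : ℝ} (hθ : θ ∈ Set.Icc 0 Real.pi) :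
    ∑ l ∈ Finset.Ico n N, c l * (Real.sin θ ^ (2 + n) * assocLegendre n l (Real.cos θ))
      = Real.sin θ ^ (2 * n + 2)
        * ∑ k ∈ Finset.range (N - n), c (n + k) * (legendreFactor n (n + k)).eval (Real.cos θ) := by
  have hs : Real.sqrt (1 - Real.cos θ ^ 2) = Real.sin θ := by
    rw [← Real.sin_sq, Real.sqrt_sq (Real.sin_nonneg_of_mem_Icc hθ)]
  rw [Finset.sum_Ico_eq_sum_range, Finset.mul_sum]
  refine Finset.sum_congr rfl fun k _ => ?_
  rw [assocLegendre_eq, hs]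
  ring

theorem hasModeExpansion_iff {n : ℕ} {s : ℝ → ℝ} {a b c : ℕ → ℝ} :
    HasModeExpansion n s a b c ↔ ∀ ε > 0, ∃ N₀, ∀ N ≥ N₀, ∀ θ ∈ Set.Icc 0 Real.pi,
      |s θ - (Real.sin θ ^ 2 * (∑ l ∈ Finset.range n,
            (a l + b l * Real.cos θ) * (1 - Real.cos θ ^ 2) ^ l)
          + Real.sin θ ^ (2 * n + 2)
            * ∑ k ∈ Finset.range N, c (n + k) * (legendreFactor n (n + k)).eval (Real.cos θ))|
        ≤ ε * Real.sin θ ^ (2 * n + 2) := by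
  have hpoly : ∀ θ, ∑ l ∈ Finset.range n, (a l + b l * Real.cos θ) * Real.sin θ ^ (2 * l + 2)
      = Real.sin θ ^ 2 * ∑ l ∈ Finset.range n,
          (a l + b l * Real.cos θ) * (1 - Real.cos θ ^ 2) ^ l := fun θ => by
    rw [Finset.mul_sum]
    refine Finset.sum_congr rfl fun l _ => ?_
    rw [sin_sq_pow_succ]; ring
  constructor
  · intro h ε hε
    obtain ⟨N₀, hN₀⟩ := h ε hε
    refine ⟨N₀, fun N hN θ hθ => ?_⟩
    have := hN₀ (N + n) (by omega) θ hθ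
    rwa [hpoly, sum_modes_eq n _ c hθ, Nat.add_sub_cancel] at this
  · intro h ε hε
    obtain ⟨N₀, hN₀⟩ := h ε hε
    refine ⟨N₀ + n, fun N hN θ hθ => ?_⟩
    rw [hpoly, sum_modes_eq n _ c hθ]
    exact hN₀ (N - n) (by omega) θ hθ

theorem HasModeExpansion.eq_of_mem {n : ℕ} {s s' : ℝ → ℝ} {a b c : ℕ → ℝ}
    (h : HasModeExpansion n s a b c) (h' : HasModeExpansion n s' a b c) {θ : ℝ}
    (hθ : θ ∈ Set.Icc 0 Real.pi) : s θ = s' θ := by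
  refine eq_of_abs_sub_le_all fun ε hε => ?_
  obtain ⟨N, hN⟩ := h (ε / 2) (by positivity)
  obtain ⟨N', hN'⟩ := h' (ε / 2) (by positivity)
  have h1 := hN _ (le_max_left N N') θ hθ
  have h2 := hN' _ (le_max_right N N') θ hθ
  have h3 : Real.sin θ ^ (2 * n + 2) ≤ 1 :=
    pow_le_one₀ (Real.sin_nonneg_of_mem_Icc hθ) (Real.sin_le_one θ)
  have h4 : ε / 2 * Real.sin θ ^ (2 * n + 2) ≤ ε / 2 := mul_le_of_le_one_right (by positivity) h3
  rw [abs_le] at *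
  constructor <;> linarith

theorem HasModeExpansion.congr_coeff {n : ℕ} {s : ℝ → ℝ} {a b c a' b' c' : ℕ → ℝ}
    (h : HasModeExpansion n s a b c) (ha : ∀ l < n, a l = a' l) (hb : ∀ l < n, b l = b' l)
    (hc : ∀ l, c l = c' l) : HasModeExpansion n s a' b' c' := by
  obtain rfl : c = c' := funext hc
  intro ε hε
  obtain ⟨N₀, hN₀⟩ := h ε hε
  refine ⟨N₀, fun N hN θ hθ => ?_⟩
  have : ∑ l ∈ Finset.range n, (a' l + b' l * Real.cos θ) * Real.sin θ ^ (2 * l + 2)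
      = ∑ l ∈ Finset.range n, (a l + b l * Real.cos θ) * Real.sin θ ^ (2 * l + 2) :=
    Finset.sum_congr rfl fun l hl => by
      rw [ha l (Finset.mem_range.1 hl), hb l (Finset.mem_range.1 hl)]
  rw [this]
  exact hN₀ N hN θ hθ

/-- The series part of a mode expansion converges uniformly in the variable `cos θ`. -/
theorem HasModeExpansion.exists_uniform_limit {n : ℕ} {s : ℝ → ℝ} {a b c : ℕ → ℝ}
    (h : HasModeExpansion n s a b c) :
    ∃ g : ℝ → ℝ, ∀ ε > 0, ∃ N₀, ∀ N ≥ N₀, ∀ x ∈ Set.Ioo (-1 : ℝ) 1,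
      |g x - ∑ k ∈ Finset.range N, c (n + k) * (legendreFactor n (n + k)).eval x| ≤ ε := by
  -- The expansion solved for the sum of the series, by division by `sin^(2 n + 2) θ`; hence the
  -- open interval.
  refine ⟨fun x => (s (Real.arccos x) - (1 - x ^ 2) * ∑ l ∈ Finset.range n,
    (a l + b l * x) * (1 - x ^ 2) ^ l) / ((1 - x ^ 2) * (1 - x ^ 2) ^ n), fun ε hε => ?_⟩
  obtain ⟨N₀, hN₀⟩ := hasModeExpansion_iff.1 h ε hε
  refine ⟨N₀, fun N hN x hx => ?_⟩
  have h1 := hN₀ N hN (Real.arccos x) ⟨Real.arccos_nonneg x, Real.arccos_le_pi x⟩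
  rw [sin_sq_pow_succ, Real.sin_sq, Real.cos_arccos hx.1.le hx.2.le] at h1
  have h2 : 0 < 1 - x ^ 2 := by nlinarith [hx.1, hx.2]
  have h3 : 0 < (1 - x ^ 2) * (1 - x ^ 2) ^ n := by positivity
  refine le_of_mul_le_mul_right (le_trans (le_of_eq ?_) h1) h3
  rw [← abs_of_pos h3, ← abs_mul, abs_of_pos h3, sub_mul, div_mul_cancel₀ _ h3.ne']
  congr 1
  ring

theorem contDiff_modeAmplitude (n : ℕ) (δ : ℝ) (x : ℕ → ℝ) (l : ℕ) :
    ContDiff ℝ ∞ (modeAmplitude n δ x l) := by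
  unfold modeAmplitude
  fun_prop

theorem contDiff_polynomialPart (n : ℕ) {A B : ℕ → ℝ → ℝ} (hA : ∀ l, ContDiff ℝ ∞ (A l))
    (hB : ∀ l, ContDiff ℝ ∞ (B l)) :
    ContDiff ℝ ∞ (fun q : ℝ × ℝ => polynomialPart n A B q.1 q.2) := by
  unfold polynomialPart
  fun_prop

/-! ### The solution and its agreement with every flow. -/

theorem theorem5 (n : ℕ) (psiInf : ℝ) (hpsi : 0 < psiInf)
    (X₀ : S2 → E3) (hX₀ : IsRotSphere X₀) (hconv : IsConvexSphere X₀)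
    (a b c : ℕ → ℝ) (hdec : HasModeExpansion n (astigmatism X₀) a b c) :
    ∃ a' b' : ℕ → ℝ,
      (∀ x : ℕ → ℝ, InitialRelation n 0 a x ↔ ∀ l, l < n → x l = a' l) ∧
      (∀ x : ℕ → ℝ, InitialRelation n (1 / 2) b x ↔ ∀ l, l < n → x l = b' l) ∧
      ∃ s : ℝ → ℝ → ℝ,
        (∀ t, 0 ≤ t → HasModeExpansion n (s t)
          (fun l => modeAmplitude n 0 a' l t)
          (fun l => modeAmplitude n (1 / 2) b' l t)
          (fun l => c l * Real.exp (-rateOmega n l * t))) ∧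
        SolvesAstigmatismEquation (hopfLam n) (astigmatism X₀) s ∧
        ∀ (T : ℝ) (X : S2 → ℝ → E3), 0 < T → IsLinearHopfFlow (hopfLam n) psiInf T X →
          (∀ p, X p 0 = X₀ p) →
          ∀ t ∈ Set.Ico 0 T, ∀ θ ∈ Set.Icc 0 Real.pi,
            astigmatism (fun p => X p t) θ = s t θ := by
  obtain ⟨a', ha'⟩ := exists_initialRelation_iff n 0 a
  obtain ⟨b', hb'⟩ := exists_initialRelation_iff n (1 / 2) b
  obtain ⟨g, hg⟩ := hdec.exists_uniform_limit
  obtain ⟨V, hVseries, hVcont, hVsol⟩ := exists_mode_series n c g hg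
  set P := polynomialPart n (modeAmplitude n 0 a') (modeAmplitude n (1 / 2) b') with hPdef
  have hP : ContDiff ℝ ∞ (fun q : ℝ × ℝ => P q.1 q.2) :=
    contDiff_polynomialPart n (contDiff_modeAmplitude n 0 a') (contDiff_modeAmplitude n (1 / 2) b')
  have hPsol : IsReducedSolution (1 / (2 * ((n : ℝ) + 1))) Set.univ P :=
    isReducedSolution_polynomialPart n
      (fun l hl t => by simpa only [add_zero] using
        hasDerivAt_modeAmplitude n (Or.inl rfl) a' hl t)
      (fun l hl t => hasDerivAt_modeAmplitude n (Or.inr rfl) b' hl t)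
  have hexp : ∀ t, 0 ≤ t → HasModeExpansion n
      (fun θ => Real.sin θ ^ 2 * (P t (Real.cos θ)
        + (1 - Real.cos θ ^ 2) ^ n * V t (Real.cos θ)))
      (fun l => modeAmplitude n 0 a' l t) (fun l => modeAmplitude n (1 / 2) b' l t)
      (fun l => c l * Real.exp (-rateOmega n l * t)) := by
    intro t ht
    rw [hasModeExpansion_iff]
    intro ε hε
    obtain ⟨N₀, hN₀⟩ := hVseries ε hε
    refine ⟨N₀, fun N hN θ hθ => ?_⟩
    have h1 := hN₀ N hN t ht (Real.cos θ) ⟨Real.neg_one_le_cos θ, Real.cos_le_one θ⟩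
    have h2 : 0 ≤ Real.sin θ ^ (2 * n + 2) := pow_nonneg (Real.sin_nonneg_of_mem_Icc hθ) _
    have h3 : ∑ k ∈ Finset.range N, c (n + k) * Real.exp (-rateOmega n (n + k) * t)
          * (legendreFactor n (n + k)).eval (Real.cos θ)
        = ∑ k ∈ Finset.range N, c (n + k) * (legendreFactor n (n + k)).eval (Real.cos θ)
          * Real.exp (-rateOmega n (n + k) * t) := Finset.sum_congr rfl fun k _ => by ring
    rw [h3, ← polynomialPart.eq_1, ← hPdef, mul_comm ε]
    refine le_trans (le_of_eq ?_) (mul_le_mul_of_nonneg_left h1 h2)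
    rw [← abs_of_nonneg h2, ← abs_mul, abs_of_nonneg h2, sin_sq_pow_succ]
    congr 1
    ring
  -- At `t = 0` the constructed function and the given astigmatism have the same expansion, and an
  -- expansion determines its function on `[0, π]`.
  have hinit : ∀ θ ∈ Set.Icc 0 Real.pi, Real.sin θ ^ 2 * (P 0 (Real.cos θ)
      + (1 - Real.cos θ ^ 2) ^ n * V 0 (Real.cos θ)) = astigmatism X₀ θ := fun θ hθ =>
    ((hexp 0 le_rfl).congr_coeff
      (fun l hl => modeAmplitude_zero ((ha' a').2 fun _ _ => rfl) hl)
      (fun l hl => modeAmplitude_zero ((hb' b').2 fun _ _ => rfl) hl)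
      (fun l => by simp)).eq_of_mem hdec hθ
  refine ⟨a', b', ha', hb', fun t θ => Real.sin θ ^ 2 * (P t (Real.cos θ)
    + (1 - Real.cos θ ^ 2) ^ n * V t (Real.cos θ)), hexp, ?_, ?_⟩
  · exact IsReducedSolution.solvesAstigmatismEquation
      ((hPsol.mono (Set.subset_univ _)).add hVsol)
      (hP.continuous.continuousOn.add (ContinuousOn.mul (by fun_prop) hVcont)) hinit
  · intro T X hT hX hX0 t ht θ hθ
    have hlam : hopfLam n = 1 + 2 * (1 / (2 * ((n : ℝ) + 1))) := by
      rw [hopfLam]; field_simp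
    rw [hlam] at hX
    obtain rfl : (fun p => X p 0) = X₀ := funext hX0
    -- The reduced variable covers only the open interval; at the poles both sides vanish, on the
    -- flow's side because the poles are umbilic.
    by_cases hθs : Real.sin θ = 0
    · rw [(hX.sphere t ht).astigmatism_eq_zero_of_sin_eq_zero hθs]
      simp only [hθs]
      ring
    · have hθ' : θ ∈ Set.Ioo 0 Real.pi := by
        refine ⟨hθ.1.lt_of_ne ?_, hθ.2.lt_of_ne ?_⟩
        · rintro rfl; exact hθs Real.sin_zero
        · rintro rfl; exact hθs Real.sin_pi
      rw [hX.astigmatism_eq_reduced ht hθ',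
        hX.reduced_eq hP hPsol hVcont hVsol ?_ ht (IsLinearHopfFlow.cos_mem_Ioo hθ')]
      intro x hx
      have hα : Real.arccos x ∈ Set.Ioo 0 Real.pi :=
        ⟨Real.arccos_pos.2 hx.2, Real.arccos_lt_pi.2 hx.1⟩
      have h1 := hinit (Real.arccos x) ⟨hα.1.le, hα.2.le⟩
      rw [hX.astigmatism_eq_reduced ⟨le_rfl, hT⟩ hα, Real.cos_arccos hx.1.le hx.2.le] at h1
      exact (mul_left_cancel₀ (pow_pos (Real.sin_pos_of_mem_Ioo hα) 2).ne' h1).symm
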